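/- Let $n\ge 4$. A polytopal subdivision $\Sigma$ of $\Delta_2\times\Delta_{n-4}$ is meant without new vertices. The Cayley trick replaces each maximal cell of $\Sigma$ by the labelled Minkowski cell $C=C_1+\dots+C_{n-3}$, where $C_j=\mathrm{conv}\{e_a : (e_a,e_j) \text{ is a vertex of the cell}\}$; the resulting family is denoted $M(\Sigma)$. A mixed subdivision of $(n-3)\Delta_2$ is a subdivision into full-dimensional labelled Minkowski cells $C=C_1+\dots+C_{n-3}$, with all $C_j$ nonempty faces of $\Delta_2$, any two of which are disjoint or meet in a common labelled face. It is fine if $\sum_j\dim C_j=2$ for every maximal cell $C$ (the cells are then unit upward triangles and lozenges). Trees here are finite trees without nodes of degree two whose leaves are bijectively labelled. An abstract arrangement of $n$ trees is an $n$-tuple of trees $T_i$, where $T_i$ has leaf set $[n]\setminus\{i\}$, such that: $n=4$; or $n=5$ and the $T_i$ are the five quartets (subtrees induced by four of the leaves) of one tree with five leaves; or $n\ge 6$ and for each $i$ the trees $T_j\setminus i$ $(j\ne i)$, obtained by deleting the leaf $i$, form an abstract arrangement of $n-1$ trees. Let $M$ be a mixed subdivision of $(n-3)\Delta_2$. Take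 as labels the elements of $\{1,\dots,n-3\}$ (tropical pseudolines) and $x,y,z$ (boundary lines); side $a\in\{x,y,z\}$ of $(n-3)\Delta_2$ is the side on which coordinate $a$ vanishes. Define graphs $T_\ell(M)$, one for each label $\ell$, as follows. * For a pseudoline $i$, the nodes of $T_i(M)$ are the maximal cells $C$ with $\dim C_i\ge1$. Two nodes are adjacent if the cells share an edge $E$ with $\dim E_i=1$. The leaf $a\in\{x,y,z\}$ is attached to the cell having such an edge on side $a$, and the leaf $j\neq i$ is attached to the cell $C$ with $\dim C_i,\dim C_j\ge 1$ and $\dim(C_i+C_j)=2$, in which the pseudolines $i$ and $j$ cross. * For a boundary line $a$, the nodes of $T_a(M)$ are the edges of $M$ on side $a$, and two nodes are adjacent if the edges share a vertex. The leaf $j$ is attached to the edge $E$ with $\dim E_j=1$, and each leaf $b\in\{x,y,z\}\setminus\{a\}$ is attached to the edge containing the common corner of the sides $a$ and $b$. Then the following hold. 1. For every polytopal subdivision $\Sigma$ of $\Delta_2\times\Delta_{n-4}$, $M(\Sigma)$ is a mixed subdivision of $(n-3)\Delta_2$, and the graphs $T(\Sigma)=(T_\ell(M(\Sigma)))_\ell$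 form an abstract arrangement of $n$ trees. If $\Sigma'$ is any triangulation refining $\Sigma$, then $M(\Sigma')$ is fine, and each tree of $T(\Sigma)$ is obtained from the corresponding tree of $T(\Sigma')$ by contracting edges. 2. For every mixed subdivision $M$ of $(n-3)\Delta_2$, the graphs $(T_\ell(M))_\ell$ form an abstract arrangement of $n$ trees. If $M'$ is any fine mixed subdivision refining $M$ (as labelled subdivisions), then each tree of $M$ is obtained from the corresponding tree of $M'$ by contracting edges. -/

import Mathlib

/-! ### Trees with labelled leaves and abstract tree arrangements -/

/-- A graph some of whose vertices carry labels from a subset `labels` of `L`. -/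
structure LabelledGraph (L : Type) where
  /-- the vertices -/
  V : Type
  /-- the graph -/
  graph : SimpleGraph V
  /-- the labels in use -/
  labels : Set L
  /-- the vertex carrying a given label -/
  leaf : labels → V

namespace LabelledGraph

variable {L : Type}

/-- The labelled graph is a (finite) tree with leaf set `X`: the labels are the elements of `X`, they
are in bijection with the vertices of degree one, and (as is usual for combinatorial trees with
labelled leaves) there is no vertex of degree two. -/
def IsTreeWithLeaves (T : LabelledGraph L) (X : Set L) : Prop :=
  T.labels = X ∧ Finite T.V ∧ T.graph.IsTree ∧ Function.Injective T.leaf ∧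
    (∀ v : T.V, v ∈ Set.range T.leaf ↔ (T.graph.neighborSet v).ncard = 1) ∧
    ∀ v : T.V, (T.graph.neighborSet v).ncard ≠ 2

/-- Vertices lying on a path between two leaves different from the leaf `i`. -/
def spanWithout (T : LabelledGraph L) (i : L) : Set T.V :=
  {v | ∃ x y : T.labels, (x : L) ≠ i ∧ (y : L) ≠ i ∧
    ∃ p : T.graph.Walk (T.leaf x) (T.leaf y), p.IsPath ∧ v ∈ p.support}

/-- Deleting the leaf `i` from a tree: what remains is the subtree spanned by all other leaves.
(Nodes of degree two that may arise are kept; they are irrelevant for `SameQuartets` below.) -/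
def delete (T : LabelledGraph L) (i : L) : LabelledGraph L where
  V := T.spanWithout i
  graph := T.graph.induce (T.spanWithout i)
  labels := T.labels \ {i}
  leaf := fun x => ⟨T.leaf ⟨x.1, x.2.1⟩,
    ⟨x.1, x.2.1⟩, ⟨x.1, x.2.1⟩, x.2.2, x.2.2, SimpleGraph.Walk.nil, by simp, by simp⟩

/-- The tree induces the quartet `ab|cd`: the path from `a` to `b` and the path from `c` to `d` are
disjoint. -/
def Displays (T : LabelledGraph L) (a b c d : L) : Prop :=
  ∃ (ha : a ∈ T.labels) (hb : b ∈ T.labels) (hc : c ∈ T.labels) (hd : d ∈ T.labels)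
    (p : T.graph.Walk (T.leaf ⟨a, ha⟩) (T.leaf ⟨b, hb⟩))
    (q : T.graph.Walk (T.leaf ⟨c, hc⟩) (T.leaf ⟨d, hd⟩)),
    p.IsPath ∧ q.IsPath ∧ ∀ v, v ∈ p.support → v ∉ q.support

/-- Two trees have the same leaf labels and induce the same quartets. A tree with four labelled
leaves is either a star or has exactly one split `ab|cd`; so for trees with four leaves this says
that they are the same leaf-labelled tree. -/
def SameQuartets (T T' : LabelledGraph L) : Prop :=
  T.labels = T'.labels ∧
    ∀ a b c d : L, [a, b, c, d].Nodup → (T.Displays a b c d ↔ T'.Displays a b c d)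

/-- The tree `T` is obtained from the tree `T'` by contracting edges: there is a map onto the
vertices of `T` that keeps the leaf labels, has connected fibres, and for which the edges of `T` are
exactly the images of the edges of `T'` that are not collapsed. -/
def IsContractionOf (T T' : LabelledGraph L) : Prop :=
  T.labels = T'.labels ∧
  ∃ f : T'.V → T.V, Function.Surjective f ∧
    (∀ (x : L) (hx : x ∈ T.labels) (hx' : x ∈ T'.labels), f (T'.leaf ⟨x, hx'⟩) = T.leaf ⟨x, hx⟩) ∧
    (∀ v, (T'.graph.induce (f ⁻¹' {v})).Connected) ∧
    ∀ v w, T.graph.Adj v w ↔ v ≠ w ∧ ∃ v' w', f v' = v ∧ f w' = w ∧ T'.graph.Adj v' w'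

end LabelledGraph

/-- The recursive condition on an arrangement of `k + 4` trees, indexed by the `k + 4` elements of
`S`: nothing for four trees; five trees have to be the quartets of one tree with five leaves; and for
at least six trees, deleting the tree `T i` and the leaf `i` from all other trees has to give, for
each `i`, a family satisfying the condition for one tree less. -/
def ArrangementCondition {L : Type} [DecidableEq L] :
    ℕ → Finset L → (L → LabelledGraph L) → Prop
  | 0, _, _ => True
  | 1, S, T => ∃ T₀ : LabelledGraph L, T₀.IsTreeWithLeaves (S : Set L) ∧
      ∀ i ∈ S, (T i).SameQuartets (T₀.delete i)
  | k + 2, S, T => ∀ i ∈ S, ArrangementCondition (k + 1) (S.erase i) (fun j => (T j).delete i)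

/-- `(T i)`, for `i ∈ S`, is an abstract arrangement of `n` trees, where `n = S.card`. -/
def IsAbstractTreeArrangement {L : Type} [DecidableEq L] (S : Finset L)
    (T : L → LabelledGraph L) : Prop :=
  4 ≤ S.card ∧ (∀ i ∈ S, (T i).IsTreeWithLeaves ((S : Set L) \ {i})) ∧
    ArrangementCondition (S.card - 4) S T

/-! ### Polytopal subdivisions of a product of simplices `Δ₂ × Δₘ₋₁` -/

/-- The vertex `(e_a, e_j)` of `Δ₂ × Δₘ₋₁`. -/
def prodVertex (m : ℕ) (p : Fin 3 × Fin m) : (Fin 3 → ℝ) × (Fin m → ℝ) :=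
  (Pi.single p.1 1, Pi.single p.2 1)

/-- The polytope spanned by a set of vertices of `Δ₂ × Δₘ₋₁`. -/
def cellPolytope {m : ℕ} (σ : Finset (Fin 3 × Fin m)) : Set ((Fin 3 → ℝ) × (Fin m → ℝ)) :=
  convexHull ℝ (prodVertex m '' (σ : Set (Fin 3 × Fin m)))

/-- The polytope `Δ₂ × Δₘ₋₁`. -/
def simplexProduct (m : ℕ) : Set ((Fin 3 → ℝ) × (Fin m → ℝ)) :=
  stdSimplex ℝ (Fin 3) ×ˢ stdSimplex ℝ (Fin m)

/-- A polytopal subdivision of `Δ₂ × Δₘ₋₁` (without new vertices), given by the vertex sets of its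
maximal cells: these are full-dimensional, cover the polytope, and any two of them intersect in a
common (possibly empty) face. -/
def IsPolytopalSubdivision {m : ℕ} (S : Finset (Finset (Fin 3 × Fin m))) : Prop :=
  (∀ σ ∈ S, affineSpan ℝ (cellPolytope σ) = affineSpan ℝ (simplexProduct m)) ∧
  (⋃ σ ∈ S, cellPolytope σ) = simplexProduct m ∧
  ∀ σ ∈ S, ∀ τ ∈ S, IsExposed ℝ (cellPolytope σ) (cellPolytope σ ∩ cellPolytope τ)

/-- A polytopal subdivision all of whose cells are simplices. -/
def IsTriangulation {m : ℕ} (S : Finset (Finset (Fin 3 × Fin m))) : Prop :=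
  IsPolytopalSubdivision S ∧
  ∀ σ ∈ S, AffineIndependent ℝ (fun p : σ => prodVertex m p)

/-- `S'` refines `S`: each cell of `S'` lies in a cell of `S`. -/
def Refines {m : ℕ} (S' S : Finset (Finset (Fin 3 × Fin m))) : Prop :=
  ∀ τ ∈ S', ∃ σ ∈ S, cellPolytope τ ⊆ cellPolytope σ

/-! ### Mixed subdivisions of the dilated triangle `m Δ₂` -/

/-- A (labelled) Minkowski cell `c`: it stands for the Minkowski sum over `j` of the faces
`conv {e_a : a ∈ c j}` of the triangle `Δ₂`. -/
abbrev MixedCell (m : ℕ) := Fin m → Finset (Fin 3)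

/-- The polygon (or segment, or point) given by a Minkowski cell. -/
def MixedCell.polytope {m : ℕ} (c : MixedCell m) : Set (Fin 3 → ℝ) :=
  {x | ∃ y : Fin m → Fin 3 → ℝ,
    (∀ j, y j ∈ convexHull ℝ ((fun a : Fin 3 => (Pi.single a 1 : Fin 3 → ℝ)) '' (c j : Set (Fin 3))))
      ∧ x = ∑ j, y j}

/-- The dilated triangle `m Δ₂`. -/
def dilatedTriangle (m : ℕ) : Set (Fin 3 → ℝ) :=
  {x | ∃ y ∈ stdSimplex ℝ (Fin 3), x = (m : ℝ) • y}

/-- `F` is a face of the Minkowski cell `c`: all of its summands consist of the minimizers of one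
linear functional. -/
def MixedCell.IsFace {m : ℕ} (F c : MixedCell m) : Prop :=
  ∃ w : Fin 3 → ℝ, ∀ j a, a ∈ F j ↔ a ∈ c j ∧ ∀ b ∈ c j, w a ≤ w b

/-- A mixed subdivision of `m Δ₂ = Δ₂ + ⋯ + Δ₂`, given by its maximal cells: these are Minkowski
cells, full-dimensional, they cover the triangle, and any two that meet intersect in a common face,
as Minkowski cells. -/
def IsMixedSubdivision {m : ℕ} (M : Finset (MixedCell m)) : Prop :=
  (∀ c ∈ M, (∀ j, (c j).Nonempty) ∧
    affineSpan ℝ c.polytope = affineSpan ℝ (dilatedTriangle m)) ∧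
  (⋃ c ∈ M, MixedCell.polytope c) = dilatedTriangle m ∧
  ∀ c ∈ M, ∀ d ∈ M, c.polytope ∩ d.polytope = ∅ ∨
    ∃ F : MixedCell m, F.IsFace c ∧ F.IsFace d ∧ c.polytope ∩ d.polytope = F.polytope

/-- A mixed subdivision is fine if in each cell the dimensions of the `m` summands add up to two,
the dimension of the cell. Its cells are then unit upward triangles (one summand is `Δ₂`, the others
are points) and unit lozenges (two summands are non-parallel edges, the others are points). -/
def IsFineMixedSubdivision {m : ℕ} (M : Finset (MixedCell m)) : Prop :=
  IsMixedSubdivision M ∧ ∀ c ∈ M, ∑ j, ((c j).card - 1) = 2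

/-- `M'` refines `M`, as subdivisions into labelled Minkowski cells. -/
def MixedRefines {m : ℕ} (M' M : Finset (MixedCell m)) : Prop :=
  ∀ c' ∈ M', ∃ c ∈ M, ∀ j, c' j ⊆ c j

/-- The Cayley trick: a cell `σ` of a subdivision of `Δ₂ × Δₘ₋₁` becomes the Minkowski cell whose
`j`-th summand is spanned by the `e_a` such that `(e_a, e_j)` is a vertex of `σ`. -/
def cayley {m : ℕ} (S : Finset (Finset (Fin 3 × Fin m))) : Finset (MixedCell m) :=
  S.image fun σ j => Finset.univ.filter fun a => (a, j) ∈ σ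

/-! ### The trees of a mixed subdivision

The `m + 3` labels are the boundary lines `Sum.inl a` (`a = 0, 1, 2`, that is `x, y, z`) and the
tropical pseudolines `Sum.inr i` (`i` in `Fin m`). The side `a` of `m Δ₂` is the side where the
coordinate `a` vanishes. All edges that are dual to the pseudoline `i` have a segment as their `i`-th
summand; in a fine mixed subdivision they are exactly the edges parallel, through a chain of
lozenges, to an edge of the upward triangle whose `i`-th summand is `Δ₂`. The intersection of a Minkowski cell `c` with the side `a` is the Minkowski
cell `fun j => (c j).erase a`, provided all these sets are nonempty; otherwise it is empty. -/

/-- The labels of the trees. -/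
abbrev TreeLabel (m : ℕ) := Fin 3 ⊕ Fin m

/-- The edge `e` of the subdivision is contained in side `a` of the big triangle. -/
def IsBoundaryEdge {m : ℕ} (M : Finset (MixedCell m)) (a : Fin 3) (e : MixedCell m) : Prop :=
  (∃ c ∈ M, ∀ j, e j = (c j).erase a) ∧ (∀ j, (e j).Nonempty) ∧ ∃ j, 2 ≤ (e j).card

/-- The nodes of the tree with label `ℓ`, as Minkowski cells. The inner tree `i` has as its nodes the
cells through which the tropical pseudoline `i` passes, that is, the cells whose `i`-th summand is not
a point. The tree of the boundary line `a` has the edges on side `a` as its nodes. -/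
def IsTreeNode {m : ℕ} (M : Finset (MixedCell m)) : TreeLabel m → MixedCell m → Prop
  | .inl a, e => IsBoundaryEdge M a e
  | .inr i, c => c ∈ M ∧ 2 ≤ (c i).card

/-- Two nodes of the tree with label `ℓ` are adjacent. In the tree of a boundary line: the two edges
of the subdivision have a common vertex. In the inner tree `i`: the two cells have a common edge
belonging to the pseudoline `i`, i.e. an edge whose `i`-th summand is not a point. -/
def NodeAdj {m : ℕ} : TreeLabel m → MixedCell m → MixedCell m → Prop
  | .inl _, e, e' => ∀ j, (e j ∩ e' j).Nonempty
  | .inr i, c, c' => (∀ j, (c j ∩ c' j).Nonempty) ∧ 2 ≤ (c i ∩ c' i).card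

/-- The leaf with a given label (third argument) is attached to a given node (second argument) of
the tree with label `ℓ` (first argument).
* On side `a`: the leaf of the boundary line `b` is attached to the edge that contains the common
  corner of the sides `a` and `b`; the leaf `j` is attached to the edge in which the pseudoline `j`
  ends, i.e. whose `j`-th summand is not a point.
* In the inner tree `i`: the leaf of the boundary line `a` is attached to the cell that has an edge
  of the pseudoline `i` on side `a`; the leaf `j` is attached to the cell in which the pseudolines
  `i` and `j` cross, i.e. the Minkowski sum of the `i`-th and the `j`-th summand is two-dimensional
  and none of them is a point. -/
def LeafAdj {m : ℕ} : TreeLabel m → MixedCell m → TreeLabel m → Prop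
  | .inl _, e, .inl b => ∀ j, ((e j).erase b).Nonempty
  | .inl _, e, .inr j => 2 ≤ (e j).card
  | .inr i, c, .inl a => (∀ j, ((c j).erase a).Nonempty) ∧ 2 ≤ ((c i).erase a).card
  | .inr i, c, .inr j => 2 ≤ (c i).card ∧ 2 ≤ (c j).card ∧ 3 ≤ (c i ∪ c j).card

/-- The tree with label `ℓ` of the mixed subdivision `M`: a vertex is a node or a leaf, and the leaves
are the labels different from `ℓ`. -/
def mixedTree {m : ℕ} (M : Finset (MixedCell m)) (ℓ : TreeLabel m) : LabelledGraph (TreeLabel m) where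
  V := {c : MixedCell m // IsTreeNode M ℓ c} ⊕ {k : TreeLabel m // k ≠ ℓ}
  graph := SimpleGraph.fromRel fun v w =>
    match v, w with
    | .inl c, .inl c' => NodeAdj ℓ c.1 c'.1
    | .inl c, .inr k => LeafAdj ℓ c.1 k.1
    | .inr _, _ => False
  labels := {k | k ≠ ℓ}
  leaf := fun k => .inr ⟨k.1, k.2⟩

/-! ### Rooted trees given by a parent function -/

/-! Every label is treated as a tropical line with up to three legs. At a Minkowski cell `N` the
summand `N k` records the position of the cell relative to the line `k`: a singleton `{r}` is a
sector, `{r}ᶜ` means that the cell lies on the leg coming from side `r`, and all of `Fin 3` is the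
apex. Going up the leg `r` of a line increases the coordinate `r`. Another line `k` is crossed where
`r ∈ N k` and `N k ≠ {r}`, and it has been passed once `N k = {r}`. So the upper edge of a cell on
this leg splits the labels into those with `r ∈ N k` and the others.

Trees: the cells on a line form chains, one per leg, that are glued at the apex; a boundary line is
a single chain. This is axiomatized by `IsSpider`. Rooted at its last cell, the line becomes a tree:
a passed line stays passed, so each label is attached exactly once, and each cell on a leg has a
crossing, so no degree is two. The displayed quartets are the splits at upper edges
(`IsRootedSpider.displays_iff`). If one subdivision refines another, sending a cell to the cell that
contains it respects steps up the legs or collapses them, and hence contracts the trees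
(`IsRootedSpider.isContractionOf`).

Arrangements: deleting a leaf only restricts the set of quartets
(`LabelledGraph.displays_delete_iff`), so the recursive condition reduces to five labels. The
property that is inherited is `QuartetsCompatible`: if the tree `i` displays `ab|cd`, then the tree
`c` displays `ab|di` or the tree `a` displays `cd|bi`. For five labels this makes every quartet come
from a pair that is a cherry in all trees outside the pair. Such pairs are disjoint, and the tree
with these cherries induces all the given ones (`QuartetsCompatible.exists_tree`). The transfer of
quartets is proved in `IsTraversable.legDisplays_transfer` by walking along the lines to suitable
crossings. Boundary edges and corners are added to the cells (`MixedCell.positions`) so that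
boundary lines can be followed like all others.

Geometry: a Minkowski sum of faces of a triangle is cut out by integer bounds on the coordinates
(`MixedCell.mem_polytope_of_bounds`), so a full-dimensional cell is a union of unit triangles, and
each unit triangle lies in exactly one cell. The neighbour of a cell across an edge is the cell of
the unit triangle on the other side, and since the common face is a labelled face, the two cells
agree on it summand by summand.

Cayley trick: the slice of a cell of the product over the barycentre of the second factor is, up to
scaling by `m`, its Minkowski cell; common faces that meet the slice become labelled common faces. A
full-dimensional simplex has `m + 2` vertices, so its `m` summands have total dimension two. -/

/-- The graph `G` is the tree in which every vertex `v ≠ root` is joined to its parent `par v`, which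
is nearer to the root. -/
structure IsRootedTree {V : Type} (G : SimpleGraph V) (root : V) (par : V → V) (ht : V → ℕ) :
    Prop where
  adj_iff : ∀ v w, G.Adj v w ↔ (v ≠ root ∧ par v = w) ∨ (w ≠ root ∧ par w = v)
  ht_lt : ∀ v, v ≠ root → ht (par v) < ht v
  par_root : par root = root

/-- The vertex `u` is a descendant of `v`. -/
def Descends {V : Type} (par : V → V) (v u : V) : Prop := ∃ n : ℕ, par^[n] u = v

namespace Descends

variable {V : Type} {par : V → V} {u v w : V}

theorem refl (v : V) : Descends par v v := ⟨0, rfl⟩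

theorem of_par (h : Descends par v (par u)) : Descends par v u := by
  obtain ⟨n, hn⟩ := h
  exact ⟨n + 1, by simpa using hn⟩

theorem eq_or_par (h : Descends par v u) : u = v ∨ Descends par v (par u) := by
  obtain ⟨n, hn⟩ := h
  cases n with
  | zero => exact Or.inl hn
  | succ n => exact Or.inr ⟨n, by simpa using hn⟩

theorem trans (h₁ : Descends par v u) (h₂ : Descends par u w) : Descends par v w := by
  obtain ⟨n, rfl⟩ := h₁
  obtain ⟨k, rfl⟩ := h₂
  exact ⟨n + k, by rw [Function.iterate_add_apply]⟩

theorem total (h₁ : Descends par v u) (h₂ : Descends par w u) :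
    Descends par v w ∨ Descends par w v := by
  obtain ⟨n, rfl⟩ := h₁
  obtain ⟨k, rfl⟩ := h₂
  rcases le_total n k with h | h
  · right
    exact ⟨k - n, by rw [← Function.iterate_add_apply, Nat.sub_add_cancel h]⟩
  · left
    exact ⟨n - k, by rw [← Function.iterate_add_apply, Nat.sub_add_cancel h]⟩

end Descends

namespace IsRootedTree

variable {V : Type} {G : SimpleGraph V} {root : V} {par : V → V} {ht : V → ℕ}

theorem adj_par (h : IsRootedTree G root par ht) {v : V} (hv : v ≠ root) : G.Adj v (par v) :=
  (h.adj_iff _ _).2 (Or.inl ⟨hv, rfl⟩)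

theorem induction_up (h : IsRootedTree G root par ht) {P : V → Prop} (h0 : P root)
    (hs : ∀ v, v ≠ root → P (par v) → P v) (v : V) : P v := by
  induction hn : ht v using Nat.strong_induction_on generalizing v with
  | _ n ih =>
    subst hn
    by_cases hv : v = root
    · rwa [hv]
    · exact hs v hv (ih _ (h.ht_lt v hv) _ rfl)

theorem descends_root (h : IsRootedTree G root par ht) (v : V) : Descends par root v :=
  h.induction_up (P := fun v => Descends par root v) (Descends.refl _)
    (fun _ _ hp => hp.of_par) v

theorem ht_le (h : IsRootedTree G root par ht) {v u : V} (hd : Descends par v u) :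
    ht v ≤ ht u := by
  obtain ⟨n, rfl⟩ := hd
  induction n with
  | zero => exact le_rfl
  | succ n ih =>
    rw [Function.iterate_succ_apply']
    by_cases hr : par^[n] u = root
    · rw [hr, h.par_root, ← hr]; exact ih
    · exact (h.ht_lt _ hr).le.trans ih

theorem eq_of_descends (h : IsRootedTree G root par ht) {v u : V} (h₁ : Descends par v u)
    (h₂ : Descends par u v) : u = v := by
  rcases h₁.eq_or_par with h₁ | h₁
  · exact h₁
  · by_cases hu : u = root
    · obtain ⟨k, hk⟩ := h₁
      rw [hu, h.par_root, Function.iterate_fixed h.par_root] at hk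
      rw [hu, hk]
    · have := h.ht_lt u hu
      have h3 := h.ht_le h₁
      have h4 := h.ht_le h₂
      omega

theorem reachable_root (h : IsRootedTree G root par ht) (v : V) : G.Reachable v root :=
  h.induction_up (P := fun v => G.Reachable v root) (SimpleGraph.Reachable.refl _)
    (fun _ hv hp => (h.adj_par hv).reachable.trans hp) v

theorem connected (h : IsRootedTree G root par ht) : G.Connected :=
  { preconnected := fun v w => (h.reachable_root v).trans (h.reachable_root w).symm
    nonempty := ⟨root⟩ }

/-- An edge that leaves the set of descendants of `v` joins `v` to its parent. -/
theorem eq_of_adj (h : IsRootedTree G root par ht) {v u u' : V} (hd : Descends par v u)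
    (ha : G.Adj u u') (hn : ¬ Descends par v u') : u = v ∧ u' = par v := by
  rcases (h.adj_iff _ _).1 ha with ⟨_, rfl⟩ | ⟨_, rfl⟩
  · rcases hd.eq_or_par with rfl | hd
    · exact ⟨rfl, rfl⟩
    · exact absurd hd hn
  · exact absurd hd.of_par hn

/-- The only exit from the descendants of `v` is the edge from `v` to its parent, so a walk that
leaves them visits both ends of this edge. -/
theorem mem_support (h : IsRootedTree G root par ht) {v x y : V} (p : G.Walk x y)
    (hx : Descends par v x) (hy : ¬ Descends par v y) : v ∈ p.support ∧ par v ∈ p.support := by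
  induction p with
  | nil => exact absurd hx hy
  | @cons x z y ha q ih =>
    by_cases hz : Descends par v z
    · have := ih hz hy
      exact ⟨List.mem_cons_of_mem _ this.1, List.mem_cons_of_mem _ this.2⟩
    · obtain ⟨rfl, rfl⟩ := h.eq_of_adj hx ha hz
      simp

/-- Every edge from a vertex to its parent is a bridge: once it is removed, no walk leaves the set
of descendants of the lower end. -/
theorem isTree (h : IsRootedTree G root par ht) : G.IsTree := by
  refine ⟨h.connected, ?_⟩
  rw [SimpleGraph.isAcyclic_iff_forall_adj_isBridge]
  have key : ∀ v, v ≠ root → G.IsBridge s(v, par v) := by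
    intro v hv
    rw [SimpleGraph.isBridge_iff]
    rintro ⟨p⟩
    have : ∀ {x y : V} (p : (G \ SimpleGraph.fromEdgeSet {s(v, par v)}).Walk x y),
        Descends par v x → Descends par v y := by
      intro x y p
      induction p with
      | nil => exact id
      | @cons x z y ha q ih =>
        intro hx
        apply ih
        by_contra hz
        rw [SimpleGraph.sdiff_adj, SimpleGraph.fromEdgeSet_adj] at ha
        obtain ⟨rfl, rfl⟩ := h.eq_of_adj hx ha.1 hz
        exact ha.2 ⟨rfl, ha.1.ne⟩
    have h2 := this p (Descends.refl v)
    have h3 := h.ht_le h2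
    have h4 := h.ht_lt v hv
    omega
  intro v w ha
  rcases (h.adj_iff _ _).1 ha with ⟨hv, rfl⟩ | ⟨hw, rfl⟩
  · exact key v hv
  · rw [Sym2.eq_swap]; exact key w hw

/-- The walk from a vertex to one of its ancestors. -/
theorem exists_walk_up (h : IsRootedTree G root par ht) {v u : V} (hd : Descends par v u) :
    ∃ p : G.Walk u v, ∀ x ∈ p.support, Descends par v x ∧ Descends par x u := by
  obtain ⟨n, hn⟩ := hd
  induction n generalizing u with
  | zero =>
    obtain rfl : u = v := hn
    exact ⟨SimpleGraph.Walk.nil, by simp [Descends.refl]⟩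
  | succ n ih =>
    by_cases hu : u = root
    · have : v = root := by
        rw [← hn, hu]; exact Function.iterate_fixed h.par_root _
      subst this; subst hu
      exact ⟨SimpleGraph.Walk.nil, by simp [Descends.refl]⟩
    · obtain ⟨p, hp⟩ := ih (u := par u) (by simpa using hn)
      refine ⟨SimpleGraph.Walk.cons (h.adj_par hu) p, ?_⟩
      intro x hx
      rw [SimpleGraph.Walk.support_cons, List.mem_cons] at hx
      rcases hx with rfl | hx
      · exact ⟨⟨n + 1, hn⟩, Descends.refl _⟩
      · exact ⟨(hp x hx).1, (hp x hx).2.of_par⟩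

/-- The lowest common ancestor of two vertices. -/
theorem exists_lca (h : IsRootedTree G root par ht) (a b : V) :
    ∃ u, Descends par u a ∧ Descends par u b ∧
      ∀ v, Descends par v a → Descends par v b → Descends par v u := by
  revert b
  refine fun b => h.induction_up (P := fun a => ∃ u, Descends par u a ∧ Descends par u b ∧
      ∀ v, Descends par v a → Descends par v b → Descends par v u) ?_ ?_ a
  · exact ⟨root, Descends.refl _, h.descends_root b, fun v hv _ => hv⟩
  · rintro a - ⟨u, hu, hub, hmin⟩
    by_cases hab : Descends par a b
    · exact ⟨a, Descends.refl _, hab, fun v hv _ => hv⟩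
    · refine ⟨u, hu.of_par, hub, fun v hv hvb => ?_⟩
      rcases hv.eq_or_par with rfl | hv
      · exact absurd hvb hab
      · exact hmin v hv hvb

/-- A walk between two vertices passes through everything between one of them and their lowest common
ancestor. -/
theorem mem_support_of_lca (h : IsRootedTree G root par ht) {a b u x : V} (p : G.Walk a b)
    (hmin : ∀ v, Descends par v a → Descends par v b → Descends par v u)
    (hx : Descends par u x) (hxa : Descends par x a) : x ∈ p.support := by
  by_cases hxb : Descends par x b
  · have hxu := h.eq_of_descends (hmin x hxa hxb) hx
    subst hxu
    clear hx hxb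
    by_cases hau : a = u
    · rw [← hau]; exact p.start_mem_support
    · -- the child of `u` above `a`
      have : ∃ y, y ≠ root ∧ par y = u ∧ Descends par y a ∧ y ≠ u := by
        obtain ⟨n, hn⟩ := hxa
        induction n generalizing a with
        | zero => exact absurd hn hau
        | succ n ih =>
          by_cases har : a = root
          · exfalso
            apply hau
            rw [← hn, har]; exact (Function.iterate_fixed h.par_root _).symm
          · by_cases hp : par a = u
            · exact ⟨a, har, hp, Descends.refl _, hau⟩
            · obtain ⟨y, h1, h2, h3, h4⟩ := ih (a := par a)
                ((SimpleGraph.Walk.cons (h.adj_par har).symm p))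
                (fun v hv => hmin v hv.of_par) hp (by simpa using hn)
              exact ⟨y, h1, h2, h3.of_par, h4⟩
      obtain ⟨y, hyr, hyu, hya, hne⟩ := this
      have hyb : ¬ Descends par y b := by
        intro hyb
        have h1 := hmin y hya hyb
        have h2 : Descends par u y := ⟨1, hyu⟩
        exact hne (h.eq_of_descends h2 h1)
      have := (h.mem_support p hya hyb).2
      rwa [hyu] at this
  · exact (h.mem_support p hxa hxb).1

/-- Two disjoint walks in a rooted tree are separated by an edge. -/
theorem exists_separating (h : IsRootedTree G root par ht) {a b c d : V} (p : G.Walk a b)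
    (q : G.Walk c d) (hpq : ∀ v, v ∈ p.support → v ∉ q.support) :
    ∃ v, (Descends par v a ∧ Descends par v b ∧ ¬ Descends par v c ∧ ¬ Descends par v d) ∨
      (Descends par v c ∧ Descends par v d ∧ ¬ Descends par v a ∧ ¬ Descends par v b) := by
  obtain ⟨u, hua, hub, hu⟩ := h.exists_lca a b
  obtain ⟨w, hwc, hwd, hw⟩ := h.exists_lca c d
  have pmem : ∀ x, Descends par u x → (Descends par x a ∨ Descends par x b) → x ∈ p.support := by
    rintro x hx (hxa | hxb)
    · exact h.mem_support_of_lca p hu hx hxa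
    · have := h.mem_support_of_lca p.reverse (fun v h1 h2 => hu v h2 h1) hx hxb
      rwa [SimpleGraph.Walk.support_reverse, List.mem_reverse] at this
  have qmem : ∀ x, Descends par w x → (Descends par x c ∨ Descends par x d) → x ∈ q.support := by
    rintro x hx (hxa | hxb)
    · exact h.mem_support_of_lca q hw hx hxa
    · have := h.mem_support_of_lca q.reverse (fun v h1 h2 => hw v h2 h1) hx hxb
      rwa [SimpleGraph.Walk.support_reverse, List.mem_reverse] at this
  -- Each walk contains everything between its lowest common ancestor and its ends. If `u` is above
  -- `w`, cut above `w`: an end of `p` below `w` would put `w` on both walks. Otherwise cut above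
  -- `u`: an end of `q` below `u` would make `u` and `w` comparable and put `u` on both walks.
  by_cases huw : Descends par u w
  · refine ⟨w, Or.inr ⟨hwc, hwd, fun hwa => ?_, fun hwb => ?_⟩⟩
    · exact hpq w (pmem w huw (Or.inl hwa)) (qmem w (Descends.refl _) (Or.inl hwc))
    · exact hpq w (pmem w huw (Or.inr hwb)) (qmem w (Descends.refl _) (Or.inl hwc))
  · refine ⟨u, Or.inl ⟨hua, hub, fun huc => ?_, fun hud => ?_⟩⟩
    · exact hpq u (pmem u (Descends.refl _) (Or.inl hua))
        (qmem u ((huc.total hwc).resolve_left huw) (Or.inl huc))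
    · exact hpq u (pmem u (Descends.refl _) (Or.inl hua))
        (qmem u ((hud.total hwd).resolve_left huw) (Or.inr hud))

/-- One path goes through `v` and stays among its descendants. The other goes through the root and
only uses ancestors of `c` and `d`, none of which lies below `v`. -/
theorem exists_disjoint_paths (h : IsRootedTree G root par ht) {v a b c d : V}
    (ha : Descends par v a) (hb : Descends par v b) (hc : ¬ Descends par v c)
    (hd : ¬ Descends par v d) : ∃ (p : G.Walk a b) (q : G.Walk c d), p.IsPath ∧ q.IsPath ∧
      ∀ x, x ∈ p.support → x ∉ q.support := by
  classical
  obtain ⟨pa, hpa⟩ := h.exists_walk_up ha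
  obtain ⟨pb, hpb⟩ := h.exists_walk_up hb
  obtain ⟨pc, hpc⟩ := h.exists_walk_up (h.descends_root c)
  obtain ⟨pd, hpd⟩ := h.exists_walk_up (h.descends_root d)
  refine ⟨(pa.append pb.reverse).bypass, (pc.append pd.reverse).bypass,
    SimpleGraph.Walk.bypass_isPath _, SimpleGraph.Walk.bypass_isPath _, fun x hx hx' => ?_⟩
  have h1 := SimpleGraph.Walk.support_bypass_subset_support _ hx
  have h2 := SimpleGraph.Walk.support_bypass_subset_support _ hx'
  rw [SimpleGraph.Walk.mem_support_append_iff, SimpleGraph.Walk.support_reverse,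
    List.mem_reverse] at h1 h2
  have h3 : Descends par v x := by
    rcases h1 with h1 | h1
    · exact (hpa x h1).1
    · exact (hpb x h1).1
  rcases h2 with h2 | h2
  · exact hc (h3.trans (hpc x h2).2)
  · exact hd (h3.trans (hpd x h2).2)

/-- In a rooted tree the displayed quartets are those given by the splits at the edges. -/
theorem displays_iff {L : Type} {T : LabelledGraph L} {root : T.V} {par : T.V → T.V} {ht : T.V → ℕ}
    (h : IsRootedTree T.graph root par ht) (a b c d : L) :
    T.Displays a b c d ↔ ∃ (ha : a ∈ T.labels) (hb : b ∈ T.labels) (hc : c ∈ T.labels)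
      (hd : d ∈ T.labels), ∃ v,
      (Descends par v (T.leaf ⟨a, ha⟩) ∧ Descends par v (T.leaf ⟨b, hb⟩) ∧
        ¬ Descends par v (T.leaf ⟨c, hc⟩) ∧ ¬ Descends par v (T.leaf ⟨d, hd⟩)) ∨
      (Descends par v (T.leaf ⟨c, hc⟩) ∧ Descends par v (T.leaf ⟨d, hd⟩) ∧
        ¬ Descends par v (T.leaf ⟨a, ha⟩) ∧ ¬ Descends par v (T.leaf ⟨b, hb⟩)) := by
  constructor
  · rintro ⟨ha, hb, hc, hd, p, q, -, -, hpq⟩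
    exact ⟨ha, hb, hc, hd, h.exists_separating p q hpq⟩
  · rintro ⟨ha, hb, hc, hd, v, ⟨h1, h2, h3, h4⟩ | ⟨h1, h2, h3, h4⟩⟩
    · obtain ⟨p, q, hp, hq, hpq⟩ := h.exists_disjoint_paths h1 h2 h3 h4
      exact ⟨ha, hb, hc, hd, p, q, hp, hq, hpq⟩
    · obtain ⟨p, q, hp, hq, hpq⟩ := h.exists_disjoint_paths h1 h2 h3 h4
      exact ⟨ha, hb, hc, hd, q, p, hq, hp, fun x hx hx' => hpq x hx' hx⟩

/-- A rooted tree does not display two different quartets on the same four leaves. -/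
theorem not_displays_of_displays {L : Type} {T : LabelledGraph L} {root : T.V} {par : T.V → T.V}
    {ht : T.V → ℕ} (h : IsRootedTree T.graph root par ht) {a b c d : L}
    (h₁ : T.Displays a b c d) : ¬ T.Displays a c b d := by
  intro h₂
  obtain ⟨ha, hb, hc, hd, v, hv⟩ := (h.displays_iff a b c d).1 h₁
  obtain ⟨_, _, _, _, w, hw⟩ := (h.displays_iff a c b d).1 h₂
  -- The descendants of `v` and those of `w` share the leaf `x`, so the two sets are nested; but `y`
  -- lies only below `v` and `z` only below `w`.
  have key : ∀ x y z t, Descends par v x → Descends par v y → ¬ Descends par v z →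
      Descends par w x → Descends par w z → ¬ Descends par w y → Descends par w t →
      False := by
    intro x y z t h1 h2 h3 h4 h5 h6 _
    rcases h1.total h4 with h | h
    · exact h3 (h.trans h5)
    · exact h6 (h.trans h2)
  rcases hv with ⟨h1, h2, h3, h4⟩ | ⟨h1, h2, h3, h4⟩ <;>
    rcases hw with ⟨h5, h6, h7, h8⟩ | ⟨h5, h6, h7, h8⟩
  · exact key _ _ _ _ h1 h2 h3 h5 h6 h7 h5
  · exact key _ _ _ _ h2 h1 h4 h5 h6 h7 h5
  · exact key _ _ _ _ h1 h2 h3 h6 h5 h8 h5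
  · exact key _ _ _ _ h2 h1 h4 h6 h5 h8 h5

end IsRootedTree

/-- A map of rooted trees that maps each parent to the parent of the image or collapses the edge
is a contraction if its fibres, except for the one over the root, consist of comparable vertices. -/
theorem LabelledGraph.isContractionOf_of_map {L : Type} {T T' : LabelledGraph L}
    {root : T.V} {par : T.V → T.V} {ht : T.V → ℕ} (h : IsRootedTree T.graph root par ht)
    {root' : T'.V} {par' : T'.V → T'.V} {ht' : T'.V → ℕ} (h' : IsRootedTree T'.graph root' par' ht')
    (hl : T.labels = T'.labels) (f : T'.V → T.V) (hf : Function.Surjective f)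
    (hleaf : ∀ (x : L) (hx : x ∈ T.labels) (hx' : x ∈ T'.labels),
      f (T'.leaf ⟨x, hx'⟩) = T.leaf ⟨x, hx⟩)
    (hroot : f root' = root) (hpar : ∀ v, f (par' v) = f v ∨ f (par' v) = par (f v))
    (hcomp : ∀ v w, f v = f w → f v ≠ root → Descends par' v w ∨ Descends par' w v) :
    T.IsContractionOf T' := by
  have hmono : ∀ {v w}, Descends par' v w → Descends par (f v) (f w) := by
    rintro v w ⟨n, rfl⟩
    induction n with
    | zero => exact Descends.refl _
    | succ n ih =>
      rw [Function.iterate_succ_apply']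
      rcases hpar (par'^[n] w) with h1 | h1 <;> rw [h1]
      · exact ih
      · exact Descends.trans ⟨1, rfl⟩ ih
  refine ⟨hl, f, hf, hleaf, ?_, ?_⟩
  · intro a
    have hup : ∀ v w, f v = a → f w = a → Descends par' v w →
        ∀ (hv : v ∈ f ⁻¹' {a}) (hw : w ∈ f ⁻¹' {a}),
        (T'.graph.induce (f ⁻¹' {a})).Reachable ⟨w, hw⟩ ⟨v, hv⟩ := by
      rintro v w hva hwa hd hv hw
      obtain ⟨p, hp⟩ := h'.exists_walk_up hd
      have hs : ∀ x ∈ p.support, x ∈ f ⁻¹' {a} := by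
        intro x hx
        have h1 := hmono (hp x hx).1
        have h2 := hmono (hp x hx).2
        rw [hva] at h1
        rw [hwa] at h2
        exact h.eq_of_descends h1 h2
      exact ⟨p.induce (f ⁻¹' {a}) hs⟩
    obtain ⟨v₀, hv₀⟩ := hf a
    have : Nonempty (f ⁻¹' {a}) := ⟨⟨v₀, hv₀⟩⟩
    refine SimpleGraph.Connected.mk ?_
    rintro ⟨v, hv⟩ ⟨w, hw⟩
    -- The fibre over the root need not be a chain; it is connected through `root'`.
    by_cases ha : a = root
    · have hr : root' ∈ f ⁻¹' {a} := by rw [ha]; exact hroot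
      exact (hup _ _ (hroot.trans ha.symm) hv (h'.descends_root v) hr hv).trans
        (hup _ _ (hroot.trans ha.symm) hw (h'.descends_root w) hr hw).symm
    · have hvw : f v = f w := (show f v = a from hv).trans (show f w = a from hw).symm
      rcases hcomp v w hvw (by rw [show f v = a from hv]; exact ha) with hd | hd
      · exact (hup v w hv hw hd hv hw).symm
      · exact hup w v hw hv hd hw hv
  · have hdown : ∀ v, v ≠ root → ∃ v' w', f v' = v ∧ f w' = par v ∧ T'.graph.Adj v' w' := by
      intro v hv
      obtain ⟨v', hv'⟩ := hf v
      have : ∀ v', f v' = v → ∃ v' w', f v' = v ∧ f w' = par v ∧ T'.graph.Adj v' w' :=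
        h'.induction_up (P := fun v' => f v' = v →
            ∃ v' w', f v' = v ∧ f w' = par v ∧ T'.graph.Adj v' w')
          (fun hr => absurd (hr.symm.trans hroot) hv) (fun u hu ih hfu => by
            rcases hpar u with h1 | h1
            · exact ih (h1.trans hfu)
            · exact ⟨u, par' u, hfu, by rw [h1, hfu], h'.adj_par hu⟩)
      exact this v' hv'
    intro v w
    constructor
    · intro ha
      refine ⟨ha.ne, ?_⟩
      rcases (h.adj_iff _ _).1 ha with ⟨hv, rfl⟩ | ⟨hw, rfl⟩
      · exact hdown v hv
      · obtain ⟨v', w', h1, h2, h3⟩ := hdown w hw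
        exact ⟨w', v', h2, h1, h3.symm⟩
    · rintro ⟨hne, v', w', rfl, rfl, ha⟩
      rcases (h'.adj_iff _ _).1 ha with ⟨hv, rfl⟩ | ⟨hw, rfl⟩
      · rcases hpar v' with h1 | h1
        · exact absurd h1.symm hne
        · refine (h.adj_iff _ _).2 (Or.inl ⟨fun hr => hne ?_, h1.symm⟩)
          rw [h1, hr, h.par_root]
      · rcases hpar w' with h1 | h1
        · exact absurd h1 hne
        · refine (h.adj_iff _ _).2 (Or.inr ⟨fun hr => hne ?_, h1.symm⟩)
          rw [h1, hr, h.par_root]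

/-! ### Quartets of tree arrangements -/

theorem SimpleGraph.exists_disjoint_paths_induce {V : Type} {G : SimpleGraph V} {s : Set V}
    {a b c d : s} {p : G.Walk a b} {q : G.Walk c d} (hp : p.IsPath) (hq : q.IsPath)
    (hps : ∀ v ∈ p.support, v ∈ s) (hqs : ∀ v ∈ q.support, v ∈ s)
    (hpq : ∀ v, v ∈ p.support → v ∉ q.support) :
    ∃ (p : (G.induce s).Walk a b) (q : (G.induce s).Walk c d), p.IsPath ∧ q.IsPath ∧
      ∀ v, v ∈ p.support → v ∉ q.support := by
  refine ⟨p.induce s hps, q.induce s hqs, ?_, ?_, ?_⟩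
  · apply SimpleGraph.Walk.IsPath.of_map (f := (SimpleGraph.Embedding.induce _).toHom)
    rw [SimpleGraph.Walk.map_induce]; exact hp
  · apply SimpleGraph.Walk.IsPath.of_map (f := (SimpleGraph.Embedding.induce _).toHom)
    rw [SimpleGraph.Walk.map_induce]; exact hq
  · intro v hv hv'
    rw [SimpleGraph.Walk.support_induce, List.mem_attachWith] at hv hv'
    exact hpq _ hv hv'

theorem SimpleGraph.exists_disjoint_paths_of_induce {V : Type} {G : SimpleGraph V}
    {s : Set V} {a b c d : s} {p : (G.induce s).Walk a b} {q : (G.induce s).Walk c d}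
    (hp : p.IsPath) (hq : q.IsPath) (hpq : ∀ v, v ∈ p.support → v ∉ q.support) :
    ∃ (p : G.Walk ((SimpleGraph.Embedding.induce (G := G) s).toHom a)
        ((SimpleGraph.Embedding.induce (G := G) s).toHom b))
      (q : G.Walk ((SimpleGraph.Embedding.induce (G := G) s).toHom c)
        ((SimpleGraph.Embedding.induce (G := G) s).toHom d)), p.IsPath ∧ q.IsPath ∧
      ∀ v, v ∈ p.support → v ∉ q.support := by
  have hinj := (SimpleGraph.Embedding.induce (G := G) s).injective
  refine ⟨p.map (SimpleGraph.Embedding.induce _).toHom,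
    q.map (SimpleGraph.Embedding.induce _).toHom, hp.map hinj, hq.map hinj, ?_⟩
  intro v hv hv'
  rw [SimpleGraph.Walk.support_map, List.mem_map] at hv hv'
  obtain ⟨x, hx, rfl⟩ := hv
  obtain ⟨y, hy, hxy⟩ := hv'
  have : y = x := hinj hxy
  subst this
  exact hpq _ hx hy

namespace LabelledGraph

variable {L : Type}

theorem Displays.swap_left {T : LabelledGraph L} {a b c d : L} (h : T.Displays a b c d) :
    T.Displays b a c d := by
  obtain ⟨ha, hb, hc, hd, p, q, hp, hq, hpq⟩ := h
  exact ⟨hb, ha, hc, hd, p.reverse, q, hp.reverse, hq, by simpa using hpq⟩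

theorem Displays.symm {T : LabelledGraph L} {a b c d : L} (h : T.Displays a b c d) :
    T.Displays c d a b := by
  obtain ⟨ha, hb, hc, hd, p, q, hp, hq, hpq⟩ := h
  exact ⟨hc, hd, ha, hb, q, p, hq, hp, fun v hv hv' => hpq v hv' hv⟩

theorem Displays.swap_right {T : LabelledGraph L} {a b c d : L} (h : T.Displays a b c d) :
    T.Displays a b d c := h.symm.swap_left.symm

/-- A path between two remaining leaves lies in the spanned subtree by definition, so deletion loses
exactly the quartets that involve `i`. The possible nodes of degree two play no role. -/
theorem displays_delete_iff {T : LabelledGraph L} {i a b c d : L} :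
    (T.delete i).Displays a b c d ↔ T.Displays a b c d ∧ a ≠ i ∧ b ≠ i ∧ c ≠ i ∧ d ≠ i := by
  constructor
  · rintro ⟨ha, hb, hc, hd, p, q, hp, hq, hpq⟩
    exact ⟨⟨ha.1, hb.1, hc.1, hd.1, SimpleGraph.exists_disjoint_paths_of_induce hp hq hpq⟩,
      ha.2, hb.2, hc.2, hd.2⟩
  · rintro ⟨⟨ha, hb, hc, hd, p, q, hp, hq, hpq⟩, hai, hbi, hci, hdi⟩
    have hps : ∀ v ∈ p.support, v ∈ T.spanWithout i :=
      fun v hv => ⟨⟨a, ha⟩, ⟨b, hb⟩, hai, hbi, p, hp, hv⟩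
    have hqs : ∀ v ∈ q.support, v ∈ T.spanWithout i :=
      fun v hv => ⟨⟨c, hc⟩, ⟨d, hd⟩, hci, hdi, q, hq, hv⟩
    exact ⟨⟨ha, hai⟩, ⟨hb, hbi⟩, ⟨hc, hci⟩, ⟨hd, hdi⟩,
      SimpleGraph.exists_disjoint_paths_induce (a := ⟨_, hps _ p.start_mem_support⟩)
        (b := ⟨_, hps _ p.end_mem_support⟩) (c := ⟨_, hqs _ q.start_mem_support⟩)
        (d := ⟨_, hqs _ q.end_mem_support⟩) hp hq hps hqs hpq⟩

/-- A tree is a tree with leaf set `X` if the labelled vertices have degree one and the others have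
degree at least three. -/
theorem isTreeWithLeaves_of {T : LabelledGraph L} {X : Set L} (hl : T.labels = X)
    (hV : Finite T.V) (hT : T.graph.IsTree) (hinj : Function.Injective T.leaf)
    (hleaf : ∀ x, (T.graph.neighborSet (T.leaf x)).ncard = 1)
    (hinner : ∀ v, v ∉ Set.range T.leaf → 3 ≤ (T.graph.neighborSet v).ncard) :
    T.IsTreeWithLeaves X := by
  refine ⟨hl, hV, hT, hinj, fun v => ⟨?_, fun h => ?_⟩, fun v h => ?_⟩
  · rintro ⟨x, rfl⟩
    exact hleaf x
  · by_contra hv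
    have := hinner v hv
    omega
  · by_cases hv : v ∈ Set.range T.leaf
    · obtain ⟨x, rfl⟩ := hv
      rw [hleaf x] at h
      omega
    · have := hinner v hv
      omega

theorem nodup_five {i a b c d : L} : [i, a, b, c, d].Nodup ↔
    (i ≠ a ∧ i ≠ b ∧ i ≠ c ∧ i ≠ d) ∧ (a ≠ b ∧ a ≠ c ∧ a ≠ d) ∧ (b ≠ c ∧ b ≠ d) ∧ c ≠ d := by
  simp only [List.nodup_cons, List.mem_cons, List.not_mem_nil, or_false, not_or,
    List.nodup_nil, not_false_eq_true, and_true]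

theorem nodup_swap_left {i a b c d : L} (h : [i, a, b, c, d].Nodup) : [i, b, a, c, d].Nodup := by
  obtain ⟨⟨h1, h2, h3, h4⟩, ⟨h5, h6, h7⟩, ⟨h8, h9⟩, h10⟩ := nodup_five.1 h
  exact nodup_five.2 ⟨⟨h2, h1, h3, h4⟩, ⟨h5.symm, h8, h9⟩, ⟨h6, h7⟩, h10⟩

theorem nodup_symm {i a b c d : L} (h : [i, a, b, c, d].Nodup) : [i, c, d, a, b].Nodup := by
  obtain ⟨⟨h1, h2, h3, h4⟩, ⟨h5, h6, h7⟩, ⟨h8, h9⟩, h10⟩ := nodup_five.1 h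
  exact nodup_five.2 ⟨⟨h3, h4, h1, h2⟩, ⟨h10, h6.symm, h8.symm⟩, ⟨h7.symm, h9.symm⟩, h5⟩

theorem nodup_swap_right {i a b c d : L} (h : [i, a, b, c, d].Nodup) : [i, a, b, d, c].Nodup :=
  nodup_symm (nodup_swap_left (nodup_symm h))

end LabelledGraph

/-- The quartets of the trees `T i`, for `i ∈ S`, fit together: each tree displays at most one quartet
on four leaves, and a quartet of one tree determines a quartet of another one. -/
structure QuartetsCompatible {L : Type} (S : Finset L) (T : L → LabelledGraph L) : Prop where
  labels_eq : ∀ i ∈ S, (T i).labels = (S : Set L) \ {i}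
  thin : ∀ i ∈ S, ∀ a b c d, (T i).Displays a b c d → ¬ (T i).Displays a c b d
  transfer : ∀ i a b c d, i ∈ S → a ∈ S → b ∈ S → c ∈ S → d ∈ S → [i, a, b, c, d].Nodup →
    (T i).Displays a b c d → (T c).Displays a b d i ∨ (T a).Displays c d b i

namespace QuartetsCompatible

variable {L : Type} {S : Finset L} {T : L → LabelledGraph L}

/-- Compatibility is inherited by deletion, which is what makes the recursion over the number of
trees work. -/
theorem delete [DecidableEq L] (h : QuartetsCompatible S T) (i : L) :
    QuartetsCompatible (S.erase i) (fun j => (T j).delete i) where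
  labels_eq := by
    intro j hj
    rw [Finset.mem_erase] at hj
    change (T j).labels \ {i} = _
    rw [h.labels_eq j hj.2]
    ext x
    simp only [Set.mem_sdiff, Set.mem_singleton_iff, Finset.coe_erase]
    tauto
  thin := by
    intro j hj a b c d h1 h2
    rw [LabelledGraph.displays_delete_iff] at h1 h2
    exact h.thin j (Finset.mem_of_mem_erase hj) _ _ _ _ h1.1 h2.1
  transfer := by
    intro j a b c d hj ha hb hc hd hn h1
    simp only [Finset.mem_erase] at hj ha hb hc hd
    rw [LabelledGraph.displays_delete_iff] at h1
    rcases h.transfer j a b c d hj.2 ha.2 hb.2 hc.2 hd.2 hn h1.1 with h2 | h2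
    · exact Or.inl (LabelledGraph.displays_delete_iff.2 ⟨h2, ha.1, hb.1, hd.1, hj.1⟩)
    · exact Or.inr (LabelledGraph.displays_delete_iff.2 ⟨h2, hc.1, hd.1, hb.1, hj.1⟩)

end QuartetsCompatible

/-- The set `P` consists of two leaves that form a cherry in each of the other trees. -/
def IsCommonCherry {L : Type} [DecidableEq L] (S : Finset L) (T : L → LabelledGraph L)
    (P : Finset L) : Prop :=
  ∃ a b, a ≠ b ∧ P = {a, b} ∧ a ∈ S ∧ b ∈ S ∧
    ∀ k c d, k ∈ S → c ∈ S → d ∈ S → [k, a, b, c, d].Nodup → (T k).Displays a b c d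

namespace IsCommonCherry

variable {L : Type} [DecidableEq L] {S : Finset L} {T : L → LabelledGraph L} {P Q : Finset L}

theorem subset (h : IsCommonCherry S T P) : P ⊆ S := by
  obtain ⟨a, b, -, rfl, ha, hb, -⟩ := h
  intro x hx
  simp only [Finset.mem_insert, Finset.mem_singleton] at hx
  rcases hx with rfl | rfl <;> assumption

theorem card_eq (h : IsCommonCherry S T P) : P.card = 2 := by
  obtain ⟨a, b, hab, rfl, -⟩ := h
  exact Finset.card_pair hab

theorem displays {k a b c d : L} (h : IsCommonCherry S T {a, b}) (hk : k ∈ S) (hc : c ∈ S)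
    (hd : d ∈ S) (hn : [k, a, b, c, d].Nodup) : (T k).Displays a b c d := by
  obtain ⟨a', b', hab, he, -, -, h⟩ := h
  have hne : a ≠ b := (LabelledGraph.nodup_five.1 hn).2.1.1
  have ha : a ∈ ({a', b'} : Finset L) := by rw [← he]; simp
  have hb : b ∈ ({a', b'} : Finset L) := by rw [← he]; simp
  simp only [Finset.mem_insert, Finset.mem_singleton] at ha hb
  rcases ha with rfl | rfl <;> rcases hb with rfl | rfl
  · exact absurd rfl hne
  · exact h k c d hk hc hd hn
  · exact (h k c d hk hc hd (LabelledGraph.nodup_swap_left hn)).swap_left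
  · exact absurd rfl hne

theorem exists_eq (h : IsCommonCherry S T P) {x : L} (hx : x ∈ P) :
    ∃ y, y ≠ x ∧ P = {x, y} := by
  obtain ⟨a, b, hab, rfl, -⟩ := h
  simp only [Finset.mem_insert, Finset.mem_singleton] at hx
  rcases hx with rfl | rfl
  · exact ⟨b, hab.symm, rfl⟩
  · exact ⟨a, hab, Finset.pair_comm _ _⟩

/-- Two cherries `{x, b}` and `{x, c}` would force the tree of a fourth label `d` to display both
`xb|ce` and `xc|be`, where `e` is the fifth label. -/
theorem eq_of_mem (hS : S.card = 5) (hT : QuartetsCompatible S T) (hP : IsCommonCherry S T P)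
    (hQ : IsCommonCherry S T Q) {x : L} (hxP : x ∈ P) (hxQ : x ∈ Q) : P = Q := by
  obtain ⟨b, hb, rfl⟩ := hP.exists_eq hxP
  obtain ⟨c, hc, rfl⟩ := hQ.exists_eq hxQ
  by_cases hbc : b = c
  · rw [hbc]
  exfalso
  have hxS := hP.subset hxP
  have hbS : b ∈ S := hP.subset (by simp)
  have hcS : c ∈ S := hQ.subset (by simp)
  have hcard : (S \ {x, b, c}).card = 2 := by
    rw [Finset.card_sdiff_of_subset, hS, Finset.card_eq_three.2 ⟨x, b, c, hb.symm, hc.symm, hbc, rfl⟩]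
    intro y hy
    simp only [Finset.mem_insert, Finset.mem_singleton] at hy
    rcases hy with rfl | rfl | rfl <;> assumption
  obtain ⟨d, e, hde, he⟩ := Finset.card_eq_two.1 hcard
  have hd : d ∈ S \ {x, b, c} := by rw [he]; simp
  have he : e ∈ S \ {x, b, c} := by rw [he]; simp
  simp only [Finset.mem_sdiff, Finset.mem_insert, Finset.mem_singleton, not_or] at hd he
  have h1 := hP.displays hd.1 hcS he.1 (LabelledGraph.nodup_five.2 ⟨⟨hd.2.1, hd.2.2.1, hd.2.2.2, hde⟩, ⟨hb.symm, hc.symm, Ne.symm he.2.1⟩,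
      ⟨hbc, Ne.symm he.2.2.1⟩, Ne.symm he.2.2.2⟩)
  have h2 := hQ.displays hd.1 hbS he.1 (LabelledGraph.nodup_five.2 ⟨⟨hd.2.1, hd.2.2.2, hd.2.2.1, hde⟩, ⟨hc.symm, hb.symm, Ne.symm he.2.1⟩,
      ⟨Ne.symm hbc, Ne.symm he.2.2.2⟩, Ne.symm he.2.2.1⟩)
  exact hT.thin d hd.1 _ _ _ _ h1 h2

/-- With five labels, `i`, `c` and `d` are the only trees that contain both leaves `a` and `b`, and
each of them has just one quartet to check. -/
theorem of_displays (hS : S.card = 5) {i a b c d : L} (hi : i ∈ S) (ha : a ∈ S) (hb : b ∈ S)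
    (hc : c ∈ S) (hd : d ∈ S) (hn : [i, a, b, c, d].Nodup) (h1 : (T i).Displays a b c d)
    (h2 : (T c).Displays a b d i) (h3 : (T d).Displays a b c i) : IsCommonCherry S T {a, b} := by
  have hSe : ({i, a, b, c, d} : Finset L) = S := by
    apply Finset.eq_of_subset_of_card_le
    · intro y hy
      simp only [Finset.mem_insert, Finset.mem_singleton] at hy
      rcases hy with rfl | rfl | rfl | rfl | rfl <;> assumption
    · rw [hS]
      have := List.toFinset_card_of_nodup hn
      simp only [List.toFinset_cons, List.toFinset_nil, List.length_cons, List.length_nil] at this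
      rw [← insert_empty_eq d, this]
  have hab : a ≠ b := (LabelledGraph.nodup_five.1 hn).2.1.1
  refine ⟨a, b, hab, rfl, ha, hb, ?_⟩
  have mem : ∀ x, x ∈ S → x ≠ a → x ≠ b → x = i ∨ x = c ∨ x = d := by
    intro x hx h1 h2
    rw [← hSe] at hx
    simp only [Finset.mem_insert, Finset.mem_singleton] at hx
    tauto
  intro k x y hk hx hy hn'
  obtain ⟨⟨k1, k2, k3, k4⟩, ⟨-, x1, y1⟩, ⟨x2, y2⟩, xy⟩ := LabelledGraph.nodup_five.1 hn'
  rcases mem k hk k1 k2 with rfl | rfl | rfl <;>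
    rcases mem x hx (Ne.symm x1) (Ne.symm x2) with rfl | rfl | rfl <;>
      first
      | exact absurd rfl k3
      | rcases mem y hy (Ne.symm y1) (Ne.symm y2) with rfl | rfl | rfl <;>
          first
          | exact absurd rfl xy
          | exact absurd rfl k4
          | assumption
          | exact LabelledGraph.Displays.swap_right ‹_›

end IsCommonCherry

/-- The symmetries of the quartet `ab|cd` give four instances of the transfer property, each a
choice between one of the trees `c`, `d` and one of the trees `a`, `b`. If one of `c`, `d` fails,
both `a` and `b` must succeed, so one of the two pairs is a cherry everywhere. -/
theorem QuartetsCompatible.isCommonCherry {L : Type} [DecidableEq L] {S : Finset L}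
    {T : L → LabelledGraph L} (hT : QuartetsCompatible S T)
    (hS : S.card = 5) {i a b c d : L} (hi : i ∈ S) (ha : a ∈ S) (hb : b ∈ S)
    (hc : c ∈ S) (hd : d ∈ S) (hn : [i, a, b, c, d].Nodup) (h : (T i).Displays a b c d) :
    IsCommonCherry S T {a, b} ∨ IsCommonCherry S T {c, d} := by
  have h1 := hT.transfer i a b c d hi ha hb hc hd hn h
  have h2 := hT.transfer i b a c d hi hb ha hc hd
    (LabelledGraph.nodup_swap_left hn) h.swap_left
  have h3 := hT.transfer i a b d c hi ha hb hd hc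
    (LabelledGraph.nodup_swap_right hn) h.swap_right
  have h4 := hT.transfer i b a d c hi hb ha hd hc
    (LabelledGraph.nodup_swap_left (LabelledGraph.nodup_swap_right hn)) h.swap_left.swap_right
  by_cases hC : (T c).Displays a b d i ∧ (T d).Displays a b c i
  · exact Or.inl (IsCommonCherry.of_displays hS hi ha hb hc hd hn h hC.1 hC.2)
  · right
    have hA : (T a).Displays c d b i ∧ (T b).Displays c d a i := by
      rw [not_and_or] at hC
      rcases hC with hC | hC
      · exact ⟨h1.resolve_left hC, h2.resolve_left fun h => hC h.swap_left⟩
      · exact ⟨(h3.resolve_left hC).swap_left, (h4.resolve_left fun h => hC h.swap_left).swap_left⟩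
    exact IsCommonCherry.of_displays hS hi hc hd ha hb
      (LabelledGraph.nodup_symm hn) h.symm hA.1 hA.2

theorem Set.three_le_ncard {α : Type*} {s : Set α} (hs : s.Finite) {x y z : α} (hx : x ∈ s)
    (hy : y ∈ s) (hz : z ∈ s) (hxy : x ≠ y) (hxz : x ≠ z) (hyz : y ≠ z) : 3 ≤ s.ncard := by
  have h3 : ({x, y, z} : Set α).ncard = 3 := Set.ncard_eq_three.2 ⟨x, y, z, hxy, hxz, hyz, rfl⟩
  rw [← h3]
  apply Set.ncard_le_ncard _ hs
  rintro w (rfl | rfl | rfl) <;> assumption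

/-! ### The tree with prescribed disjoint cherries -/

namespace CherryTree

variable {L : Type} (S : Finset L) (F : Finset L → Prop)

/-- The vertices of the tree: the leaves, a root, and one vertex for each cherry. -/
abbrev Vert := {x // x ∈ S} ⊕ Option {P : Finset L // F P}

open Classical in
/-- The parent function of the tree with given cherries. -/
noncomputable def par : Vert S F → Vert S F
  | .inl x => if h : ∃ P, F P ∧ x.1 ∈ P then .inr (some ⟨h.choose, h.choose_spec.1⟩) else .inr none
  | .inr _ => .inr none

/-- The distance to the root. -/
def ht : Vert S F → ℕ
  | .inl _ => 2
  | .inr (some _) => 1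
  | .inr none => 0

/-- The graph in which every vertex other than the root is joined to its parent. -/
noncomputable def graph : SimpleGraph (Vert S F) :=
  SimpleGraph.fromRel fun v w => v ≠ .inr none ∧ par S F v = w

/-- The tree with leaf set `S` in which the leaves in each of the sets in `F` form a cherry. -/
noncomputable def tree : LabelledGraph L where
  V := Vert S F
  graph := graph S F
  labels := S
  leaf := fun x => .inl ⟨x.1, x.2⟩

variable {S F}

theorem par_inl_of_mem (hF : ∀ P Q x, F P → F Q → x ∈ P → x ∈ Q → P = Q) {P : Finset L}
    (hP : F P) {x : {x // x ∈ S}} (hx : x.1 ∈ P) : par S F (.inl x) = .inr (some ⟨P, hP⟩) := by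
  have h : ∃ P, F P ∧ x.1 ∈ P := ⟨P, hP, hx⟩
  simp only [par, h, dite_true]
  congr
  exact hF _ _ _ h.choose_spec.1 hP h.choose_spec.2 hx

theorem par_inl_eq_some {x : {x // x ∈ S}} {P : {P : Finset L // F P}}
    (h : par S F (.inl x) = .inr (some P)) : x.1 ∈ P.1 := by
  classical
  by_cases hx : ∃ P, F P ∧ x.1 ∈ P
  · simp only [par, hx, dite_true, Sum.inr.injEq, Option.some.injEq] at h
    rw [← h]; exact hx.choose_spec.2
  · simp [par, hx] at h

theorem par_inl_ne (x y : {x // x ∈ S}) : par S F (.inl x) ≠ .inl y := by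
  classical
  by_cases hx : ∃ P, F P ∧ x.1 ∈ P <;> simp [par, hx]

theorem isRootedTree : IsRootedTree (graph S F) (.inr none : Vert S F) (par S F) (ht S F) where
  adj_iff := by
    intro v w
    rw [graph, SimpleGraph.fromRel_adj]
    constructor
    · rintro ⟨-, h | h⟩
      · exact Or.inl h
      · exact Or.inr h
    · have key : ∀ v : Vert S F, v ≠ .inr none → v ≠ par S F v := by
        rintro (x | _ | P) hv h
        · exact par_inl_ne x x h.symm
        · exact hv rfl
        · simp [par] at h
      rintro (⟨hv, rfl⟩ | ⟨hw, rfl⟩)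
      · exact ⟨key v hv, Or.inl ⟨hv, rfl⟩⟩
      · exact ⟨(key w hw).symm, Or.inr ⟨hw, rfl⟩⟩
  ht_lt := by
    rintro (x | _ | P) hv
    · rcases h : par S F (.inl x) with y | _ | P
      · exact absurd h (par_inl_ne x y)
      · simp [ht]
      · simp [ht]
    · exact absurd rfl hv
    · simp [par, ht]
  par_root := rfl

theorem descends_inl_iff (hF : ∀ P Q x, F P → F Q → x ∈ P → x ∈ Q → P = Q) (v : Vert S F)
    (x : {x // x ∈ S}) : Descends (par S F) v (.inl x) ↔
      v = .inl x ∨ v = .inr none ∨ ∃ P : {P : Finset L // F P}, v = .inr (some P) ∧ x.1 ∈ P.1 := by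
  constructor
  · intro h
    rcases h.eq_or_par with h | h
    · exact Or.inl h.symm
    rcases h.eq_or_par with h | h
    · rcases v with y | _ | P
      · exact absurd h (par_inl_ne x y)
      · exact Or.inr (Or.inl rfl)
      · exact Or.inr (Or.inr ⟨P, rfl, par_inl_eq_some h⟩)
    · right; left
      have h2 : par S F (par S F (.inl x)) = .inr none := by
        rcases h : par S F (.inl x) with y | P
        · exact absurd h (par_inl_ne x y)
        · rfl
      rw [h2] at h
      obtain ⟨n, hn⟩ := h
      rw [Function.iterate_fixed rfl] at hn
      exact hn.symm
  · rintro (rfl | rfl | ⟨P, rfl, hx⟩)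
    · exact Descends.refl _
    · exact isRootedTree.descends_root _
    · exact ⟨1, par_inl_of_mem hF P.2 hx⟩

/-- A cherry vertex is joined to its two leaves and to the root. That the root has three neighbours
uses that there are five leaves and that at most two of them hang from one neighbour. -/
theorem isTreeWithLeaves [DecidableEq L] (hS : S.card = 5) (hF : ∀ P Q x, F P → F Q → x ∈ P → x ∈ Q → P = Q)
    (hFS : ∀ P, F P → P ⊆ S) (hF2 : ∀ P, F P → P.card = 2) :
    (tree S F).IsTreeWithLeaves (S : Set L) := by
  classical
  have hfin : Finite {P : Finset L // F P} :=
    Finite.of_injective (fun P : {P : Finset L // F P} =>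
      (⟨P.1, Finset.mem_powerset.2 (hFS P.1 P.2)⟩ : {Q // Q ∈ S.powerset})) (by
        rintro ⟨P, hP⟩ ⟨Q, hQ⟩ h
        simpa using h)
  have hfinV : Finite (Vert S F) := inferInstance
  have hT := isRootedTree (S := S) (F := F)
  have hleaf : ∀ x : {x // x ∈ S}, ((graph S F).neighborSet (.inl x)).ncard = 1 := by
    intro x
    rw [Set.ncard_eq_one]
    refine ⟨par S F (.inl x), ?_⟩
    ext w
    rw [SimpleGraph.mem_neighborSet, hT.adj_iff]
    constructor
    · rintro (⟨-, rfl⟩ | ⟨hw, h⟩)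
      · rfl
      · rcases w with y | w
        · exact absurd h (par_inl_ne y x)
        · simp [par] at h
    · rintro rfl
      exact Or.inl ⟨by simp, rfl⟩
  have hinner : ∀ v : Option {P : Finset L // F P},
      3 ≤ ((graph S F).neighborSet (.inr v)).ncard := by
    rintro (_ | P)
    · let g : {x // x ∈ S} → Vert S F := fun x =>
        if par S F (.inl x) = .inr none then .inl x else par S F (.inl x)
      have hg : ∀ x, g x ∈ (graph S F).neighborSet (.inr none) := by
        intro x
        rw [SimpleGraph.mem_neighborSet, hT.adj_iff]
        by_cases hx : par S F (.inl x) = .inr none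
        · have : g x = .inl x := if_pos hx
          rw [this]
          exact Or.inr ⟨by simp, hx⟩
        · have : g x = par S F (.inl x) := if_neg hx
          rw [this]
          refine Or.inr ⟨hx, ?_⟩
          rcases h : par S F (.inl x) with y | P
          · exact absurd h (par_inl_ne x y)
          · rfl
      have h1 : (Finset.univ.image g).card ≤
          ((graph S F).neighborSet (.inr none)).ncard := by
        rw [← Set.ncard_coe_finset]
        apply Set.ncard_le_ncard _ (Set.toFinite _)
        intro w hw
        simp only [Finset.coe_image, Finset.coe_univ, Set.image_univ, Set.mem_range] at hw
        obtain ⟨x, rfl⟩ := hw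
        exact hg x
      -- The map `g` sends a leaf to the neighbour of the root on the way to it. No value is taken
      -- more than twice, so five leaves require at least three values.
      have h2 : (Finset.univ : Finset {x // x ∈ S}).card ≤ 2 * (Finset.univ.image g).card := by
        apply Finset.card_le_mul_card_image
        intro b hb
        rcases b with y | _ | P
        · calc _ ≤ ({y} : Finset {x // x ∈ S}).card := by
                apply Finset.card_le_card
                intro x hx
                simp only [Finset.mem_filter, Finset.mem_univ, true_and] at hx
                by_cases hx' : par S F (.inl x) = .inr none
                · simp only [g, hx', if_true, Sum.inl.injEq] at hx
                  simp [hx]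
                · simp only [g, hx', if_false] at hx
                  exact absurd hx (par_inl_ne x y)
            _ ≤ 2 := by simp
        · calc _ ≤ (∅ : Finset {x // x ∈ S}).card := by
                apply Finset.card_le_card
                intro x hx
                simp only [Finset.mem_filter, Finset.mem_univ, true_and] at hx
                by_cases hx' : par S F (.inl x) = .inr none
                · simp [g, hx'] at hx
                · simp [g, hx'] at hx
            _ ≤ 2 := by simp
        · rw [← hF2 P.1 P.2]
          apply Finset.card_le_card_of_injOn (fun x => x.1)
          · intro x hx
            simp only [Finset.coe_filter, Finset.mem_univ, true_and, Set.mem_ofPred_eq] at hx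
            by_cases hx' : par S F (.inl x) = .inr none
            · simp [g, hx'] at hx
            · simp only [g, hx', if_false] at hx
              exact par_inl_eq_some hx
          · intro x _ y _ h
            exact Subtype.ext h
      rw [Finset.card_univ, Fintype.card_coe, hS] at h2
      omega
    · obtain ⟨x, y, hxy, hPe⟩ := Finset.card_eq_two.1 (hF2 P.1 P.2)
      have hx : x ∈ P.1 := by rw [hPe]; simp
      have hy : y ∈ P.1 := by rw [hPe]; simp
      apply Set.three_le_ncard (Set.toFinite _) (x := (.inl ⟨x, hFS _ P.2 hx⟩ : Vert S F))
        (y := .inl ⟨y, hFS _ P.2 hy⟩) (z := .inr none)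
      · rw [SimpleGraph.mem_neighborSet, hT.adj_iff]
        exact Or.inr ⟨by simp, par_inl_of_mem hF P.2 hx⟩
      · rw [SimpleGraph.mem_neighborSet, hT.adj_iff]
        exact Or.inr ⟨by simp, par_inl_of_mem hF P.2 hy⟩
      · rw [SimpleGraph.mem_neighborSet, hT.adj_iff]
        exact Or.inl ⟨by simp, rfl⟩
      · simpa using hxy
      · simp
      · simp
  refine LabelledGraph.isTreeWithLeaves_of (T := tree S F) rfl hfinV hT.isTree ?_
    (fun x => hleaf ⟨x.1, x.2⟩) ?_
  · rintro ⟨x, hx⟩ ⟨y, hy⟩ h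
    exact Subtype.ext (congrArg Subtype.val (Sum.inl_injective h))
  · rintro (x | v) hv
    · exact absurd ⟨⟨x.1, x.2⟩, rfl⟩ hv
    · exact hinner v

/-- A vertex that has two leaves but not all of them below it can only be a cherry vertex, and then
the two leaves are the cherry. -/
theorem displays_iff [DecidableEq L] (hF : ∀ P Q x, F P → F Q → x ∈ P → x ∈ Q → P = Q)
    (hF2 : ∀ P, F P → P.card = 2) {a b c d : L} (ha : a ∈ S) (hb : b ∈ S) (hc : c ∈ S)
    (hd : d ∈ S) (hn : [a, b, c, d].Nodup) :
    (tree S F).Displays a b c d ↔ F {a, b} ∨ F {c, d} := by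
  have hab : a ≠ b := by simp only [List.nodup_cons, List.mem_cons] at hn; tauto
  have hcd : c ≠ d := by simp only [List.nodup_cons, List.mem_cons] at hn; tauto
  have key : ∀ x y z t, x ∈ S → y ∈ S → z ∈ S → t ∈ S → x ≠ y →
      ∀ (hx : x ∈ S) (hy : y ∈ S) (hz : z ∈ S) (v : Vert S F),
      Descends (par S F) v (.inl ⟨x, hx⟩) → Descends (par S F) v (.inl ⟨y, hy⟩) →
      ¬ Descends (par S F) v (.inl ⟨z, hz⟩) → F {x, y} := by
    intro x y z t _ _ _ _ hxy hx hy hz v h1 h2 h3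
    rw [descends_inl_iff hF] at h1 h2 h3
    push Not at h3
    rcases h1 with rfl | rfl | ⟨P, rfl, h1⟩
    · rcases h2 with h2 | h2 | ⟨P, h2, -⟩
      · simp at h2; exact absurd h2 hxy
      · simp at h2
      · simp at h2
    · exact absurd rfl h3.2.1
    · rcases h2 with h2 | h2 | ⟨Q, h2, h4⟩
      · simp at h2
      · simp at h2
      · simp only [Sum.inr.injEq, Option.some.injEq] at h2
        subst h2
        have : ({x, y} : Finset L) = P.1 := by
          apply Finset.eq_of_subset_of_card_le
          · intro w hw
            simp only [Finset.mem_insert, Finset.mem_singleton] at hw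
            rcases hw with rfl | rfl <;> assumption
          · rw [hF2 P.1 P.2, Finset.card_pair hxy]
        rw [this]; exact P.2
  have back : ∀ x y z, ∀ (hx : x ∈ S) (hy : y ∈ S) (hz : z ∈ S), z ≠ x → z ≠ y →
      ∀ h : F {x, y}, Descends (par S F) (.inr (some ⟨{x, y}, h⟩)) (.inl ⟨x, hx⟩) ∧
      Descends (par S F) (.inr (some ⟨{x, y}, h⟩)) (.inl ⟨y, hy⟩) ∧
      ¬ Descends (par S F) (.inr (some ⟨{x, y}, h⟩)) (.inl ⟨z, hz⟩) := by
    intro x y z hx hy hz h1 h2 h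
    simp only [descends_inl_iff hF]
    simp [h1, h2]
  rw [IsRootedTree.displays_iff (T := tree S F) isRootedTree]
  constructor
  · rintro ⟨_, _, _, _, v, ⟨h1, h2, h3, -⟩ | ⟨h1, h2, h3, -⟩⟩
    · exact Or.inl (key a b c d ha hb hc hd hab _ _ _ v h1 h2 h3)
    · exact Or.inr (key c d a b hc hd ha hb hcd _ _ _ v h1 h2 h3)
  · simp only [List.nodup_cons, List.mem_cons, List.not_mem_nil, or_false, not_or] at hn
    obtain ⟨⟨-, h13, h14⟩, ⟨h23, h24⟩, -, -⟩ := hn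
    rintro (h | h)
    · have h1 := back a b c ha hb hc (Ne.symm h13) (Ne.symm h23) h
      have h2 := back a b d ha hb hd (Ne.symm h14) (Ne.symm h24) h
      exact ⟨ha, hb, hc, hd, _, Or.inl ⟨h1.1, h1.2.1, h1.2.2, h2.2.2⟩⟩
    · have h1 := back c d a hc hd ha h13 h14 h
      have h2 := back c d b hc hd hb h23 h24 h
      exact ⟨ha, hb, hc, hd, _, Or.inr ⟨h1.1, h1.2.1, h1.2.2, h2.2.2⟩⟩

end CherryTree

/-- The common tree is the one whose cherries are the common cherries: a displayed quartet contains
a common cherry, and conversely a common cherry determines the quartets of every other tree. -/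
theorem QuartetsCompatible.exists_tree {L : Type} [DecidableEq L] {S : Finset L}
    {T : L → LabelledGraph L} (hT : QuartetsCompatible S T) (hS : S.card = 5) :
    ∃ T₀ : LabelledGraph L, T₀.IsTreeWithLeaves (S : Set L) ∧
      ∀ i ∈ S, (T i).SameQuartets (T₀.delete i) := by
  have hF : ∀ P Q x, IsCommonCherry S T P → IsCommonCherry S T Q → x ∈ P → x ∈ Q → P = Q :=
    fun P Q x hP hQ => hP.eq_of_mem hS hT hQ
  refine ⟨CherryTree.tree S (IsCommonCherry S T), CherryTree.isTreeWithLeaves hS hF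
    (fun P hP => hP.subset) (fun P hP => hP.card_eq), fun i hi => ⟨hT.labels_eq i hi, ?_⟩⟩
  intro a b c d hn
  rw [LabelledGraph.displays_delete_iff]
  have mem : ∀ x, x ∈ (T i).labels → x ∈ S ∧ x ≠ i := by
    intro x hx
    rw [hT.labels_eq i hi] at hx
    exact hx
  have nodup : a ≠ i → b ≠ i → c ≠ i → d ≠ i → [i, a, b, c, d].Nodup := by
    intro h1 h2 h3 h4
    refine List.nodup_cons.2 ⟨?_, hn⟩
    simp only [List.mem_cons, List.not_mem_nil, or_false, not_or]
    exact ⟨h1.symm, h2.symm, h3.symm, h4.symm⟩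
  constructor
  · intro h
    obtain ⟨ha, hb, hc, hd, -⟩ := id h
    obtain ⟨ha, hai⟩ := mem a ha
    obtain ⟨hb, hbi⟩ := mem b hb
    obtain ⟨hc, hci⟩ := mem c hc
    obtain ⟨hd, hdi⟩ := mem d hd
    refine ⟨?_, hai, hbi, hci, hdi⟩
    rw [CherryTree.displays_iff hF (fun P hP => hP.card_eq) ha hb hc hd hn]
    exact hT.isCommonCherry hS hi ha hb hc hd (nodup hai hbi hci hdi) h
  · rintro ⟨h, hai, hbi, hci, hdi⟩
    obtain ⟨ha, hb, hc, hd, -⟩ := id h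
    rw [CherryTree.displays_iff hF (fun P hP => hP.card_eq) ha hb hc hd hn] at h
    have hn' := nodup hai hbi hci hdi
    rcases h with h | h
    · exact h.displays hi hc hd hn'
    · exact (h.displays hi ha hb (LabelledGraph.nodup_symm hn')).symm

theorem QuartetsCompatible.arrangementCondition {L : Type} [DecidableEq L] (k : ℕ) {S : Finset L}
    {T : L → LabelledGraph L} (hT : QuartetsCompatible S T) (hS : S.card = k + 5) :
    ArrangementCondition (k + 1) S T := by
  induction k generalizing S T with
  | zero => exact hT.exists_tree hS
  | succ k ih =>
    intro i hi
    exact ih (hT.delete i) (by rw [Finset.card_erase_of_mem hi, hS]; rfl)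

/-! ### Traversing a complex of labelled cells -/

/-- The summand of the face of a cell on which the coordinate `r` is maximal. -/
def topFace (r : Fin 3) (X : Finset (Fin 3)) : Finset (Fin 3) := if r ∈ X then {r} else X

/-- The summand of the face of a cell on which the coordinate `r` is minimal. -/
def botFace (r : Fin 3) (X : Finset (Fin 3)) : Finset (Fin 3) := if X = {r} then {r} else X.erase r

section

variable {r : Fin 3} {X Y : Finset (Fin 3)}

theorem topFace_of_mem (h : r ∈ X) : topFace r X = {r} := if_pos h

theorem topFace_of_notMem (h : r ∉ X) : topFace r X = X := if_neg h

theorem botFace_singleton : botFace r {r} = {r} := if_pos rfl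

theorem botFace_of_ne (h : X ≠ {r}) : botFace r X = X.erase r := if_neg h

theorem topFace_eq_singleton_iff : topFace r X = {r} ↔ r ∈ X := by
  by_cases h : r ∈ X
  · simp [topFace, h]
  · simp only [topFace, h, if_false, iff_false]
    rintro rfl
    simp at h

theorem botFace_eq_singleton_iff : botFace r X = {r} ↔ X = {r} := by
  by_cases h : X = {r}
  · simp [botFace, h]
  · simp only [botFace, h, if_false, iff_false]
    intro h'
    have : r ∈ X.erase r := by rw [h']; simp
    simp at this

theorem mem_iff_eq_of_topFace_eq_botFace (h : topFace r X = botFace r Y) : r ∈ X ↔ Y = {r} := by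
  rw [← topFace_eq_singleton_iff, h, botFace_eq_singleton_iff]

theorem eq_erase_of_topFace_eq_botFace (h : topFace r X = botFace r Y) (hY : Y ≠ {r}) :
    X = Y.erase r := by
  have : r ∉ X := fun hr => hY ((mem_iff_eq_of_topFace_eq_botFace h).1 hr)
  rwa [topFace_of_notMem this, botFace_of_ne hY] at h

theorem erase_eq_of_topFace_eq_botFace (h : topFace r X = botFace r Y) (hX : r ∉ X) :
    Y.erase r = X := by
  have : Y ≠ {r} := fun hr => hX ((mem_iff_eq_of_topFace_eq_botFace h).2 hr)
  rw [topFace_of_notMem hX, botFace_of_ne this] at h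
  exact h.symm

theorem compl_singleton_ne (r : Fin 3) : ({r}ᶜ : Finset (Fin 3)) ≠ {r} := by
  revert r; decide

theorem eq_of_compl_subset (h : {r}ᶜ ⊆ X) : X = {r}ᶜ ∨ X = Finset.univ := by
  revert r X; decide

set_option synthInstance.maxSize 512 in
theorem compl_subset_of_mem {p q r : Fin 3} (hpq : p ≠ q) (hpr : p ≠ r) (hqr : q ≠ r)
    (hp : p ∈ X) (hX : X ≠ {p}) : {r}ᶜ ⊆ X ∨ X = {q}ᶜ := by
  revert p q r X; decide

theorem compl_subset_of_mem_mem {p q r : Fin 3} (hpq : p ≠ q) (hpr : p ≠ r) (hqr : q ≠ r)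
    (hp : p ∈ X) (hq : q ∈ X) : {r}ᶜ ⊆ X := by
  revert p q r X; decide

theorem eq_compl_of_mem_mem {p q r : Fin 3} (hpq : p ≠ q) (hpr : p ≠ r) (hqr : q ≠ r)
    (hp : p ∈ X) (hq : q ∈ X) (hr : r ∉ X) : X = {r}ᶜ := by
  revert p q r X; decide

theorem mem_of_erase_eq_singleton {p q : Fin 3} (h : X.erase q = {p}) : p ∈ X := by
  have : p ∈ X.erase q := by rw [h]; simp
  exact Finset.mem_of_mem_erase this

theorem eq_of_erase_eq {q : Fin 3} (h : X.erase q = Y) (hq : q ∉ X) : X = Y := by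
  rwa [Finset.erase_eq_of_notMem hq] at h

end

/-- A set of labelled cells in which one can walk along each line: from every cell on the line `l` to
the neighbours of the cell on this line, unless all other lines have been passed. -/
structure IsTraversable {L : Type} (K : Set (L → Finset (Fin 3))) : Prop where
  cross : ∀ N ∈ K, ∀ l r, N l = {r}ᶜ → ∃ k, r ∈ N k ∧ N k ≠ {r}
  up : ∀ N ∈ K, ∀ l r, N l = {r}ᶜ →
    (∃ N' ∈ K, ∀ k, topFace r (N k) = botFace r (N' k)) ∨ ∀ k, k ≠ l → r ∈ N k
  down : ∀ N ∈ K, ∀ l r, {r}ᶜ ⊆ N l →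
    (∃ N' ∈ K, N' l = {r}ᶜ ∧ ∀ k, topFace r (N' k) = botFace r (N k)) ∨ ∀ k, N k ≠ {r}

/-- Some edge dual to the line `l` separates the lines `a`, `b` from the lines `c`, `d`. -/
def LegDisplays {L : Type} (K : Set (L → Finset (Fin 3))) (l a b c d : L) : Prop :=
  ∃ N ∈ K, ∃ r, N l = {r}ᶜ ∧
    ((r ∈ N a ∧ r ∈ N b ∧ r ∉ N c ∧ r ∉ N d) ∨ (r ∈ N c ∧ r ∈ N d ∧ r ∉ N a ∧ r ∉ N b))

namespace LegDisplays

variable {L : Type} {K : Set (L → Finset (Fin 3))} {l a b c d : L}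

theorem symm (h : LegDisplays K l a b c d) : LegDisplays K l c d a b := by
  obtain ⟨N, hN, r, hr, h⟩ := h
  exact ⟨N, hN, r, hr, h.symm⟩

theorem swap_left (h : LegDisplays K l a b c d) : LegDisplays K l b a c d := by
  obtain ⟨N, hN, r, hr, h⟩ := h
  exact ⟨N, hN, r, hr, by tauto⟩

theorem swap_right (h : LegDisplays K l a b c d) : LegDisplays K l a b d c :=
  h.symm.swap_left.symm

end LegDisplays

namespace IsTraversable

variable {L : Type} {K : Set (L → Finset (Fin 3))} {N : L → Finset (Fin 3)}
  {i a b c d : L} {p q r : Fin 3}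

/-- Walk down on the line `l` to the first crossing with one of the lines in `P`. -/
theorem exists_down [Finite L] (hK : IsTraversable K) (hN : N ∈ K) {l : L} (hl : {r}ᶜ ⊆ N l)
    {P : L → Prop} (hP : ∃ k, P k) (hPN : ∀ k, P k → N k = {r}) :
    ∃ D ∈ K, D l = {r}ᶜ ∧ (∀ k, P k → r ∈ D k) ∧ (∃ k, P k ∧ D k ≠ {r}) ∧
      ∀ k, N k ≠ {r} → D k = (N k).erase r := by
  induction hn : {k | N k = {r}}.ncard using Nat.strong_induction_on generalizing N with
  | _ n ih =>
    obtain ⟨c, hc⟩ := hP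
    rcases hK.down N hN l r hl with ⟨N', hN', hl', hs⟩ | h
    · have h1 : ∀ k, N k ≠ {r} → N' k = (N k).erase r :=
        fun k hk => eq_erase_of_topFace_eq_botFace (hs k) hk
      have h2 : ∀ k, P k → r ∈ N' k :=
        fun k hk => (mem_iff_eq_of_topFace_eq_botFace (hs k)).2 (hPN k hk)
      by_cases hex : ∃ k, P k ∧ N' k ≠ {r}
      · exact ⟨N', hN', hl', h2, hex, h1⟩
      · push Not at hex
        -- Lines passed at `N'` are also passed at `N`, and a line that crosses `l` at `N'` is
        -- passed at `N` only.
        have hlt : {k | N' k = {r}}.ncard < n := by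
          rw [← hn]
          apply Set.ncard_lt_ncard _ (Set.toFinite _)
          refine ⟨fun k hk => ?_, fun hsub => ?_⟩
          · have hk : N' k = {r} := hk
            exact (mem_iff_eq_of_topFace_eq_botFace (hs k)).1 (by rw [hk]; simp)
          · obtain ⟨k, hk, hk'⟩ := hK.cross N' hN' l r hl'
            exact hk' (hsub ((mem_iff_eq_of_topFace_eq_botFace (hs k)).1 hk))
        obtain ⟨D, hD, h3, h4, h5, h6⟩ := ih _ hlt hN' hl'.ge hex rfl
        refine ⟨D, hD, h3, h4, h5, fun k hk => ?_⟩
        have hne : N' k ≠ {r} := by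
          intro h
          have : r ∈ N' k := by rw [h]; simp
          rw [h1 k hk] at this
          simp at this
        rw [h6 k hne, h1 k hk, Finset.erase_idem]
    · exact absurd (hPN c hc) (h c)

/-- Walk up on the line `l` to the first crossing with one of the lines in `P`, or to the apex. -/
theorem exists_up [Finite L] (hK : IsTraversable K) (hN : N ∈ K) {l : L} (hl : N l = {r}ᶜ)
    {P : L → Prop} (hP : ∃ k, P k ∧ k ≠ l ∧ r ∉ N k) :
    ∃ U ∈ K, {r}ᶜ ⊆ U l ∧ (∀ k, r ∈ N k → U k = {r}) ∧
      (∀ k, P k → r ∉ N k → (U k).erase r = N k) ∧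
      (U l = Finset.univ ∨ ∃ k, P k ∧ r ∉ N k ∧ r ∈ U k) := by
  induction hn : {k | r ∉ N k}.ncard using Nat.strong_induction_on generalizing N with
  | _ n ih =>
    obtain ⟨c, hc, hcl, hcN⟩ := hP
    rcases hK.up N hN l r hl with ⟨N', hN', hs⟩ | h
    · have h1 : ∀ k, r ∈ N k → N' k = {r} :=
        fun k hk => (mem_iff_eq_of_topFace_eq_botFace (hs k)).1 hk
      have h2 : ∀ k, r ∉ N k → (N' k).erase r = N k :=
        fun k hk => erase_eq_of_topFace_eq_botFace (hs k) hk
      have hl' : {r}ᶜ ⊆ N' l := by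
        rw [← hl, ← h2 l (by rw [hl]; simp)]
        exact Finset.erase_subset _ _
      by_cases hflip : N' l = Finset.univ ∨ ∃ k, P k ∧ r ∉ N k ∧ r ∈ N' k
      · exact ⟨N', hN', hl', h1, fun k _ => h2 k, hflip⟩
      · push Not at hflip
        have hl'' : N' l = {r}ᶜ := (eq_of_compl_subset hl').resolve_right hflip.1
        have h3 : ∀ k, P k → r ∉ N k → N' k = N k :=
          fun k hk hk' => eq_of_erase_eq (h2 k hk') (hflip.2 k hk hk')
        have hlt : {k | r ∉ N' k}.ncard < n := by
          rw [← hn]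
          apply Set.ncard_lt_ncard _ (Set.toFinite _)
          refine ⟨fun k hk hk' => hk (by rw [h1 k hk']; simp), fun hsub => ?_⟩
          obtain ⟨k, hk, hk'⟩ := hK.cross N' hN' l r hl''
          exact hsub (a := k) (fun h => hk' (h1 k h)) hk
        obtain ⟨U, hU, h4, h5, h6, h7⟩ := ih _ hlt hN' hl''
          ⟨c, hc, hcl, by rw [h3 c hc hcN]; exact hcN⟩ rfl
        refine ⟨U, hU, h4, fun k hk => h5 k (by rw [h1 k hk]; simp), fun k hk hk' => ?_, ?_⟩
        · rw [h6 k hk (by rw [h3 k hk hk']; exact hk'), h3 k hk hk']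
        · refine h7.imp id ?_
          rintro ⟨k, hk, hk', hk''⟩
          exact ⟨k, hk, fun h => hk' (by rw [h1 k h]; simp), hk''⟩
    · exact absurd (h c hcl) hcN

theorem legDisplays_of_top (hN : N ∈ K) {l : L} (hl : N l = {r}ᶜ) (ha : r ∈ N a) (hb : r ∈ N b)
    (hc : r ∉ N c) (hd : r ∉ N d) : LegDisplays K l a b c d :=
  ⟨N, hN, r, hl, Or.inl ⟨ha, hb, hc, hd⟩⟩

theorem exists_cell_below (hK : IsTraversable K) (hN : N ∈ K) {l : L} (hl : {r}ᶜ ⊆ N l)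
    (ha : N a = {r}) : ∃ N' ∈ K, N' l = {r}ᶜ ∧ (∀ k, N k = {r} → r ∈ N' k) ∧
      ∀ k, N k ≠ {r} → N' k = (N k).erase r := by
  rcases hK.down N hN l r hl with ⟨N', hN', hl', hs⟩ | h
  · exact ⟨N', hN', hl', fun k hk => (mem_iff_eq_of_topFace_eq_botFace (hs k)).2 hk,
      fun k hk => eq_erase_of_topFace_eq_botFace (hs k) hk⟩
  · exact absurd ha (h a)

/-- The lower edge of `N` on the leg `r` is the upper edge of the next cell down, and the lines
passed there are those with summand `{r}` in `N`. -/
theorem legDisplays_of_bot (hK : IsTraversable K) (hN : N ∈ K) {l : L} (hl : {r}ᶜ ⊆ N l)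
    (ha : N a = {r}) (hb : N b = {r}) (hc : N c ≠ {r}) (hd : N d ≠ {r}) :
    LegDisplays K l a b c d := by
  obtain ⟨N', hN', hl', h1, h2⟩ := hK.exists_cell_below hN hl ha
  exact legDisplays_of_top hN' hl' (h1 a ha) (h1 b hb) (by simp [h2 c hc]) (by simp [h2 d hd])

theorem ne_of_mem {p q : Fin 3} (hpq : p ≠ q) {X : Finset (Fin 3)} (h : q ∈ X) : X ≠ {p} := by
  rintro rfl
  exact hpq (Finset.mem_singleton.1 h).symm

/-- The line `c` leaves the sector `p` at this cell, so it has either the leg `r` or the leg `q`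
there. In the first case the lower edge has `a`, `b` on its passed side, in the second case the
upper edge has `d`, `i` there. -/
theorem legDisplays_of_cross (hK : IsTraversable K) (hN : N ∈ K) (hpq : p ≠ q) (hpr : p ≠ r)
    (hqr : q ≠ r) (ha : N a = {r}) (hb : N b = {r}) (hd : q ∈ N d) (hi : q ∈ N i) (hc : p ∈ N c)
    (hc' : N c ≠ {p}) : LegDisplays K c a b d i := by
  rcases compl_subset_of_mem hpq hpr hqr hc hc' with h | h
  · exact hK.legDisplays_of_bot hN h ha hb (ne_of_mem hqr.symm hd) (ne_of_mem hqr.symm hi)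
  · exact (legDisplays_of_top hN h hd hi (by simpa [ha] using hqr) (by simpa [hb] using hqr)).symm

/-- If the lines `i`, `c`, `d` are pairwise distinct at an edge of `i` and this edge separates `a` and
`b` from them, then `a` and `b` are also together on the line `c`. -/
theorem legDisplays_of_cherry [Finite L] (hK : IsTraversable K) (hN : N ∈ K) (hpq : p ≠ q)
    (hpr : p ≠ r) (hqr : q ≠ r) (hi : N i = {r}ᶜ) (ha : r ∈ N a) (hb : r ∈ N b) (hc : N c = {p})
    (hd : q ∈ N d) (hd' : r ∉ N d) : LegDisplays K c a b d i := by
  have hcr : r ∉ N c := by simpa [hc] using hpr.symm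
  have hci : c ≠ i := by
    rintro rfl
    rw [hc] at hi
    have : q ∈ ({r}ᶜ : Finset (Fin 3)) := by simpa using hqr
    rw [← hi] at this
    exact hpq (Finset.mem_singleton.1 this).symm
  -- At `U` the lines `a` and `b` have been passed, and either `c` or `d` is crossed or `i` has its
  -- apex there.
  obtain ⟨U, hU, hUi, hUr, hUe, hUs⟩ := hK.exists_up hN hi (P := fun k => k = c ∨ k = d)
    ⟨c, Or.inl rfl, hci, hcr⟩
  have hUa := hUr a ha
  have hUb := hUr b hb
  have hUc := hUe c (Or.inl rfl) hcr
  have hUd := hUe d (Or.inr rfl) hd'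
  rw [hc] at hUc
  have hUd' : q ∈ U d := Finset.mem_of_mem_erase (a := r) (by rw [hUd]; exact hd)
  have hUi' : q ∈ U i := hUi (by simpa using hqr)
  have hUc' : p ∈ U c := mem_of_erase_eq_singleton hUc
  by_cases hUcr : r ∈ U c
  · exact hK.legDisplays_of_cross hU hpq hpr hqr hUa hUb hUd' hUi' hUc' (ne_of_mem hpr hUcr)
  have hUc := eq_of_erase_eq hUc hUcr
  have hap : U a ≠ {p} := ne_of_mem hpr (by simp [hUa])
  have hbp : U b ≠ {p} := ne_of_mem hpr (by simp [hUb])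
  -- If `c` is not crossed at `U`, it is found by going down a leg `p` of some line through `U`. On
  -- the way `a`, `b` remain at `{r}` and the summands of `d`, `i` keep the point `q`, so the
  -- previous crossing argument applies.
  have hleg : ∀ l, {p}ᶜ ⊆ U l → LegDisplays K c a b d i := by
    intro l hl
    obtain ⟨D, hD, -, hDc, ⟨k, rfl, hDc'⟩, hDe⟩ := hK.exists_down hU hl (P := fun k => k = c)
      ⟨c, rfl⟩ (by rintro k rfl; exact hUc)
    refine hK.legDisplays_of_cross hD hpq hpr hqr ?_ ?_ ?_ ?_ (hDc _ rfl) hDc'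
    · rw [hDe a hap, hUa, Finset.erase_eq_of_notMem (by simpa using hpr)]
    · rw [hDe b hbp, hUb, Finset.erase_eq_of_notMem (by simpa using hpr)]
    · rw [hDe d (ne_of_mem hpq hUd')]
      exact Finset.mem_erase.2 ⟨hpq.symm, hUd'⟩
    · rw [hDe i (ne_of_mem hpq hUi')]
      exact Finset.mem_erase.2 ⟨hpq.symm, hUi'⟩
  rcases hUs with hUs | ⟨k, rfl | rfl, -, hk⟩
  · exact hleg i (by rw [hUs]; exact Finset.subset_univ _)
  · exact absurd hk hUcr
  · exact hleg k (compl_subset_of_mem_mem hqr hpq.symm hpr.symm hUd' hk)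

/-- One step down the leg `p` of `b`, the lines `c` and `d` are on the passed side, while `a` and
`i` are not passed and lie in different directions. This is the situation of
`legDisplays_of_cherry`, with `b` as the line that is followed. -/
theorem legDisplays_of_parallel [Finite L] (hK : IsTraversable K) (hN : N ∈ K) (hpq : p ≠ q)
    (hpr : p ≠ r) (hqr : q ≠ r) (hb : {p}ᶜ ⊆ N b) (hc : N c = {p}) (hd : N d = {p})
    (ha : N a = {r}) (hi : q ∈ N i) : LegDisplays K a c d b i := by
  obtain ⟨N', hN', hl', h1, h2⟩ := hK.exists_cell_below hN hb hc
  have hip := h2 i (ne_of_mem hpq hi)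
  refine (hK.legDisplays_of_cherry hN' (p := r) (q := q) (r := p) hqr.symm hpr.symm hpq.symm hl'
    (h1 c hc) (h1 d hd) ?_ (d := i) ?_ ?_).swap_right
  · rw [h2 a (ne_of_mem hpr (by simp [ha])), ha, Finset.erase_eq_of_notMem (by simpa using hpr)]
  · rw [hip]; exact Finset.mem_erase.2 ⟨hpq.symm, hi⟩
  · simp [hip]

/-- The case of `legDisplays_transfer` in which the line `i` crosses the line `b` at the cell `N`. -/
theorem legDisplays_transfer_of_cross [Finite L] (hK : IsTraversable K) (hN : N ∈ K) (hpq : p ≠ q)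
    (hpr : p ≠ r) (hqr : q ≠ r) (hi : N i = {r}ᶜ) (ha : r ∈ N a) (hb : r ∈ N b) (hb' : N b ≠ {r})
    (hc : N c = {p}) (hd : N d = {p}) : LegDisplays K c a b d i ∨
      LegDisplays K b c d a i ∧ (N a = {r} → LegDisplays K a c d b i) := by
  have hqi : q ∈ N i := by rw [hi]; simpa using hqr
  have hap : N a ≠ {p} := ne_of_mem hpr ha
  have hipp : N i ≠ {p} := ne_of_mem hpq hqi
  -- If `b` has the leg `p` at `N`, the lower edge of that leg separates `c`, `d` from `a`, `i`.
  by_cases hqb : q ∈ N b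
  · have hpb : {p}ᶜ ⊆ N b := compl_subset_of_mem_mem hqr hpq.symm hpr.symm hqb hb
    exact Or.inr ⟨hK.legDisplays_of_bot hN hpb hc hd hap hipp,
      fun ha => hK.legDisplays_of_parallel hN hpq hpr hqr hpb hc hd ha hqi⟩
  have hbq : N b = {q}ᶜ :=
    (compl_subset_of_mem hqr.symm hpr.symm hpq.symm hb hb').resolve_left fun h =>
      hqb (h (by simpa using hpq.symm))
  have hcq : q ∉ N c := by simpa [hc] using hpq.symm
  have hdq : q ∉ N d := by simpa [hd] using hpq.symm
  -- Now `b` has the leg `q` at `N`. If `a` is also met there, the upper edge of `b` does the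
  -- separation.
  by_cases hqa : q ∈ N a
  · exact Or.inr ⟨(legDisplays_of_top hN hbq hqa hqi hcq hdq).symm,
      fun h => absurd h (ne_of_mem hqr.symm hqa)⟩
  have hcb : c ≠ b := by rintro rfl; rw [hc] at hb; exact hpr (Finset.mem_singleton.1 hb).symm
  -- Otherwise `b` is followed to the next crossing with `a`, `c` or `d`, or to its apex. A crossing
  -- with `c` or `d` yields the first alternative. If there is none at `U`, then `c` and `d` are
  -- still in the sector `p`, and the crossing with `a` or the apex yields the second one.
  obtain ⟨U, hU, hUb, hUr, hUe, hUs⟩ := hK.exists_up hN hbq (P := fun k => k = a ∨ k = c ∨ k = d)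
    ⟨c, Or.inr (Or.inl rfl), hcb, hcq⟩
  have hUi := hUr i hqi
  have hUa := hUe a (Or.inl rfl) hqa
  have hUc := hUe c (Or.inr (Or.inl rfl)) hcq
  have hUd := hUe d (Or.inr (Or.inr rfl)) hdq
  rw [hc] at hUc
  rw [hd] at hUd
  have hra : r ∈ U a := Finset.mem_of_mem_erase (a := q) (by rw [hUa]; exact ha)
  have hrb : r ∈ U b := hUb (by simpa using hqr.symm)
  have hpc := mem_of_erase_eq_singleton hUc
  have hpd := mem_of_erase_eq_singleton hUd
  have hrc : r ∉ U c := fun h => by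
    have : r ∈ (U c).erase q := Finset.mem_erase.2 ⟨hqr.symm, h⟩
    rw [hUc] at this
    exact hpr (Finset.mem_singleton.1 this).symm
  have hrd : r ∉ U d := fun h => by
    have : r ∈ (U d).erase q := Finset.mem_erase.2 ⟨hqr.symm, h⟩
    rw [hUd] at this
    exact hpr (Finset.mem_singleton.1 this).symm
  have hri : r ∉ U i := by simpa [hUi] using hqr.symm
  by_cases hqc : q ∈ U c
  · exact Or.inl (legDisplays_of_top hU (eq_compl_of_mem_mem hpq hpr hqr hpc hqc hrc)
      hra hrb hrd hri)
  have hUc := eq_of_erase_eq hUc hqc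
  by_cases hqd : q ∈ U d
  · exact Or.inl (hK.legDisplays_of_cherry hU hpq hpr hqr
      (eq_compl_of_mem_mem hpq hpr hqr hpd hqd hrd) hra hrb hUc (by simp [hUi]) hri).swap_right
  have hUd := eq_of_erase_eq hUd hqd
  have hUap : U a ≠ {p} := ne_of_mem hpr hra
  have hUip : U i ≠ {p} := ne_of_mem hpq (by simp [hUi])
  right
  have hbuniv : U b = Finset.univ → {p}ᶜ ⊆ U b := fun h => by rw [h]; exact Finset.subset_univ _
  constructor
  · rcases eq_of_compl_subset hUb with h | h
    · have hqa : q ∈ U a := by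
        rcases hUs with hUs | ⟨k, rfl | rfl | rfl, -, hk⟩
        · rw [hUs] at h
          have : q ∈ ({q}ᶜ : Finset (Fin 3)) := by rw [← h]; simp
          simp at this
        · exact hk
        · exact absurd hk hqc
        · exact absurd hk hqd
      exact (legDisplays_of_top hU h hqa (by simp [hUi]) hqc hqd).symm
    · exact hK.legDisplays_of_bot hU (hbuniv h) hUc hUd hUap hUip
  · intro har
    rw [har] at hUa
    by_cases hqa : q ∈ U a
    · exact hK.legDisplays_of_bot hU (compl_subset_of_mem_mem hqr hpq.symm hpr.symm hqa hra) hUc hUd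
        (ne_of_mem hpr hrb) hUip
    · have hUs : U b = Finset.univ := by
        rcases hUs with hUs | ⟨k, rfl | rfl | rfl, -, hk⟩
        · exact hUs
        · exact absurd hk hqa
        · exact absurd hk hqc
        · exact absurd hk hqd
      exact hK.legDisplays_of_parallel hU hpq hpr hqr (hbuniv hUs) hUc hUd
        (eq_of_erase_eq hUa hqa) (by simp [hUi])

/-- At an edge of `i` that separates `a`, `b` from `c`, `d`, the line `c` may share the edge, and
then this edge serves for `c` as well. If `c` and `d` lie in different directions,
`legDisplays_of_cherry` applies. If they lie in the same sector, `i` is followed down to its first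
crossing with `a` or `b`. -/
theorem legDisplays_transfer [Finite L] (hK : IsTraversable K) (hne : ∀ N ∈ K, ∀ k, (N k).Nonempty)
    (h : LegDisplays K i a b c d) : LegDisplays K c a b d i ∨ LegDisplays K a c d b i := by
  have key : ∀ {a b c d : L} {N : L → Finset (Fin 3)} {r : Fin 3}, N ∈ K → N i = {r}ᶜ →
      r ∈ N a → r ∈ N b → r ∉ N c → r ∉ N d →
      LegDisplays K c a b d i ∨ LegDisplays K a c d b i := by
    intro a b c d N r hN hi ha hb hc hd
    by_cases hc' : N c = {r}ᶜ
    · exact Or.inl (legDisplays_of_top hN hc' ha hb hd (by simp [hi]))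
    obtain ⟨p, q, hpq, hpr, hqr, hcp⟩ : ∃ p q, p ≠ q ∧ p ≠ r ∧ q ≠ r ∧ N c = {p} := by
      have := hne N hN c
      revert hc hc' this
      generalize N c = X
      clear * -
      revert r X
      decide
    by_cases hqd : q ∈ N d
    · exact Or.inl (hK.legDisplays_of_cherry hN hpq hpr hqr hi ha hb hcp hqd hd)
    have hdp : N d = {p} := by
      have := hne N hN d
      revert hd hqd this
      generalize N d = X
      clear * - hpq hpr hqr
      revert p q r X
      decide
    have hci : N c ≠ {r} := ne_of_mem hpr.symm (by simp [hcp])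
    have hdi : N d ≠ {r} := ne_of_mem hpr.symm (by simp [hdp])
    have step : ∀ D ∈ K, D i = {r}ᶜ → r ∈ D a → r ∈ D b → D c = {p} → D d = {p} →
        (D a ≠ {r} ∨ D b ≠ {r}) → LegDisplays K c a b d i ∨ LegDisplays K a c d b i := by
      intro D hD hDi hDa hDb hDc hDd hab
      -- The crossing lemma names the crossed line `b`. If `a` is crossed, the two are interchanged;
      -- if `a` has already been passed, the extra clause of the lemma gives a quartet of the line
      -- `a`.
      by_cases h : D a = {r}
      · exact (hK.legDisplays_transfer_of_cross hD hpq hpr hqr hDi hDa hDb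
          (hab.resolve_left (not_not.2 h)) hDc hDd).imp id fun h' => h'.2 h
      · exact (hK.legDisplays_transfer_of_cross hD hpq hpr hqr hDi hDb hDa h hDc hDd).imp
          (fun h' => h'.swap_left) fun h' => h'.1
    by_cases hab : N a ≠ {r} ∨ N b ≠ {r}
    · exact step N hN hi ha hb hcp hdp hab
    · push Not at hab
      obtain ⟨D, hD, hDi, hDP, ⟨k, hk, hk'⟩, hDe⟩ := hK.exists_down hN hi.ge
        (P := fun k => k = a ∨ k = b) ⟨a, Or.inl rfl⟩ (by rintro k (rfl | rfl); exacts [hab.1, hab.2])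
      refine step D hD hDi (hDP a (Or.inl rfl)) (hDP b (Or.inr rfl)) ?_ ?_ ?_
      · rw [hDe c hci, hcp, Finset.erase_eq_of_notMem (by simpa using hpr.symm)]
      · rw [hDe d hdi, hdp, Finset.erase_eq_of_notMem (by simpa using hpr.symm)]
      · rcases hk with rfl | rfl
        · exact Or.inl hk'
        · exact Or.inr hk'
  obtain ⟨N, hN, r, hi, ⟨h1, h2, h3, h4⟩ | ⟨h1, h2, h3, h4⟩⟩ := h
  · exact key hN hi h1 h2 h3 h4
  · exact (key hN hi h1 h2 h3 h4).symm

end IsTraversable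

/-! ### The tree of a line -/

section

variable {r s : Fin 3} {X Y : Finset (Fin 3)}

theorem compl_singleton_injective (h : ({r}ᶜ : Finset (Fin 3)) = {s}ᶜ) : r = s := by
  simpa using h

theorem eq_of_compl_subset_compl (h : ({r}ᶜ : Finset (Fin 3)) ⊆ {s}ᶜ) : r = s := by
  revert r s; decide

theorem topFace_subset : topFace r X ⊆ X := by
  revert r X; decide

theorem botFace_subset : botFace r X ⊆ X := by
  revert r X; decide

theorem topFace_nonempty (h : X.Nonempty) : (topFace r X).Nonempty := by
  by_cases hr : r ∈ X
  · simp [topFace, hr]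
  · simpa [topFace, hr] using h

theorem compl_subset_of_topFace_eq_botFace (h : topFace r {r}ᶜ = botFace r X) : {r}ᶜ ⊆ X := by
  rw [topFace_of_notMem (by simp)] at h
  rw [h]; exact botFace_subset

theorem exists_compl_subset_of_card_inter (h : 2 ≤ (X ∩ Y).card) :
    ∃ r : Fin 3, {r}ᶜ ⊆ X ∧ {r}ᶜ ⊆ Y := by
  have : ∃ r : Fin 3, {r}ᶜ ⊆ X ∩ Y := by
    revert h
    generalize X ∩ Y = Z
    revert Z; decide
  obtain ⟨r, hr⟩ := this
  exact ⟨r, hr.trans Finset.inter_subset_left, hr.trans Finset.inter_subset_right⟩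

theorem two_le_card_of_compl_subset (h : {r}ᶜ ⊆ X) : 2 ≤ X.card := by
  revert r X; decide

theorem cross_iff : (2 ≤ X.card ∧ 3 ≤ ({r}ᶜ ∪ X : Finset (Fin 3)).card) ↔ r ∈ X ∧ X ≠ {r} := by
  revert r X; decide

theorem eq_singleton_of_subset (h : X ⊆ {r}) (hX : X.Nonempty) : X = {r} :=
  (Finset.subset_singleton_iff.1 h).resolve_left hX.ne_empty

end

/-- The cells `N c` passed by the line `l`: along each of the (up to three) legs of this line the cells
form a chain, from the side of the big triangle up to the apex, or to the other end of `l`. -/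
structure IsSpider {L Nd : Type} (N : Nd → L → Finset (Fin 3)) (l : L) (side : Fin 3 → L) :
    Prop where
  nonempty : ∀ c k, (N c k).Nonempty
  leg : ∀ c, ∃ r, {r}ᶜ ⊆ N c l
  side_eq : ∀ c r, {r}ᶜ ⊆ N c l → N c (side r) = {r}
  side_inj : Function.Injective side
  cross : ∀ c r, N c l = {r}ᶜ → ∃ k, r ∈ N c k ∧ N c k ≠ {r}
  down : ∀ c r, {r}ᶜ ⊆ N c l → (∃ c', N c' l = {r}ᶜ ∧ ∀ k, topFace r (N c' k) = botFace r (N c k)) ∨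
    ∀ k, N c k = {r} → k = side r
  up : ∀ c r, N c l = {r}ᶜ → (∃ c', ∀ k, topFace r (N c k) = botFace r (N c' k)) ∨
    ∃ κ, κ ≠ l ∧ ∀ k, k ≠ l → (r ∈ N c k ↔ k ≠ κ)
  bot_inj : ∀ c c' r, {r}ᶜ ⊆ N c l → {r}ᶜ ⊆ N c' l →
    (∀ k, botFace r (N c k) = botFace r (N c' k)) → c = c'
  bottom_unique : ∀ c c' r, {r}ᶜ ⊆ N c l → {r}ᶜ ⊆ N c' l → (∀ k, N c k = {r} → k = side r) →
    (∀ k, N c' k = {r} → k = side r) → c = c'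
  one_leg : ∀ c r κ, κ ≠ l → N c l = {r}ᶜ → (∀ k, k ≠ l → (r ∈ N c k ↔ k ≠ κ)) →
    ∀ c', N c' l = {r}ᶜ ∧ r ∉ N c' κ

namespace IsSpider

variable {L Nd : Type}

/-- The cell `c'` is the next one after `c` in the direction of the apex of `l`. -/
def Up (N : Nd → L → Finset (Fin 3)) (l : L) (c c' : Nd) : Prop :=
  ∃ r, N c l = {r}ᶜ ∧ ∀ k, topFace r (N c k) = botFace r (N c' k)

/-- The leaf `k` is attached to the cell `c`: the lines `k` and `l` cross there, or `k` is the side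
at the lower end of a leg of `l`, or the line at the upper end of `l`. -/
def Attached (N : Nd → L → Finset (Fin 3)) (l : L) (side : Fin 3 → L) (c : Nd) (k : L) : Prop :=
  (2 ≤ (N c k).card ∧ 3 ≤ (N c l ∪ N c k).card) ∨
  (∃ r, k = side r ∧ {r}ᶜ ⊆ N c l ∧ ∀ k', N c k' = {r} → k' = side r) ∨
  (∃ r, N c l = {r}ᶜ ∧ ∀ k', k' ≠ l → (r ∈ N c k' ↔ k' ≠ k))

/-- The cells `c` and `c'` have a common edge that is dual to `l`. -/
def NodesAdj (N : Nd → L → Finset (Fin 3)) (l : L) (c c' : Nd) : Prop :=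
  (∀ k, (N c k ∩ N c' k).Nonempty) ∧ 2 ≤ (N c l ∩ N c' l).card

variable {N : Nd → L → Finset (Fin 3)} {l : L} {side : Fin 3 → L} {c d e : Nd} {r : Fin 3} {k : L}

open Relation

theorem Up.subset (h : Up N l c d) (hr : N c l = {r}ᶜ) : {r}ᶜ ⊆ N d l := by
  obtain ⟨s, hs, h⟩ := h
  obtain rfl := compl_singleton_injective (hr.symm.trans hs)
  have := h l
  rw [hs] at this
  exact compl_subset_of_topFace_eq_botFace this

theorem Up.topFace_eq (h : Up N l c d) (hr : N c l = {r}ᶜ) (k : L) :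
    topFace r (N c k) = botFace r (N d k) := by
  obtain ⟨s, hs, h⟩ := h
  obtain rfl := compl_singleton_injective (hr.symm.trans hs)
  exact h k

theorem Up.eq_compl (h : Up N l c d) (hr : {r}ᶜ ⊆ N c l) : N c l = {r}ᶜ := by
  obtain ⟨s, hs, h⟩ := h
  rw [hs] at hr
  rw [hs, eq_of_compl_subset_compl hr]

theorem Up.eq_singleton (h : Up N l c d) (hr : N c l = {r}ᶜ) (hk : r ∈ N c k) : N d k = {r} :=
  (mem_iff_eq_of_topFace_eq_botFace (h.topFace_eq hr k)).1 hk

/-- Steps up remain on the same leg, since a cell with a successor lies on one leg only, and a line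
that has been passed stays passed. -/
theorem transGen_spec (h : TransGen (Up N l) c d) (hr : N c l = {r}ᶜ) :
    {r}ᶜ ⊆ N d l ∧ ∀ k, r ∈ N c k → N d k = {r} := by
  induction h with
  | single h => exact ⟨h.subset hr, fun k hk => h.eq_singleton hr hk⟩
  | tail _ h ih =>
    have h2 := h.eq_compl ih.1
    exact ⟨h.subset h2, fun k hk => h.eq_singleton h2 (by rw [ih.2 k hk]; simp)⟩

theorem up_of_transGen (h : TransGen (Up N l) c d) : ∃ e, Up N l c e := by
  obtain ⟨e, he, -⟩ := TransGen.head'_iff.1 h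
  exact ⟨e, he⟩

variable (h : IsSpider N l side)
include h

theorem up_unique (h1 : Up N l c d) (h2 : Up N l c e) : d = e := by
  obtain ⟨r, hr, h1'⟩ := id h1
  exact h.bot_inj d e r (h1.subset hr) (h2.subset hr)
    fun k => (h1' k).symm.trans (h2.topFace_eq hr k)

omit h in
theorem cross_attached (hr : N c l = {r}ᶜ) (hk : r ∈ N c k) (hk' : N c k ≠ {r}) :
    Attached N l side c k := by
  left
  rw [hr]
  exact cross_iff.2 ⟨hk, hk'⟩

omit h in
/-- The measure that decreases on the way to the apex. -/
noncomputable def depth (N : Nd → L → Finset (Fin 3)) (l : L) (c : Nd) : ℕ :=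
  open Classical in
  if N c l = Finset.univ then 0 else 1 + {k | ∃ r, N c l = {r}ᶜ ∧ r ∉ N c k}.ncard

omit h in
theorem depth_le [Finite L] (c : Nd) : depth N l c ≤ 1 + Nat.card L := by
  classical
  unfold depth
  split_ifs
  · omega
  · have := Set.ncard_le_card {k | ∃ r, N c l = {r}ᶜ ∧ r ∉ N c k}
    omega

/-- The set of lines not yet passed can only shrink along a leg. It shrinks strictly because a line
that crosses `l` at `d` is on the unpassed side at `c`. The apex has depth zero by convention. -/
theorem depth_lt [Finite L] (hu : Up N l c d) : depth N l d < depth N l c := by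
  classical
  obtain ⟨r, hr, -⟩ := id hu
  have hcu : N c l ≠ Finset.univ := by
    intro h
    have : r ∈ ({r}ᶜ : Finset (Fin 3)) := by rw [← hr, h]; simp
    simp at this
  unfold depth
  rw [if_neg hcu]
  split_ifs with hd
  · omega
  · have hd' := (eq_of_compl_subset (hu.subset hr)).resolve_right hd
    apply Nat.add_lt_add_left
    apply Set.ncard_lt_ncard _ (Set.toFinite _)
    refine ⟨?_, fun hsub => ?_⟩
    · rintro k ⟨s, hs, hk⟩
      obtain rfl := compl_singleton_injective (hd'.symm.trans hs)
      exact ⟨r, hr, fun hk' => hk (by rw [hu.eq_singleton hr hk']; simp)⟩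
    · obtain ⟨k, hk, hk'⟩ := h.cross d r hd'
      obtain ⟨s, hs, hsk⟩ := hsub (a := k) ⟨r, hr, fun h => hk' (hu.eq_singleton hr h)⟩
      obtain rfl := compl_singleton_injective (hd'.symm.trans hs)
      exact hsk hk

theorem exists_bottom [Finite L] (hr : {r}ᶜ ⊆ N c l) :
    ∃ b, {r}ᶜ ⊆ N b l ∧ (∀ k, N b k = {r} → k = side r) ∧ ReflTransGen (Up N l) b c := by
  induction hn : {k | N c k = {r}}.ncard using Nat.strong_induction_on generalizing c with
  | _ n ih =>
    rcases h.down c r hr with ⟨c', hc', hs⟩ | hb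
    · have hlt : {k | N c' k = {r}}.ncard < n := by
        rw [← hn]
        apply Set.ncard_lt_ncard _ (Set.toFinite _)
        refine ⟨fun k hk => ?_, fun hsub => ?_⟩
        · have hk : N c' k = {r} := hk
          exact (mem_iff_eq_of_topFace_eq_botFace (hs k)).1 (by rw [hk]; simp)
        · obtain ⟨k, hk, hk'⟩ := h.cross c' r hc'
          exact hk' (hsub ((mem_iff_eq_of_topFace_eq_botFace (hs k)).1 hk))
      obtain ⟨b, h1, h2, h3⟩ := ih _ hlt hc'.ge rfl
      exact ⟨b, h1, h2, h3.tail ⟨r, hc', hs⟩⟩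
    · exact ⟨c, hr, hb, ReflTransGen.refl⟩

/-- Both cells are reached from the unique lowest cell of the leg, and the way up is deterministic.
-/
theorem comparable [Finite L] (hc : {r}ᶜ ⊆ N c l) (hd : {r}ᶜ ⊆ N d l) :
    ReflTransGen (Up N l) c d ∨ ReflTransGen (Up N l) d c := by
  obtain ⟨b, h1, h2, h3⟩ := h.exists_bottom hc
  obtain ⟨b', h1', h2', h3'⟩ := h.exists_bottom hd
  obtain rfl := h.bottom_unique b b' r h1 h1' h2 h2'
  exact ReflTransGen.total_of_right_unique (fun _ _ _ => h.up_unique) h3 h3'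

/-- By `one_leg` the next cell would lie on the same leg, with `κ` not met there. The line that
crosses `l` at the next cell is then neither `κ` nor `l`, so it has been passed already. -/
theorem not_up_of_terminal {κ : L} (hκ : κ ≠ l) (hr : N c l = {r}ᶜ)
    (ht : ∀ k, k ≠ l → (r ∈ N c k ↔ k ≠ κ)) : ¬ Up N l c d := by
  intro hu
  have h1 := h.one_leg c r κ hκ hr ht d
  obtain ⟨k, hk, hk'⟩ := h.cross d r h1.1
  by_cases hkκ : k = κ
  · subst hkκ
    exact h1.2 hk
  · by_cases hkl : k = l
    · subst hkl
      rw [h1.1] at hk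
      simp at hk
    · exact hk' (hu.eq_singleton hr ((ht k hkl).2 hkκ))

/-- A cell of minimal depth has no successor. It is the apex, which lies on all legs, or a terminal
cell, in which case there is only one leg; in both cases it is comparable with every other cell. -/
theorem exists_root [Finite L] [Nonempty Nd] :
    ∃ ρ, (∀ c, ¬ Up N l ρ c) ∧ ∀ c, ReflTransGen (Up N l) c ρ := by
  obtain ⟨ρ, hρ⟩ : ∃ ρ, ∀ c, depth N l ρ ≤ depth N l c := by
    obtain ⟨ρ, -, hρ⟩ := (measure (depth N l)).wf.has_min Set.univ ⟨Classical.arbitrary Nd, trivial⟩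
    exact ⟨ρ, fun c => not_lt.1 (hρ c trivial)⟩
  have hup : ∀ c, ¬ Up N l ρ c := fun c hu => (h.depth_lt hu).not_ge (hρ c)
  refine ⟨ρ, hup, fun c => ?_⟩
  have hshare : ∃ r, {r}ᶜ ⊆ N c l ∧ {r}ᶜ ⊆ N ρ l := by
    obtain ⟨r, hr⟩ := h.leg ρ
    rcases eq_of_compl_subset hr with hr' | hr'
    · rcases h.up ρ r hr' with ⟨c', hc'⟩ | ⟨κ, hκ, ht⟩
      · exact absurd ⟨r, hr', hc'⟩ (hup c')
      · exact ⟨r, (h.one_leg ρ r κ hκ hr' ht c).1.ge, hr⟩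
    · obtain ⟨s, hs⟩ := h.leg c
      exact ⟨s, hs, by rw [hr']; exact Finset.subset_univ _⟩
  obtain ⟨r, h1, h2⟩ := hshare
  rcases h.comparable h1 h2 with h3 | h3
  · exact h3
  · rcases ReflTransGen.cases_head h3 with rfl | ⟨e, he, -⟩
    · exact ReflTransGen.refl
    · exact absurd he (hup e)

theorem mem_of_attached (hr : N c l = {r}ᶜ) (hd : Up N l c d) (hk : k ≠ l)
    (ha : Attached N l side c k) : r ∈ N c k := by
  rcases ha with ha | ⟨s, rfl, hs, -⟩ | ⟨s, hs, ht⟩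
  · rw [hr] at ha
    exact (cross_iff.1 ha).1
  · rw [hr] at hs
    obtain rfl := eq_of_compl_subset_compl hs
    rw [h.side_eq c s hr.ge]
    simp
  · obtain rfl := compl_singleton_injective (hr.symm.trans hs)
    exact absurd hd (h.not_up_of_terminal hk hr ht)

theorem not_attached_of_transGen (hcd : TransGen (Up N l) c d) (hk : k ≠ l)
    (hc : Attached N l side c k) : ¬ Attached N l side d k := by
  obtain ⟨e, he⟩ := up_of_transGen hcd
  obtain ⟨r, hr, -⟩ := id he
  have h1 := transGen_spec hcd hr
  have h2 := h1.2 k (h.mem_of_attached hr he hk hc)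
  rintro (ha | ⟨s, rfl, hs, hb⟩ | ⟨s, hs, ht⟩)
  · rw [h2] at ha
    simp at ha
  · rw [h.side_eq d s hs] at h2
    obtain rfl := Finset.singleton_injective h2
    obtain ⟨k', hk', hk''⟩ := h.cross c s hr
    have := hb k' (h1.2 k' hk')
    subst this
    exact hk'' (h.side_eq c s hr.ge)
  · have := h1.1
    rw [hs] at this
    obtain rfl := eq_of_compl_subset_compl this
    exact (ht k hk).1 (by rw [h2]; simp) rfl

/-- If neither cell is the root, the summand of `k` at the root is the singleton of the leg on which
`k` was met, so both cells lie on the same leg. Of two comparable cells, the upper one has `k`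
already passed. -/
theorem attached_unique [Finite L] [Nonempty Nd] (hk : k ≠ l) (hc : Attached N l side c k)
    (hd : Attached N l side d k) : c = d := by
  have key : ReflTransGen (Up N l) c d ∨ ReflTransGen (Up N l) d c := by
    obtain ⟨ρ, -, hρ⟩ := h.exists_root
    rcases reflTransGen_iff_eq_or_transGen.1 (hρ c) with rfl | hcρ
    · exact Or.inr (hρ d)
    rcases reflTransGen_iff_eq_or_transGen.1 (hρ d) with rfl | hdρ
    · exact Or.inl (hρ c)
    obtain ⟨c', hc'⟩ := up_of_transGen hcρ
    obtain ⟨r, hr, -⟩ := id hc'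
    obtain ⟨d', hd'⟩ := up_of_transGen hdρ
    obtain ⟨s, hs, -⟩ := id hd'
    have h1 := (transGen_spec hcρ hr).2 k (h.mem_of_attached hr hc' hk hc)
    have h2 := (transGen_spec hdρ hs).2 k (h.mem_of_attached hs hd' hk hd)
    rw [h1] at h2
    obtain rfl := Finset.singleton_injective h2
    exact h.comparable hr.ge hs.ge
  rcases key with h1 | h1 <;> rcases reflTransGen_iff_eq_or_transGen.1 h1 with h2 | h2
  · exact h2.symm
  · exact absurd hd (h.not_attached_of_transGen h2 hk hc)
  · exact h2
  · exact absurd hc (h.not_attached_of_transGen h2 hk hd)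

theorem exists_attached_below [Finite L] (hr : {r}ᶜ ⊆ N c l) (hk : N c k = {r}) :
    ∃ d, ReflTransGen (Up N l) d c ∧ Attached N l side d k := by
  induction hn : {k | N c k = {r}}.ncard using Nat.strong_induction_on generalizing c with
  | _ n ih =>
    rcases h.down c r hr with ⟨c', hc', hs⟩ | hb
    · have hup : Up N l c' c := ⟨r, hc', hs⟩
      by_cases hk' : N c' k = {r}
      · have hlt : {k | N c' k = {r}}.ncard < n := by
          rw [← hn]
          apply Set.ncard_lt_ncard _ (Set.toFinite _)
          refine ⟨fun k hk => ?_, fun hsub => ?_⟩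
          · have hk : N c' k = {r} := hk
            exact (mem_iff_eq_of_topFace_eq_botFace (hs k)).1 (by rw [hk]; simp)
          · obtain ⟨k, hk, hk'⟩ := h.cross c' r hc'
            exact hk' (hsub ((mem_iff_eq_of_topFace_eq_botFace (hs k)).1 hk))
        obtain ⟨d, h1, h2⟩ := ih _ hlt hc'.ge hk' rfl
        exact ⟨d, h1.tail hup, h2⟩
      · exact ⟨c', ReflTransGen.single hup, cross_attached hc'
          ((mem_iff_eq_of_topFace_eq_botFace (hs k)).2 hk) hk'⟩
    · exact ⟨c, ReflTransGen.refl, Or.inr (Or.inl ⟨r, hb k hk, hr, hb⟩)⟩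

theorem exists_attached_of_mem [Finite L] (hr : N c l = {r}ᶜ) (hk : r ∈ N c k) :
    ∃ d, ReflTransGen (Up N l) d c ∧ Attached N l side d k := by
  by_cases hk' : N c k = {r}
  · exact h.exists_attached_below hr.ge hk'
  · exact ⟨c, ReflTransGen.refl, cross_attached hr hk hk'⟩

/-- The root tells where to look: `k` is met there, or is the terminal label, or its summand is a
singleton `{s}`, and then `k` was met below on the leg `s`. -/
theorem exists_attached [Finite L] [Nonempty Nd] (hk : k ≠ l) : ∃ d, Attached N l side d k := by
  obtain ⟨ρ, hup, -⟩ := h.exists_root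
  obtain ⟨r, hr⟩ := h.leg ρ
  rcases eq_of_compl_subset hr with hr' | hr'
  · rcases h.up ρ r hr' with ⟨c', hc'⟩ | ⟨κ, hκ, ht⟩
    · exact absurd ⟨r, hr', hc'⟩ (hup c')
    · by_cases hkκ : k = κ
      · exact ⟨ρ, Or.inr (Or.inr ⟨r, hr', by rwa [hkκ]⟩)⟩
      · obtain ⟨d, -, hd⟩ := h.exists_attached_of_mem hr' ((ht k hk).2 hkκ)
        exact ⟨d, hd⟩
  · by_cases hc : 2 ≤ (N ρ k).card
    · refine ⟨ρ, Or.inl ⟨hc, ?_⟩⟩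
      rw [hr', Finset.union_eq_left.2 (Finset.subset_univ _)]
      simp
    · have h1 : (N ρ k).card = 1 := by
        have := (h.nonempty ρ k).card_pos
        omega
      obtain ⟨s, hs⟩ := Finset.card_eq_one.1 h1
      obtain ⟨d, -, hd⟩ := h.exists_attached_below (r := s)
        (by rw [hr']; exact Finset.subset_univ _) hs
      exact ⟨d, hd⟩

/-- The leaves below a cell are those of the lines that have been passed. -/
theorem reflTransGen_iff_mem [Finite L] [Nonempty Nd] (hk : k ≠ l) (hd : Attached N l side d k)
    (hr : N c l = {r}ᶜ) (hu : Up N l c e) : ReflTransGen (Up N l) d c ↔ r ∈ N c k := by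
  constructor
  · intro hdc
    rcases reflTransGen_iff_eq_or_transGen.1 hdc with rfl | hdc
    · exact h.mem_of_attached hr hu hk hd
    · obtain ⟨d', hd'⟩ := up_of_transGen hdc
      obtain ⟨s, hs, -⟩ := id hd'
      have h1 := transGen_spec hdc hs
      have h2 := h1.1
      rw [hr] at h2
      obtain rfl := eq_of_compl_subset_compl h2
      rw [h1.2 k (h.mem_of_attached hs hd' hk hd)]
      simp
  · intro hk'
    obtain ⟨d', h1, h2⟩ := h.exists_attached_of_mem hr hk'
    rwa [h.attached_unique hk hd h2]

theorem nodesAdj_of_up (hu : Up N l c d) : NodesAdj N l c d ∧ NodesAdj N l d c := by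
  obtain ⟨r, hr, hs⟩ := id hu
  have h1 : ∀ k, (N c k ∩ N d k).Nonempty := by
    intro k
    refine (topFace_nonempty (r := r) (h.nonempty c k)).mono (Finset.subset_inter topFace_subset ?_)
    rw [hs k]
    exact botFace_subset
  have h2 : 2 ≤ (N c l ∩ N d l).card :=
    two_le_card_of_compl_subset (r := r) (Finset.subset_inter hr.ge (hu.subset hr))
  refine ⟨⟨h1, h2⟩, fun k => ?_, ?_⟩
  · rw [Finset.inter_comm]; exact h1 k
  · rwa [Finset.inter_comm]

/-- If two cells of a leg have another cell between them, a line that crosses `l` at the cell after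
the lower one has summand `{r}` at the upper one and a summand without `r` at the lower one, so they
have no common face. -/
theorem up_of_nodesAdj [Finite L] (hne : c ≠ d) (ha : NodesAdj N l c d) :
    Up N l c d ∨ Up N l d c := by
  obtain ⟨r, hc, hd⟩ := exists_compl_subset_of_card_inter ha.2
  have key : ∀ {c d}, (∀ k, (N c k ∩ N d k).Nonempty) → {r}ᶜ ⊆ N c l → c ≠ d →
      ReflTransGen (Up N l) c d → Up N l c d := by
    intro c d ha hc hne hcd
    rcases ReflTransGen.cases_head hcd with rfl | ⟨e, hce, hed⟩
    · exact absurd rfl hne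
    rcases reflTransGen_iff_eq_or_transGen.1 hed with rfl | hed
    · exact hce
    exfalso
    have hcr := hce.eq_compl hc
    obtain ⟨e', he'⟩ := up_of_transGen hed
    have her := he'.eq_compl (hce.subset hcr)
    obtain ⟨k, hk, hk'⟩ := h.cross e r her
    have h1 := (transGen_spec hed her).2 k hk
    have h2 := fun h' => hk' (hce.eq_singleton hcr (k := k) h')
    obtain ⟨x, hx⟩ := ha k
    rw [h1, Finset.mem_inter, Finset.mem_singleton] at hx
    exact h2 (hx.2 ▸ hx.1)
  rcases h.comparable hc hd with h1 | h1
  · exact Or.inl (key ha.1 hc hne h1)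
  · exact Or.inr (key (fun k => by rw [Finset.inter_comm]; exact ha.1 k) hd hne.symm h1)

end IsSpider

/-- The graph with the given nodes and leaves, adjacency relation of the nodes and position of the
leaves. -/
def nodeGraph {L Nd : Type} (l : L) (nadj : Nd → Nd → Prop) (att : Nd → L → Prop) :
    SimpleGraph (Nd ⊕ {k : L // k ≠ l}) :=
  SimpleGraph.fromRel fun v w =>
    match v, w with
    | .inl c, .inl c' => nadj c c'
    | .inl c, .inr k => att c k.1
    | .inr _, _ => False

/-- The labelled graph with the given nodes, adjacency relation of the nodes and position of the
leaves. -/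
def nodeTree {L Nd : Type} (l : L) (nadj : Nd → Nd → Prop) (att : Nd → L → Prop) :
    LabelledGraph L where
  V := Nd ⊕ {k : L // k ≠ l}
  graph := nodeGraph l nadj att
  labels := {k | k ≠ l}
  leaf := fun k => .inr ⟨k.1, k.2⟩

theorem mixedTree_eq {m : ℕ} (M : Finset (MixedCell m)) (ℓ : TreeLabel m) :
    mixedTree M ℓ = nodeTree ℓ
      (fun c c' : {c : MixedCell m // IsTreeNode M ℓ c} => NodeAdj ℓ c.1 c'.1)
      (fun c k => LeafAdj ℓ c.1 k) := by
  unfold mixedTree nodeTree nodeGraph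
  congr 1
  congr 1
  funext v w
  rcases v with v | v <;> rcases w with w | w <;> rfl

section

variable {L Nd : Type} {l : L} {nadj : Nd → Nd → Prop} {att : Nd → L → Prop}

theorem nodeGraph_adj_inl {c c' : Nd} :
    (nodeGraph l nadj att).Adj (.inl c) (.inl c') ↔ c ≠ c' ∧ (nadj c c' ∨ nadj c' c) := by
  simp [nodeGraph]

theorem nodeGraph_adj_inl_inr {c : Nd} {k : {k : L // k ≠ l}} :
    (nodeGraph l nadj att).Adj (.inl c) (.inr k) ↔ att c k.1 := by
  simp [nodeGraph]

theorem nodeGraph_adj_inr {k k' : {k : L // k ≠ l}} :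
    ¬ (nodeGraph l nadj att).Adj (.inr k) (.inr k') := by
  simp [nodeGraph]

end

/-! ### The line rooted at its last cell -/

open Relation IsSpider

/-- The tree of a line as a rooted tree: its root is the last cell of the line. -/
structure IsRootedSpider {L Nd : Type} (N : Nd → L → Finset (Fin 3)) (l : L) (side : Fin 3 → L)
    (nadj : Nd → Nd → Prop) (att : Nd → L → Prop) (ρ : Nd)
    (par : Nd ⊕ {k : L // k ≠ l} → Nd ⊕ {k : L // k ≠ l}) (ht : Nd ⊕ {k : L // k ≠ l} → ℕ) :
    Prop where
  isSpider : IsSpider N l side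
  rooted : IsRootedTree (nodeGraph l nadj att) (.inl ρ) par ht
  not_up : ∀ c, ¬ Up N l ρ c
  reach : ∀ c, ReflTransGen (Up N l) c ρ
  par_up : ∀ c d, Up N l c d → par (.inl c) = .inl d
  par_leaf : ∀ c (k : {k : L // k ≠ l}), Attached N l side c k.1 → par (.inr k) = .inl c

namespace IsSpider

variable {L Nd : Type} {N : Nd → L → Finset (Fin 3)} {l : L} {side : Fin 3 → L}
  {nadj : Nd → Nd → Prop} {att : Nd → L → Prop}

theorem exists_isRootedSpider [Finite L] [Nonempty Nd] (h : IsSpider N l side)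
    (hadj : ∀ c c', nadj c c' ↔ NodesAdj N l c c')
    (hatt : ∀ c k, k ≠ l → (att c k ↔ Attached N l side c k)) :
    ∃ ρ par ht, IsRootedSpider N l side nadj att ρ par ht := by
  classical
  obtain ⟨ρ, hup, hreach⟩ := h.exists_root
  choose pos hpos using fun k : {k : L // k ≠ l} => h.exists_attached k.2
  have hex : ∀ c, c ≠ ρ → ∃ d, Up N l c d := by
    intro c hc
    rcases ReflTransGen.cases_head (hreach c) with h1 | ⟨d, hd, -⟩
    · exact absurd h1 hc
    · exact ⟨d, hd⟩
  let next : Nd → Nd := fun c => if hc : c = ρ then ρ else (hex c hc).choose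
  have hnext : ∀ c, c ≠ ρ → Up N l c (next c) := by
    intro c hc
    simp only [next, hc, dite_false]
    exact (hex c hc).choose_spec
  have hnext' : ∀ c d, Up N l c d → next c = d := by
    intro c d hcd
    have hc : c ≠ ρ := by rintro rfl; exact hup d hcd
    exact h.up_unique (hnext c hc) hcd
  let par : Nd ⊕ {k : L // k ≠ l} → Nd ⊕ {k : L // k ≠ l} :=
    Sum.elim (fun c => .inl (next c)) (fun k => .inl (pos k))
  -- By `depth_le` no node is deeper than `1 + Nat.card L`, so a leaf is higher than the node it is
  -- attached to.
  let ht : Nd ⊕ {k : L // k ≠ l} → ℕ := Sum.elim (depth N l) fun _ => 2 + Nat.card L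
  have hadj' : ∀ c d, (nodeGraph l nadj att).Adj (.inl c) (.inl d) ↔ Up N l c d ∨ Up N l d c := by
    intro c d
    rw [nodeGraph_adj_inl, hadj, hadj]
    constructor
    · rintro ⟨hne, h1 | h1⟩
      · exact h.up_of_nodesAdj hne h1
      · exact (h.up_of_nodesAdj hne.symm h1).symm
    · rintro (h1 | h1)
      · exact ⟨fun he => (h.depth_lt h1).ne (by rw [he]), Or.inl (h.nodesAdj_of_up h1).1⟩
      · exact ⟨fun he => (h.depth_lt h1).ne (by rw [he]), Or.inl (h.nodesAdj_of_up h1).2⟩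
  have hpos' : ∀ c (k : {k : L // k ≠ l}), Attached N l side c k.1 → pos k = c :=
    fun c k hc => h.attached_unique k.2 (hpos k) hc
  refine ⟨ρ, par, ht, h, ⟨?_, ?_, ?_⟩, hup, hreach, ?_, ?_⟩
  · have hnode : ∀ c d, (Sum.inl c ≠ (Sum.inl ρ : Nd ⊕ {k : L // k ≠ l}) ∧
        par (.inl c) = .inl d) ↔ Up N l c d := by
      intro c d
      constructor
      · rintro ⟨hc, hd⟩
        have hc : c ≠ ρ := fun h => hc (by rw [h])
        have hd : next c = d := Sum.inl_injective hd
        rw [← hd]; exact hnext c hc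
      · intro hcd
        refine ⟨fun hc => ?_, congrArg _ (hnext' c d hcd)⟩
        rw [Sum.inl_injective hc] at hcd
        exact hup d hcd
    have hleaf : ∀ c (k : {k : L // k ≠ l}), (nodeGraph l nadj att).Adj (.inl c) (.inr k) ↔
        par (.inr k) = .inl c := by
      intro c k
      rw [nodeGraph_adj_inl_inr, hatt c k.1 k.2]
      constructor
      · intro hc
        exact congrArg _ (hpos' c k hc)
      · intro hc
        have hc : pos k = c := Sum.inl_injective hc
        rw [← hc]; exact hpos k
    rintro (c | k) (d | k')
    · rw [hadj', hnode, hnode]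
    · rw [hleaf]
      simp [par]
    · rw [SimpleGraph.adj_comm, hleaf]
      simp [par]
    · simp [nodeGraph_adj_inr, par]
  · rintro (c | k) hv
    · exact h.depth_lt (hnext c fun h => hv (by rw [h]))
    · have := depth_le (N := N) (l := l) (pos k)
      change depth N l (pos k) < 2 + Nat.card L
      omega
  · simp [par, next]
  · intro c d hcd
    exact congrArg _ (hnext' c d hcd)
  · intro c k hck
    exact congrArg _ (hpos' c k hck)

end IsSpider

namespace IsRootedSpider

variable {L Nd : Type} {N : Nd → L → Finset (Fin 3)} {l : L} {side : Fin 3 → L}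
  {nadj : Nd → Nd → Prop} {att : Nd → L → Prop} {ρ : Nd}
  {par : Nd ⊕ {k : L // k ≠ l} → Nd ⊕ {k : L // k ≠ l}} {ht : Nd ⊕ {k : L // k ≠ l} → ℕ}

theorem exists_up (h : IsRootedSpider N l side nadj att ρ par ht) {c : Nd} (hc : c ≠ ρ) :
    ∃ d, Up N l c d := by
  rcases ReflTransGen.cases_head (h.reach c) with h1 | ⟨d, hd, -⟩
  · exact absurd h1 hc
  · exact ⟨d, hd⟩

theorem eq_root (h : IsRootedSpider N l side nadj att ρ par ht) {c : Nd}
    (hc : ∀ d, ¬ Up N l c d) : c = ρ := by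
  by_contra hne
  obtain ⟨d, hd⟩ := h.exists_up hne
  exact hc d hd

theorem descends_inl_iff (h : IsRootedSpider N l side nadj att ρ par ht) {c d : Nd} :
    Descends par (.inl d) (.inl c) ↔ ReflTransGen (Up N l) c d := by
  constructor
  · rintro ⟨n, hn⟩
    induction n generalizing c with
    | zero =>
      obtain rfl := Sum.inl_injective hn
      exact ReflTransGen.refl
    | succ n ih =>
      rw [Function.iterate_succ_apply] at hn
      by_cases hc : c = ρ
      · rw [hc, h.rooted.par_root] at hn
        rw [hc]; exact ih hn
      · obtain ⟨e, he⟩ := h.exists_up hc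
        rw [h.par_up c e he] at hn
        exact (ih hn).head he
  · intro hcd
    induction hcd with
    | refl => exact Descends.refl _
    | tail _ hu ih => exact Descends.trans ⟨1, h.par_up _ _ hu⟩ ih

theorem not_descends_inr_inl (h : IsRootedSpider N l side nadj att ρ par ht) {c : Nd}
    {k : {k : L // k ≠ l}} : ¬ Descends par (.inr k) (.inl c) := by
  rintro ⟨n, hn⟩
  induction n generalizing c with
  | zero => simp at hn
  | succ n ih =>
    rw [Function.iterate_succ_apply] at hn
    by_cases hc : c = ρ
    · rw [hc, h.rooted.par_root] at hn
      exact ih hn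
    · obtain ⟨e, he⟩ := h.exists_up hc
      rw [h.par_up c e he] at hn
      exact ih hn

theorem descends_leaf_iff [Finite L] [Nonempty Nd]
    (h : IsRootedSpider N l side nadj att ρ par ht) {c d : Nd} {k : {k : L // k ≠ l}}
    (hc : Attached N l side c k.1) :
    Descends par (.inl d) (.inr k) ↔ ReflTransGen (Up N l) c d := by
  rw [← h.descends_inl_iff]
  constructor
  · intro hd
    rcases hd.eq_or_par with hd | hd
    · simp at hd
    · rwa [h.par_leaf c k hc] at hd
  · intro hd
    rw [← h.par_leaf c k hc] at hd
    exact hd.of_par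

theorem not_descends_inr_inr [Finite L] [Nonempty Nd]
    (h : IsRootedSpider N l side nadj att ρ par ht) {k k' : {k : L // k ≠ l}}
    (hd : Descends par (.inr k') (.inr k)) : k = k' := by
  rcases hd.eq_or_par with hd | hd
  · exact Sum.inr_injective hd
  · obtain ⟨c, hc⟩ := h.isSpider.exists_attached k.2
    rw [h.par_leaf c k hc] at hd
    exact absurd hd h.not_descends_inr_inl

/-- The quartets displayed by the tree of a line, in terms of the cells of this line. -/
theorem displays_iff [Finite L] [Nonempty Nd] (h : IsRootedSpider N l side nadj att ρ par ht)
    {a b c d : L} (hab : a ≠ b) (hcd : c ≠ d) (ha : a ≠ l) (hb : b ≠ l) (hc : c ≠ l) (hd : d ≠ l) :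
    (nodeTree l nadj att).Displays a b c d ↔ ∃ n r, N n l = {r}ᶜ ∧ (∃ n', Up N l n n') ∧
      ((r ∈ N n a ∧ r ∈ N n b ∧ r ∉ N n c ∧ r ∉ N n d) ∨
        (r ∈ N n c ∧ r ∈ N n d ∧ r ∉ N n a ∧ r ∉ N n b)) := by
  have key : ∀ {k : L} (hk : k ≠ l) {n n' : Nd} {r}, N n l = {r}ᶜ → Up N l n n' →
      (Descends par (.inl n) (.inr ⟨k, hk⟩) ↔ r ∈ N n k) := by
    intro k hk n n' r hr hu
    obtain ⟨e, he⟩ := h.isSpider.exists_attached hk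
    rw [h.descends_leaf_iff (k := ⟨k, hk⟩) he, h.isSpider.reflTransGen_iff_mem hk he hr hu]
  rw [IsRootedTree.displays_iff (T := nodeTree l nadj att) h.rooted]
  constructor
  · rintro ⟨_, _, _, _, v, hv⟩
    rcases v with n | k
    · have hn : n ≠ ρ := by
        rintro rfl
        rcases hv with ⟨-, -, h1, -⟩ | ⟨-, -, h1, -⟩ <;> exact h1 (h.rooted.descends_root _)
      obtain ⟨n', hn'⟩ := h.exists_up hn
      obtain ⟨r, hr, -⟩ := id hn'
      refine ⟨n, r, hr, ⟨n', hn'⟩, ?_⟩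
      rw [← key ha hr hn', ← key hb hr hn', ← key hc hr hn', ← key hd hr hn']
      exact hv
    · exfalso
      rcases hv with ⟨h1, h2, -⟩ | ⟨h1, h2, -⟩
      · exact hab (congrArg Subtype.val
          ((h.not_descends_inr_inr h1).trans (h.not_descends_inr_inr h2).symm))
      · exact hcd (congrArg Subtype.val
          ((h.not_descends_inr_inr h1).trans (h.not_descends_inr_inr h2).symm))
  · rintro ⟨n, r, hr, ⟨n', hn'⟩, hv⟩
    rw [← key ha hr hn', ← key hb hr hn', ← key hc hr hn', ← key hd hr hn'] at hv
    exact ⟨ha, hb, hc, hd, .inl n, hv⟩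

theorem adj_of_up (h : IsRootedSpider N l side nadj att ρ par ht) {c d : Nd} (hu : Up N l c d) :
    (nodeGraph l nadj att).Adj (.inl c) (.inl d) :=
  (h.rooted.adj_iff _ _).2 (Or.inl ⟨fun hc => h.not_up d (Sum.inl_injective hc ▸ hu),
    h.par_up c d hu⟩)

theorem adj_of_attached (h : IsRootedSpider N l side nadj att ρ par ht) {c : Nd}
    {k : {k : L // k ≠ l}} (hc : Attached N l side c k.1) :
    (nodeGraph l nadj att).Adj (.inl c) (.inr k) :=
  (h.rooted.adj_iff _ _).2 (Or.inr ⟨by simp, h.par_leaf c k hc⟩)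

theorem side_ne (h : IsSpider N l side) {c : Nd} {r : Fin 3} (hr : {r}ᶜ ⊆ N c l) :
    side r ≠ l := by
  intro hs
  have := h.side_eq c r hr
  rw [hs] at this
  rw [this] at hr
  clear this hs
  revert r; decide

/-- On each leg a cell is joined to the next lower cell, or to the leaf at the lower end. -/
theorem exists_adj_below (h : IsRootedSpider N l side nadj att ρ par ht) {c : Nd} {r : Fin 3}
    (hr : {r}ᶜ ⊆ N c l) : ∃ w, (nodeGraph l nadj att).Adj (.inl c) w ∧
      ((∃ c', w = .inl c' ∧ N c' l = {r}ᶜ ∧ Up N l c' c) ∨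
        w = .inr ⟨side r, side_ne h.isSpider hr⟩) := by
  rcases h.isSpider.down c r hr with ⟨c', hc', hs⟩ | hb
  · exact ⟨.inl c', (h.adj_of_up ⟨r, hc', hs⟩).symm, Or.inl ⟨c', rfl, hc', r, hc', hs⟩⟩
  · exact ⟨.inr ⟨side r, side_ne h.isSpider hr⟩,
      h.adj_of_attached (Or.inr (Or.inl ⟨r, rfl, hr, hb⟩)), Or.inr rfl⟩

/-- A cell on a single leg has three neighbours: the cell or side below it, a line that crosses
there, and the next cell or the terminal label. The apex has one neighbour on each of its three
legs. -/
theorem isTreeWithLeaves [Finite L] [Nonempty Nd] [Finite Nd]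
    (h : IsRootedSpider N l side nadj att ρ par ht) :
    (nodeTree l nadj att).IsTreeWithLeaves {k | k ≠ l} := by
  have hS := h.isSpider
  have hleaf : ∀ k : {k : L // k ≠ l}, ((nodeGraph l nadj att).neighborSet (.inr k)).ncard = 1 := by
    intro k
    obtain ⟨c, hc⟩ := hS.exists_attached k.2
    rw [Set.ncard_eq_one]
    refine ⟨.inl c, ?_⟩
    ext w
    rw [SimpleGraph.mem_neighborSet, h.rooted.adj_iff, h.par_leaf c k hc, Set.mem_singleton_iff]
    constructor
    · rintro (⟨-, h1⟩ | ⟨-, h1⟩)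
      · exact h1.symm
      · exact absurd (show Descends par (.inr k) w from ⟨1, h1⟩) (by
          rcases w with w | w
          · exact h.not_descends_inr_inl
          · intro hd
            obtain ⟨e, he⟩ := hS.exists_attached w.2
            rw [h.par_leaf e w he] at h1
            simp at h1)
    · rintro rfl
      exact Or.inl ⟨by simp, rfl⟩
  have hcross : ∀ c r, N c l = {r}ᶜ → ∃ k : {k : L // k ≠ l}, r ∈ N c k.1 ∧ k.1 ≠ side r ∧
      (nodeGraph l nadj att).Adj (.inl c) (.inr k) := by
    intro c r hr
    obtain ⟨k, hk, hk'⟩ := hS.cross c r hr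
    have hkl : k ≠ l := by
      rintro rfl
      rw [hr] at hk
      simp at hk
    refine ⟨⟨k, hkl⟩, hk, ?_, h.adj_of_attached (cross_attached hr hk hk')⟩
    rintro rfl
    exact hk' (hS.side_eq c r hr.ge)
  have hinner : ∀ c, 3 ≤ ((nodeGraph l nadj att).neighborSet (.inl c)).ncard := by
    intro c
    obtain ⟨r, hr⟩ := hS.leg c
    rcases eq_of_compl_subset hr with hr' | hr'
    · obtain ⟨w, hw, hw'⟩ := h.exists_adj_below hr
      obtain ⟨k, hk, hkr, hka⟩ := hcross c r hr'
      have hwk : w ≠ .inr k := by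
        rcases hw' with ⟨c', rfl, -⟩ | rfl
        · simp
        · intro he
          exact hkr (congrArg Subtype.val (Sum.inr_injective he)).symm
      by_cases hc : c = ρ
      · subst hc
        rcases hS.up c r hr' with ⟨c', hc'⟩ | ⟨κ, hκ, ht⟩
        · exact absurd ⟨r, hr', hc'⟩ (h.not_up c')
        · refine Set.three_le_ncard (Set.toFinite _) hw hka
            (h.adj_of_attached (k := ⟨κ, hκ⟩) (Or.inr (Or.inr ⟨r, hr', ht⟩))) hwk ?_ ?_
          · rcases hw' with ⟨c', rfl, -⟩ | rfl
            · simp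
            · intro he
              have he : side r = κ := congrArg Subtype.val (Sum.inr_injective he)
              refine (ht κ hκ).1 ?_ rfl
              rw [← he, hS.side_eq c r hr]
              simp
          · intro he
            have he : k.1 = κ := congrArg Subtype.val (Sum.inr_injective he)
            exact (ht k.1 k.2).1 hk he
      · obtain ⟨d, hd⟩ := h.exists_up hc
        refine Set.three_le_ncard (Set.toFinite _) hw hka (h.adj_of_up hd) hwk ?_ (by simp)
        rcases hw' with ⟨c', rfl, -, hc'⟩ | rfl
        · intro he
          obtain rfl := Sum.inl_injective he
          exact lt_asymm (hS.depth_lt hd) (hS.depth_lt hc')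
        · simp
    · have hall : ∀ s, {s}ᶜ ⊆ N c l := fun s => by rw [hr']; exact Finset.subset_univ _
      choose w hw hw' using fun s => h.exists_adj_below (hall s)
      have hne : ∀ s t, s ≠ t → w s ≠ w t := by
        intro s t hst he
        rcases hw' s with ⟨c', h1, h2, -⟩ | h1 <;> rcases hw' t with ⟨d', h3, h4, -⟩ | h3
        · rw [he, h3] at h1
          obtain rfl := Sum.inl_injective h1
          exact hst (compl_singleton_injective (h2.symm.trans h4))
        · rw [he, h3] at h1
          simp at h1
        · rw [he, h3] at h1
          simp at h1
        · rw [he, h3] at h1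
          exact hst (hS.side_inj (congrArg Subtype.val (Sum.inr_injective h1))).symm
      exact Set.three_le_ncard (Set.toFinite _) (hw 0) (hw 1) (hw 2) (hne _ _ (by decide))
        (hne _ _ (by decide)) (hne _ _ (by decide))
  refine LabelledGraph.isTreeWithLeaves_of (T := nodeTree l nadj att) rfl
    (inferInstanceAs (Finite (Nd ⊕ {k : L // k ≠ l}))) h.rooted.isTree ?_ (fun k => hleaf k) ?_
  · rintro ⟨k, hk⟩ ⟨k', hk'⟩ he
    exact Subtype.ext (congrArg Subtype.val (Sum.inr_injective he))
  · rintro (c | k) hv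
    · exact hinner c
    · exact absurd ⟨k, rfl⟩ hv

end IsRootedSpider

open Relation IsSpider

/-! ### Contraction of trees under refinement -/

section

variable {L Nd Nd' : Type} {N : Nd → L → Finset (Fin 3)} {N' : Nd' → L → Finset (Fin 3)} {l : L}
  {side : Fin 3 → L}

/-- The large cells share the edge between the small ones, so they are equal or adjacent. The
direction cannot be reversed: a line that crosses `l` at `c'` would have been passed at `c`, and
then also at the smaller cell `c'`. -/
theorem IsSpider.up_of_subset [Finite L] (h : IsSpider N l side) (h' : IsSpider N' l side)
    {c d : Nd} {c' d' : Nd'} (hc : ∀ k, N' c' k ⊆ N c k) (hd : ∀ k, N' d' k ⊆ N d k)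
    (hu : Up N' l c' d') : d = c ∨ Up N l c d := by
  by_cases hcd : d = c
  · exact Or.inl hcd
  right
  obtain ⟨r, hr, hs⟩ := id hu
  have hE : ∀ k, topFace r (N' c' k) ⊆ N c k ∩ N d k := fun k =>
    Finset.subset_inter (topFace_subset.trans (hc k))
      (by rw [hs k]; exact botFace_subset.trans (hd k))
  have hcr : {r}ᶜ ⊆ N c l := by rw [← hr]; exact hc l
  have hdr : {r}ᶜ ⊆ N d l := (hu.subset hr).trans (hd l)
  rcases h.up_of_nodesAdj (Ne.symm hcd) ⟨fun k => (topFace_nonempty (h'.nonempty c' k)).mono (hE k),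
    two_le_card_of_compl_subset (Finset.subset_inter hcr hdr)⟩ with h1 | h1
  · exact h1
  · exfalso
    have hdr' := h1.eq_compl hdr
    obtain ⟨k, hk, hk'⟩ := h'.cross c' r hr
    have h2 : r ∈ N d k := by
      have := hE k
      rw [topFace_of_mem hk] at this
      exact (Finset.mem_inter.1 (this (Finset.mem_singleton_self r))).2
    have h3 := h1.eq_singleton hdr' h2
    exact hk' (eq_singleton_of_subset (h3 ▸ hc k) (h'.nonempty c' k))

variable {nadj : Nd → Nd → Prop} {att : Nd → L → Prop} {ρ : Nd}
  {par : Nd ⊕ {k : L // k ≠ l} → Nd ⊕ {k : L // k ≠ l}} {ht : Nd ⊕ {k : L // k ≠ l} → ℕ}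
  {nadj' : Nd' → Nd' → Prop} {att' : Nd' → L → Prop} {ρ' : Nd'}
  {par' : Nd' ⊕ {k : L // k ≠ l} → Nd' ⊕ {k : L // k ≠ l}} {ht' : Nd' ⊕ {k : L // k ≠ l} → ℕ}

/-- If the cells of one complex refine those of another one, then the trees of the lines arise by
contraction. -/
theorem IsRootedSpider.isContractionOf [Finite L] [Nonempty Nd] [Nonempty Nd']
    (h : IsRootedSpider N l side nadj att ρ par ht)
    (h' : IsRootedSpider N' l side nadj' att' ρ' par' ht') (f : Nd' → Nd)
    (hsub : ∀ c k, N' c k ⊆ N (f c) k)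
    (hterm : ∀ c r κ, κ ≠ l → N' c l = {r}ᶜ → (∀ k, k ≠ l → (r ∈ N' c k ↔ k ≠ κ)) →
      N (f c) l = {r}ᶜ ∧ r ∉ N (f c) κ) :
    (nodeTree l nadj att).IsContractionOf (nodeTree l nadj' att') := by
  have hS := h.isSpider
  have hS' := h'.isSpider
  have hatt : ∀ c k, k ≠ l → Attached N' l side c k → Attached N l side (f c) k := by
    rintro c k hk (⟨h1, h2⟩ | ⟨r, rfl, h2, h3⟩ | ⟨r, hr, ht⟩)
    · exact Or.inl ⟨h1.trans (Finset.card_le_card (hsub c k)),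
        h2.trans (Finset.card_le_card (Finset.union_subset_union (hsub c l) (hsub c k)))⟩
    · exact Or.inr (Or.inl ⟨r, rfl, h2.trans (hsub c l), fun k' hk' => h3 k'
        (eq_singleton_of_subset (hk' ▸ hsub c k') (hS'.nonempty c k'))⟩)
    · obtain ⟨h1, h2⟩ := hterm c r k hk hr ht
      refine Or.inr (Or.inr ⟨r, h1, fun k' hk' => ⟨?_, fun hne => hsub c k' ((ht k' hk').2 hne)⟩⟩)
      rintro h3 rfl
      exact h2 h3
  have hroot : f ρ' = ρ := by
    apply h.eq_root
    intro d hd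
    obtain ⟨r, hr⟩ := hS'.leg ρ'
    rcases eq_of_compl_subset hr with hr' | hr'
    · rcases hS'.up ρ' r hr' with ⟨c', hc'⟩ | ⟨κ, hκ, ht⟩
      · exact h'.not_up c' ⟨r, hr', hc'⟩
      · obtain ⟨h1, h2⟩ := hterm ρ' r κ hκ hr' ht
        refine hS.not_up_of_terminal hκ h1 (fun k hk => ⟨?_, fun hne =>
          hsub ρ' k ((ht k hk).2 hne)⟩) hd
        rintro h3 rfl
        exact h2 h3
    · obtain ⟨s, hs, -⟩ := hd
      have := hsub ρ' l
      rw [hr', hs] at this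
      exact absurd (this (Finset.mem_univ s)) (by simp)
  -- A node other than the root lies on one leg only, and the small cells inside it inherit this
  -- leg.
  have hcomp : ∀ c d, f c = f d → f c ≠ ρ →
      ReflTransGen (Up N' l) c d ∨ ReflTransGen (Up N' l) d c := by
    intro c d hcd hne
    obtain ⟨e, he⟩ := h.exists_up hne
    obtain ⟨r, hr, -⟩ := he
    have key : ∀ c, N (f c) l = {r}ᶜ → {r}ᶜ ⊆ N' c l := by
      intro c hc
      obtain ⟨s, hs⟩ := hS'.leg c
      have h1 := hs.trans (hsub c l)
      rw [hc] at h1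
      rwa [eq_of_compl_subset_compl h1] at hs
    exact hS'.comparable (key c hr) (key d (hcd ▸ hr))
  refine LabelledGraph.isContractionOf_of_map (T := nodeTree l nadj att)
    (T' := nodeTree l nadj' att') h.rooted h'.rooted rfl (Sum.map f id) ?_ (fun x hx hx' => rfl)
    (congrArg Sum.inl hroot) ?_ ?_
  · rintro (c | k)
    · by_cases hc : c = ρ
      · exact ⟨.inl ρ', by rw [hc]; exact congrArg Sum.inl hroot⟩
      -- For surjectivity, take a line `k` that crosses `l` at `c`. The small cell to which `k` is
      -- attached is sent to a cell to which `k` is attached, and this can only be `c`.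
      · obtain ⟨e, r, hr, -⟩ := h.exists_up hc
        obtain ⟨k, hk, hk'⟩ := hS.cross c r hr
        have hkl : k ≠ l := by
          rintro rfl
          rw [hr] at hk
          simp at hk
        obtain ⟨c', hc'⟩ := hS'.exists_attached hkl
        exact ⟨.inl c', congrArg Sum.inl
          (hS.attached_unique hkl (hatt c' k hkl hc') (cross_attached hr hk hk'))⟩
    · exact ⟨.inr k, rfl⟩
  · rintro (c | k)
    · by_cases hc : c = ρ'
      · left
        rw [hc, h'.rooted.par_root]
      · obtain ⟨d, hd⟩ := h'.exists_up hc
        rw [h'.par_up c d hd]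
        rcases hS.up_of_subset hS' (hsub c) (hsub d) hd with h1 | h1
        · exact Or.inl (congrArg Sum.inl h1)
        · exact Or.inr (h.par_up _ _ h1).symm
    · obtain ⟨c, hc⟩ := hS'.exists_attached k.2
      right
      rw [h'.par_leaf c k hc]
      exact (h.par_leaf (f c) k (hatt c k.1 k.2 hc)).symm
  · rintro (c | k) (d | k') he hne
    · have he : f c = f d := Sum.inl_injective he
      rcases hcomp c d he (fun hc => hne (congrArg Sum.inl hc)) with h1 | h1
      · exact Or.inr (h'.descends_inl_iff.2 h1)
      · exact Or.inl (h'.descends_inl_iff.2 h1)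
    · exact absurd he Sum.inl_ne_inr
    · exact absurd he Sum.inr_ne_inl
    · have he : k = k' := Sum.inr_injective he
      rw [he]
      exact Or.inl (Descends.refl _)

end

/-! ### Minkowski cells -/

theorem mem_convexHull_image_iff {ι E : Type*} [Fintype ι] [AddCommGroup E] [Module ℝ E]
    (f : ι → E) (s : Set ι) (x : E) : x ∈ convexHull ℝ (f '' s) ↔
      ∃ w : ι → ℝ, (∀ i, 0 ≤ w i) ∧ (∀ i, i ∉ s → w i = 0) ∧ ∑ i, w i = 1 ∧
        ∑ i, w i • f i = x := by
  classical
  constructor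
  · intro hx
    refine convexHull_min (t := {x | ∃ w : ι → ℝ, (∀ i, 0 ≤ w i) ∧ (∀ i, i ∉ s → w i = 0) ∧
      ∑ i, w i = 1 ∧ ∑ i, w i • f i = x}) ?_ ?_ hx
    · rintro _ ⟨i, hi, rfl⟩
      refine ⟨Pi.single i 1, fun j => ?_, fun j hj => ?_, by simp, ?_⟩
      · by_cases h : j = i
        · subst h; simp
        · simp [h]
      · rw [Pi.single_eq_of_ne]
        rintro rfl
        exact hj hi
      · simp [Pi.single_apply]
    · rintro x ⟨w, h1, h2, h3, rfl⟩ y ⟨v, h4, h5, h6, rfl⟩ a b ha hb hab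
      refine ⟨fun i => a * w i + b * v i, fun i => ?_, fun i hi => ?_, ?_, ?_⟩
      · have := h1 i
        have := h4 i
        positivity
      · simp [h2 i hi, h5 i hi]
      · rw [Finset.sum_add_distrib, ← Finset.mul_sum, ← Finset.mul_sum, h3, h6]
        simpa using hab
      · simp only [add_smul, mul_smul, Finset.sum_add_distrib, ← Finset.smul_sum]
  · rintro ⟨w, h1, h2, h3, rfl⟩
    have hsum : ∑ i with i ∈ s, w i • f i = ∑ i, w i • f i := by
      rw [Finset.sum_filter]
      apply Finset.sum_congr rfl
      intro i _
      split_ifs with h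
      · rfl
      · rw [h2 i h, zero_smul]
    rw [← hsum]
    apply (convex_convexHull ℝ (f '' s)).sum_mem (fun i _ => h1 i)
    · rw [← h3, Finset.sum_filter]
      apply Finset.sum_congr rfl
      intro i _
      split_ifs with h
      · rfl
      · rw [h2 i h]
    · intro i hi
      exact subset_convexHull ℝ _ ⟨i, by simpa using hi, rfl⟩

namespace MixedCell

variable {m : ℕ} {c d F : MixedCell m} {x y : Fin 3 → ℝ}

/-- The weights `W j a` write the point `x` as a sum of points `∑ a, W j a • e_a` in the summands of
the cell `c`. -/
structure IsWeight (c : MixedCell m) (x : Fin 3 → ℝ) (W : Fin m → Fin 3 → ℝ) : Prop where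
  nonneg : ∀ j a, 0 ≤ W j a
  supp : ∀ j a, a ∉ c j → W j a = 0
  sum_eq_one : ∀ j, ∑ a, W j a = 1
  sum_eq : ∀ a, ∑ j, W j a = x a

theorem mem_polytope_iff : x ∈ c.polytope ↔ ∃ W, IsWeight c x W := by
  have key : ∀ (s : Finset (Fin 3)) (y : Fin 3 → ℝ),
      y ∈ convexHull ℝ ((fun a : Fin 3 => (Pi.single a 1 : Fin 3 → ℝ)) '' (s : Set (Fin 3))) ↔
      (∀ a, 0 ≤ y a) ∧ (∀ a, a ∉ s → y a = 0) ∧ ∑ a, y a = 1 := by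
    intro s y
    rw [mem_convexHull_image_iff]
    have hy : ∀ w : Fin 3 → ℝ, ∑ i, w i • (Pi.single i 1 : Fin 3 → ℝ) = w := by
      intro w
      ext a
      simp [Finset.sum_apply, Pi.single_apply]
    simp only [hy, Finset.mem_coe]
    constructor
    · rintro ⟨w, h1, h2, h3, rfl⟩
      exact ⟨h1, h2, h3⟩
    · rintro ⟨h1, h2, h3⟩
      exact ⟨y, h1, h2, h3, rfl⟩
  constructor
  · rintro ⟨W, hW, rfl⟩
    refine ⟨W, fun j => ((key _ _).1 (hW j)).1, fun j => ((key _ _).1 (hW j)).2.1,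
      fun j => ((key _ _).1 (hW j)).2.2, fun a => by simp⟩
  · rintro ⟨W, h1, h2, h3, h4⟩
    refine ⟨W, fun j => (key _ _).2 ⟨h1 j, h2 j, h3 j⟩, ?_⟩
    ext a
    simp [h4]

theorem polytope_mono (h : ∀ j, F j ⊆ c j) : F.polytope ⊆ c.polytope := by
  intro x hx
  rw [mem_polytope_iff] at hx ⊢
  obtain ⟨W, h1, h2, h3, h4⟩ := hx
  exact ⟨W, h1, fun j a ha => h2 j a fun h' => ha (h j h'), h3, h4⟩

/-- The number of summands that are the point `e_a`: the minimum of the coordinate `a`. -/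
def lo (c : MixedCell m) (a : Fin 3) : ℕ := (Finset.univ.filter fun j => c j = {a}).card

/-- The number of summands that contain the point `e_a`: the maximum of the coordinate `a`. -/
def hi (c : MixedCell m) (a : Fin 3) : ℕ := (Finset.univ.filter fun j => a ∈ c j).card

theorem IsWeight.le_one {W : Fin m → Fin 3 → ℝ} (hW : IsWeight c x W) (j : Fin m) (a : Fin 3) :
    W j a ≤ 1 := by
  rw [← hW.sum_eq_one j]
  exact Finset.single_le_sum (fun b _ => hW.nonneg j b) (Finset.mem_univ a)

theorem IsWeight.eq_one {W : Fin m → Fin 3 → ℝ} (hW : IsWeight c x W) {j : Fin m} {a : Fin 3}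
    (h : c j = {a}) : W j a = 1 := by
  rw [← hW.sum_eq_one j]
  refine (Finset.sum_eq_single a (fun b _ hb => hW.supp j b ?_) (by simp)).symm
  rw [h]; simpa using hb

theorem sum_eq_of_mem (hx : x ∈ c.polytope) : ∑ a, x a = m := by
  obtain ⟨W, hW⟩ := mem_polytope_iff.1 hx
  simp only [← hW.sum_eq]
  rw [Finset.sum_comm]
  simp [hW.sum_eq_one]

theorem lo_le_of_mem (hx : x ∈ c.polytope) (a : Fin 3) : (lo c a : ℝ) ≤ x a := by
  obtain ⟨W, hW⟩ := mem_polytope_iff.1 hx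
  rw [← hW.sum_eq, lo, ← nsmul_one, ← Finset.sum_const, Finset.sum_filter]
  apply Finset.sum_le_sum
  intro j _
  split_ifs with h
  · rw [hW.eq_one h]
  · exact hW.nonneg j a

theorem le_hi_of_mem (hx : x ∈ c.polytope) (a : Fin 3) : x a ≤ hi c a := by
  obtain ⟨W, hW⟩ := mem_polytope_iff.1 hx
  rw [← hW.sum_eq, hi, ← nsmul_one, ← Finset.sum_const, Finset.sum_filter]
  apply Finset.sum_le_sum
  intro j _
  split_ifs with h
  · exact hW.le_one j a
  · rw [hW.supp j a h]

theorem sum_mul_eq {W : Fin m → Fin 3 → ℝ} (hW : IsWeight c x W) (w : Fin 3 → ℝ) :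
    ∑ a, w a * x a = ∑ j, ∑ a, w a * W j a := by
  rw [Finset.sum_comm]
  simp only [← hW.sum_eq, Finset.mul_sum]

theorem convex_polytope : Convex ℝ c.polytope := by
  rintro x hx y hy s t hs ht hst
  obtain ⟨W, hW⟩ := mem_polytope_iff.1 hx
  obtain ⟨V, hV⟩ := mem_polytope_iff.1 hy
  refine mem_polytope_iff.2 ⟨fun j a => s * W j a + t * V j a, fun j a => ?_, fun j a h => ?_,
    fun j => ?_, fun a => ?_⟩
  · have := hW.nonneg j a
    have := hV.nonneg j a
    positivity
  · simp [hW.supp j a h, hV.supp j a h]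
  · rw [Finset.sum_add_distrib, ← Finset.mul_sum, ← Finset.mul_sum, hW.sum_eq_one, hV.sum_eq_one]
    simpa using hst
  · rw [Finset.sum_add_distrib, ← Finset.mul_sum, ← Finset.mul_sum, hW.sum_eq, hV.sum_eq]
    simp

theorem isCompact_polytope : IsCompact c.polytope := by
  have h : c.polytope = (fun y : Fin m → Fin 3 → ℝ => ∑ j, y j) '' (Set.univ.pi fun j =>
      convexHull ℝ ((fun a : Fin 3 => (Pi.single a 1 : Fin 3 → ℝ)) '' (c j : Set (Fin 3)))) := by
    ext x
    simp only [polytope, Set.mem_ofPred_eq, Set.mem_image, Set.mem_pi, Set.mem_univ, true_imp_iff]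
    exact ⟨fun ⟨y, h1, h2⟩ => ⟨y, h1, h2.symm⟩, fun ⟨y, h1, h2⟩ => ⟨y, h1, h2.symm⟩⟩
  rw [h]
  apply IsCompact.image
  · exact isCompact_univ_pi fun j =>
      Set.Finite.isCompact_convexHull ℝ ((c j).finite_toSet.image _)
  · fun_prop

/-- The sum of vertices of the summands is a point of the cell. -/
theorem sum_vertices_mem {v : Fin m → Fin 3} (hv : ∀ j, v j ∈ c j) :
    (fun a => ((Finset.univ.filter fun j => v j = a).card : ℝ)) ∈ c.polytope := by
  refine mem_polytope_iff.2 ⟨fun j a => if v j = a then 1 else 0, fun j a => ?_, fun j a h => ?_,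
    fun j => by simp, fun a => by simp⟩
  · split_ifs <;> norm_num
  · rw [if_neg]
    rintro rfl
    exact h (hv j)

theorem card_filter_eq_sum (p : Fin m → Prop) [DecidablePred p] :
    ((Finset.univ.filter p).card : ℝ) = ∑ j, if p j then (1 : ℝ) else 0 := by
  rw [Finset.card_filter]
  push_cast
  rfl

/-- A Minkowski sum of faces of the triangle is given by its bounds for the coordinates. -/
theorem mem_polytope_of_bounds (hc : ∀ j, (c j).Nonempty) (hsum : ∑ a, x a = m)
    (hlo : ∀ a, (lo c a : ℝ) ≤ x a) (hhi : ∀ a, x a ≤ hi c a) : x ∈ c.polytope := by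
  by_contra hx
  obtain ⟨f, u, hu, hf⟩ := geometric_hahn_banach_point_closed convex_polytope
    (isCompact_polytope (c := c)).isClosed hx
  set w : Fin 3 → ℝ := fun a => f (Pi.single a 1) with hw
  have hfw : ∀ z : Fin 3 → ℝ, f z = ∑ a, w a * z a := by
    intro z
    conv_lhs => rw [show z = ∑ a, z a • (Pi.single a 1 : Fin 3 → ℝ) by
      ext b; simp [Finset.sum_apply, Pi.single_apply]]
    rw [map_sum]
    apply Finset.sum_congr rfl
    intro a _
    rw [map_smul, smul_eq_mul, mul_comm]
  choose v hv hmin using fun j => Finset.exists_min_image (c j) w (hc j)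
  have h1 := hf _ (sum_vertices_mem hv)
  have h2 : f x < f fun a => ((Finset.univ.filter fun j => v j = a).card : ℝ) := hu.trans h1
  rw [hfw, hfw] at h2
  have h3 : ∑ a, w a * ((Finset.univ.filter fun j => v j = a).card : ℝ) = ∑ j, w (v j) := by
    simp only [card_filter_eq_sum, Finset.mul_sum]
    rw [Finset.sum_comm]
    simp
  rw [h3] at h2
  -- sort the weights
  obtain ⟨p, q, r, hpq, hqr, hne1, hne2, hne3⟩ :
      ∃ p q r : Fin 3, w p ≤ w q ∧ w q ≤ w r ∧ p ≠ q ∧ p ≠ r ∧ q ≠ r := by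
    rcases le_total (w 0) (w 1) with h | h <;> rcases le_total (w 1) (w 2) with h' | h' <;>
      rcases le_total (w 0) (w 2) with h'' | h''
    · exact ⟨0, 1, 2, h, h', by decide, by decide, by decide⟩
    · exact ⟨0, 1, 2, h, h', by decide, by decide, by decide⟩
    · exact ⟨0, 2, 1, h'', h', by decide, by decide, by decide⟩
    · exact ⟨2, 0, 1, h'', h, by decide, by decide, by decide⟩
    · exact ⟨1, 0, 2, h, h'', by decide, by decide, by decide⟩
    · exact ⟨1, 2, 0, h', h'', by decide, by decide, by decide⟩
    · exact ⟨2, 1, 0, h', h, by decide, by decide, by decide⟩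
    · exact ⟨2, 1, 0, h', h, by decide, by decide, by decide⟩
  have huniv : ∀ g : Fin 3 → ℝ, ∑ a, g a = g p + g q + g r := by
    intro g
    have : (Finset.univ : Finset (Fin 3)) = {p, q, r} := by
      clear * - hne1 hne2 hne3
      revert p q r; decide
    rw [this, Finset.sum_insert (by simp [hne1, hne2]), Finset.sum_insert (by simp [hne3]),
      Finset.sum_singleton, add_assoc]
  -- The minimum of the weights on a summand is `w p` if it contains `p`, `w r` if it is the point
  -- `r`, and `w q` otherwise. Summed over `j`, only the bounds `hi c p` and `lo c r` enter, and
  -- these hold for `x` by assumption.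
  have hj : ∀ j, w (v j) ≤ w q + (w p - w q) * (if p ∈ c j then 1 else 0) +
      (w r - w q) * (if c j = {r} then 1 else 0) := by
    intro j
    by_cases hp : p ∈ c j
    · have hr : c j ≠ {r} := by
        rintro h
        rw [h] at hp
        exact hne2 (Finset.mem_singleton.1 hp)
      rw [if_pos hp, if_neg hr]
      have := hmin j p hp
      linarith
    · by_cases hr : c j = {r}
      · rw [if_neg hp, if_pos hr]
        have := hmin j r (by rw [hr]; simp)
        linarith
      · have hq : q ∈ c j := by
          have h0 := hc j
          revert hp hr h0
          generalize c j = X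
          clear * - hne1 hne2 hne3
          revert p q r X
          decide
        rw [if_neg hp, if_neg hr]
        have := hmin j q hq
        linarith
  have h4 := Finset.sum_le_sum fun j (_ : j ∈ Finset.univ) => hj j
  rw [Finset.sum_add_distrib, Finset.sum_add_distrib, ← Finset.mul_sum, ← Finset.mul_sum,
    ← card_filter_eq_sum, ← card_filter_eq_sum] at h4
  simp only [Finset.sum_const, Finset.card_univ, Fintype.card_fin, nsmul_eq_mul] at h4
  rw [huniv] at h2 hsum
  have h5 := hhi p
  have h6 := hlo r
  simp only [hi, lo] at h5 h6
  have h7 : (w p - w q) * ((Finset.univ.filter fun j => p ∈ c j).card : ℝ) ≤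
      (w p - w q) * x p := mul_le_mul_of_nonpos_left h5 (by linarith)
  have h8 : (w r - w q) * ((Finset.univ.filter fun j => c j = {r}).card : ℝ) ≤
      (w r - w q) * x r := mul_le_mul_of_nonneg_left h6 (by linarith)
  rw [← hsum] at h4
  nlinarith

/-- A linear functional that defines a face is smaller on this face than elsewhere on the cell. -/
theorem sum_mul_le_of_face {w : Fin 3 → ℝ} (hF : ∀ j a, a ∈ F j → a ∈ c j ∧ ∀ b ∈ c j, w a ≤ w b)
    (hx : x ∈ F.polytope) (hy : y ∈ c.polytope) : ∑ a, w a * x a ≤ ∑ a, w a * y a := by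
  obtain ⟨W, hW⟩ := mem_polytope_iff.1 hx
  obtain ⟨V, hV⟩ := mem_polytope_iff.1 hy
  rw [sum_mul_eq hW, sum_mul_eq hV]
  apply Finset.sum_le_sum
  intro j _
  -- Both sides become averages over the product weights `W j a * V j b`, so that they can be
  -- compared term by term.
  have h1 : ∑ a, w a * W j a = ∑ a, ∑ b, W j a * V j b * w a := by
    apply Finset.sum_congr rfl
    intro a _
    have : ∑ b, W j a * V j b * w a = W j a * w a * ∑ b, V j b := by
      rw [Finset.mul_sum]
      exact Finset.sum_congr rfl fun b _ => by ring
    rw [this, hV.sum_eq_one]; ring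
  have h2 : ∑ b, w b * V j b = ∑ a, ∑ b, W j a * V j b * w b := by
    rw [Finset.sum_comm]
    apply Finset.sum_congr rfl
    intro b _
    have : ∑ a, W j a * V j b * w b = V j b * w b * ∑ a, W j a := by
      rw [Finset.mul_sum]
      exact Finset.sum_congr rfl fun a _ => by ring
    rw [this, hW.sum_eq_one]; ring
  rw [h1, h2]
  apply Finset.sum_le_sum
  intro a _
  apply Finset.sum_le_sum
  intro b _
  by_cases ha : a ∈ F j
  · by_cases hb : b ∈ c j
    · exact mul_le_mul_of_nonneg_left ((hF j a ha).2 b hb)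
        (mul_nonneg (hW.nonneg j a) (hV.nonneg j b))
    · rw [hV.supp j b hb]; simp
  · rw [hW.supp j a ha]; simp

end MixedCell

/-! ### The cells of a mixed subdivision -/

theorem Fin.exists_ne_ne (r : Fin 3) : ∃ p q : Fin 3, p ≠ q ∧ p ≠ r ∧ q ≠ r := by
  revert r; decide

theorem Fin.sum_eq_of_ne {p q r : Fin 3} (hpq : p ≠ q) (hpr : p ≠ r) (hqr : q ≠ r)
    {A : Type*} [AddCommMonoid A] (g : Fin 3 → A) : ∑ a, g a = g r + (g p + g q) := by
  have : (Finset.univ : Finset (Fin 3)) = {r, p, q} := by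
    revert p q r; decide
  rw [this, Finset.sum_insert (by simp [hpr.symm, hqr.symm]), Finset.sum_insert (by simp [hpq]),
    Finset.sum_singleton]

theorem Fin.eq_or_eq_or_eq_of_ne {p q r : Fin 3} (hpq : p ≠ q) (hpr : p ≠ r) (hqr : q ≠ r)
    (a : Fin 3) : a = r ∨ a = p ∨ a = q := by
  revert p q r a; decide

theorem mem_topFace_iff {r : Fin 3} {X : Finset (Fin 3)} : r ∈ topFace r X ↔ r ∈ X := by
  revert r X; decide

theorem mem_botFace_iff {r : Fin 3} {X : Finset (Fin 3)} : r ∈ botFace r X ↔ X = {r} := by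
  revert r X; decide

/-- An affine relation that holds on a set holds on its affine span. -/
theorem LinearMap.eq_of_mem_affineSpan {E : Type*} [AddCommGroup E] [Module ℝ E] {s : Set E}
    (f : E →ₗ[ℝ] ℝ) {k : ℝ} (h : ∀ x ∈ s, f x = k) {x : E} (hx : x ∈ affineSpan ℝ s) : f x = k := by
  refine affineSpan_induction hx h fun c u v w hu hv hw => ?_
  simp [hu, hv, hw]

theorem mem_dilatedTriangle_iff {m : ℕ} {x : Fin 3 → ℝ} :
    x ∈ dilatedTriangle m ↔ (∀ a, 0 ≤ x a) ∧ ∑ a, x a = m := by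
  constructor
  · rintro ⟨y, ⟨h1, h2⟩, rfl⟩
    refine ⟨fun a => mul_nonneg (Nat.cast_nonneg m) (h1 a), ?_⟩
    simp only [Pi.smul_apply, smul_eq_mul]
    rw [← Finset.mul_sum, h2, mul_one]
  · rintro ⟨h1, h2⟩
    rcases Nat.eq_zero_or_pos m with rfl | hm
    · refine ⟨Pi.single 0 1, single_mem_stdSimplex ℝ 0, ?_⟩
      have := (Finset.sum_eq_zero_iff_of_nonneg fun a _ => h1 a).1 (by simpa using h2)
      ext a
      simp [this a]
    · have hm' : (m : ℝ) ≠ 0 := by positivity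
      refine ⟨fun a => (m : ℝ)⁻¹ * x a, ⟨fun a => ?_, ?_⟩, ?_⟩
      · have := h1 a
        positivity
      · rw [← Finset.mul_sum, h2, inv_mul_cancel₀ hm']
      · ext a
        simp [hm']

namespace MixedCell

variable {m : ℕ} {c d F : MixedCell m} {x y : Fin 3 → ℝ} {w : Fin 3 → ℝ} {p q r : Fin 3}

theorem IsFace.subset (h : F.IsFace c) (j : Fin m) : F j ⊆ c j := by
  obtain ⟨w, h⟩ := h
  exact fun a ha => ((h j a).1 ha).1

theorem eq_of_forall_mem_iff (hw : ∀ a b, w a = w b)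
    (h : ∀ j a, a ∈ F j ↔ a ∈ c j ∧ ∀ b ∈ c j, w a ≤ w b) : F = c := by
  ext j a
  rw [h]
  exact ⟨fun h => h.1, fun h => ⟨h, fun b _ => (hw a b).le⟩⟩

/-- A face on which the coordinate `r` is constant is the cell itself, its top or its bottom. -/
theorem face_trichotomy (hpq : p ≠ q) (hpr : p ≠ r) (hqr : q ≠ r) (hw : w p = w q)
    (h : ∀ j a, a ∈ F j ↔ a ∈ c j ∧ ∀ b ∈ c j, w a ≤ w b) (hc : ∀ j, (c j).Nonempty) :
    F = c ∨ (∀ j, F j = topFace r (c j)) ∨ ∀ j, F j = botFace r (c j) := by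
  have h3 := Fin.eq_or_eq_or_eq_of_ne hpq hpr hqr
  have hw' : ∀ a, a ≠ r → w a = w p := by
    intro a ha
    rcases h3 a with rfl | rfl | rfl
    · exact absurd rfl ha
    · rfl
    · exact hw.symm
  rcases lt_trichotomy (w r) (w p) with hlt | heq | hgt
  -- Faces consist of minimizers: a small weight at `r` selects the part where the coordinate `r` is
  -- largest.
  · right; left
    intro j
    ext a
    rw [h]
    by_cases hr : r ∈ c j
    · rw [topFace_of_mem hr, Finset.mem_singleton]
      constructor
      · rintro ⟨_, h2⟩
        by_contra hne
        have := h2 r hr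
        rw [hw' a hne] at this
        linarith
      · rintro rfl
        refine ⟨hr, fun b _ => ?_⟩
        by_cases hb : b = a
        · rw [hb]
        · rw [hw' b hb]; exact hlt.le
    · rw [topFace_of_notMem hr]
      refine ⟨fun h => h.1, fun ha => ⟨ha, fun b hb => ?_⟩⟩
      rw [hw' a (by rintro rfl; exact hr ha), hw' b (by rintro rfl; exact hr hb)]
  · left
    refine eq_of_forall_mem_iff (fun a b => ?_) h
    have : ∀ a, w a = w p := fun a => by
      by_cases ha : a = r
      · rw [ha, heq]
      · exact hw' a ha
    rw [this a, this b]
  · right; right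
    intro j
    ext a
    rw [h]
    by_cases hr : c j = {r}
    · rw [hr, botFace_singleton]
      simp only [Finset.mem_singleton]
      exact ⟨fun h => h.1, by rintro rfl; simp⟩
    · rw [botFace_of_ne hr, Finset.mem_erase]
      obtain ⟨b, hb, hbr⟩ : ∃ b ∈ c j, b ≠ r := by
        by_contra hcon
        push Not at hcon
        exact hr (Finset.eq_singleton_iff_unique_mem.2
          ⟨by obtain ⟨b, hb⟩ := hc j; rw [← hcon b hb]; exact hb, hcon⟩)
      constructor
      · rintro ⟨h1, h2⟩
        refine ⟨?_, h1⟩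
        rintro rfl
        have := h2 b hb
        rw [hw' b hbr] at this
        linarith
      · rintro ⟨h1, h2⟩
        refine ⟨h2, fun b' _ => ?_⟩
        rw [hw' a h1]
        by_cases hb' : b' = r
        · rw [hb']; exact hgt.le
        · rw [hw' b' hb']

theorem lo_le_hi (c : MixedCell m) (r : Fin 3) : lo c r ≤ hi c r := by
  apply Finset.card_le_card
  intro j
  simp only [Finset.mem_filter, Finset.mem_univ, true_and]
  intro h; simp [h]

theorem lo_lt_hi {j : Fin m} (h1 : r ∈ c j) (h2 : c j ≠ {r}) : lo c r < hi c r := by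
  apply Finset.card_lt_card
  refine ⟨?_, fun h => ?_⟩
  · intro j
    simp only [Finset.mem_filter, Finset.mem_univ, true_and]
    intro h; simp [h]
  · have := h (Finset.mem_filter.2 ⟨Finset.mem_univ j, h1⟩)
    exact h2 (Finset.mem_filter.1 this).2

theorem exists_of_lo_lt_hi (h : lo c r < hi c r) : ∃ j, r ∈ c j ∧ c j ≠ {r} := by
  by_contra hcon
  push Not at hcon
  refine h.not_ge (Finset.card_le_card fun j => ?_)
  simp only [Finset.mem_filter, Finset.mem_univ, true_and]
  exact hcon j

theorem eq_hi_of_topFace (h : ∀ j, F j = topFace r (c j)) (hx : x ∈ F.polytope) :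
    x r = hi c r := by
  have h1 : lo F r = hi c r := by
    unfold lo hi
    congr 1
    ext j
    simp [h, topFace_eq_singleton_iff]
  have h2 : hi F r = hi c r := by
    unfold hi
    congr 1
    ext j
    simp only [h, Finset.mem_filter, Finset.mem_univ, true_and, mem_topFace_iff]
  apply le_antisymm
  · rw [← h2]; exact le_hi_of_mem hx r
  · rw [← h1]; exact lo_le_of_mem hx r

theorem eq_lo_of_botFace (h : ∀ j, F j = botFace r (c j)) (hx : x ∈ F.polytope) :
    x r = lo c r := by
  have h1 : lo F r = lo c r := by
    unfold lo
    congr 1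
    ext j
    simp [h, botFace_eq_singleton_iff]
  have h2 : hi F r = lo c r := by
    unfold hi lo
    congr 1
    ext j
    simp only [h, Finset.mem_filter, Finset.mem_univ, true_and, mem_botFace_iff]
  apply le_antisymm
  · rw [← h2]; exact le_hi_of_mem hx r
  · rw [← h1]; exact lo_le_of_mem hx r

/-- The cell `c` contains the unit triangle with centre `α + (m - ∑ a, α a) / 3`. -/
def HasAlcove (c : MixedCell m) (α : Fin 3 → ℕ) : Prop := ∀ a, lo c a ≤ α a ∧ α a < hi c a

/-- The centre of the unit triangle with index `α`. -/
noncomputable def centre (m : ℕ) (α : Fin 3 → ℕ) (a : Fin 3) : ℝ := α a + ((m : ℝ) - ∑ b, (α b : ℝ)) / 3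

theorem sum_centre (m : ℕ) (α : Fin 3 → ℕ) : ∑ a, centre m α a = m := by
  simp only [centre, Fin.sum_univ_three]
  ring

variable {α : Fin 3 → ℕ}

/-- The two cases are the upward and the downward unit triangles: the centre has fractional parts
`1/3` or `2/3`, and `α` is the vector of integral parts. -/
theorem centre_bounds (hα : ∑ a, α a + 1 = m ∨ ∑ a, α a + 2 = m) (a : Fin 3) :
    (α a : ℝ) < centre m α a ∧ centre m α a < α a + 1 := by
  have h : (∑ b, (α b : ℝ)) + 1 = m ∨ (∑ b, (α b : ℝ)) + 2 = m := by
    rcases hα with h | h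
    · left; exact_mod_cast h
    · right; exact_mod_cast h
  unfold centre
  rcases h with h | h <;> constructor <;> linarith

/-- The cell is cut out by integer bounds on the coordinates, and a unit triangle lies between the
same consecutive integers as its centre. -/
theorem hasAlcove_iff (hα : ∑ a, α a + 1 = m ∨ ∑ a, α a + 2 = m) (hc : ∀ j, (c j).Nonempty) :
    HasAlcove c α ↔ centre m α ∈ c.polytope := by
  constructor
  · intro h
    refine mem_polytope_of_bounds hc (sum_centre m α) (fun a => ?_) fun a => ?_
    · have h1 : (lo c a : ℝ) ≤ α a := by exact_mod_cast (h a).1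
      exact h1.trans (centre_bounds hα a).1.le
    · have h1 : (α a : ℝ) + 1 ≤ hi c a := by exact_mod_cast (h a).2
      exact (centre_bounds hα a).2.le.trans h1
  · intro h a
    have h1 := (lo_le_of_mem h a).trans_lt (centre_bounds hα a).2
    have h2 := (centre_bounds hα a).1.trans_le (le_hi_of_mem h a)
    constructor
    · exact Nat.lt_succ_iff.1 (by exact_mod_cast h1)
    · exact_mod_cast h2

/-- The common face of two cells with a common alcove is defined by a constant functional. -/
theorem const_of_hasAlcove (hα : ∑ a, α a + 1 = m ∨ ∑ a, α a + 2 = m) (hc : ∀ j, (c j).Nonempty)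
    (hd : ∀ j, (d j).Nonempty) (h1 : HasAlcove c α) (h2 : HasAlcove d α)
    (hw : ∀ x ∈ c.polytope, ∀ y ∈ c.polytope, x ∈ d.polytope → y ∈ d.polytope →
      ∑ a, w a * x a = ∑ a, w a * y a) (a b : Fin 3) : w a = w b := by
  -- the vertices of the alcove
  obtain ⟨s, hs, hs0, hs1⟩ : ∃ s t : ℝ, (∀ a, ∑ b, ((α b : ℝ) + t + s * if b = a then 1 else 0) = m) ∧
      s ≠ 0 ∧ (0 ≤ t ∧ t ≤ 1 ∧ 0 ≤ t + s ∧ t + s ≤ 1) := by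
    rcases hα with h | h
    · refine ⟨1, 0, fun a => ?_, by norm_num, by norm_num⟩
      rw [Finset.sum_add_distrib]
      simp
      exact_mod_cast h
    · refine ⟨-1, 1, fun a => ?_, by norm_num, by norm_num⟩
      rw [Finset.sum_add_distrib, Finset.sum_add_distrib]
      simp
      have : (∑ b, (α b : ℝ)) + 2 = m := by exact_mod_cast h
      linarith
  have hmem : ∀ c : MixedCell m, (∀ j, (c j).Nonempty) → HasAlcove c α → ∀ a,
      (fun b => (α b : ℝ) + hs + s * if b = a then 1 else 0) ∈ c.polytope := by
    intro c hc h a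
    refine mem_polytope_of_bounds hc (hs0 a) (fun b => ?_) fun b => ?_
    · have : (lo c b : ℝ) ≤ α b := by exact_mod_cast (h b).1
      split_ifs <;> linarith [hs1.2.1, hs1.2.2.1]
    · have : (α b : ℝ) + 1 ≤ hi c b := by exact_mod_cast (h b).2
      split_ifs <;> linarith [hs1.2.2.1, hs1.2.2.2]
  have := hw _ (hmem c hc h1 a) _ (hmem c hc h1 b) (hmem d hd h2 a) (hmem d hd h2 b)
  simp only [mul_add, Finset.sum_add_distrib] at this
  simp at this
  exact this.resolve_right hs1.1

end MixedCell

/-! ### Every unit triangle lies in exactly one cell -/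

namespace IsMixedSubdivision

open MixedCell

variable {m : ℕ} {M : Finset (MixedCell m)} {c d : MixedCell m} {x y : Fin 3 → ℝ}
  {w : Fin 3 → ℝ} {p q r : Fin 3} {α : Fin 3 → ℕ} (hM : IsMixedSubdivision M)

include hM

theorem nonempty (hc : c ∈ M) (j : Fin m) : (c j).Nonempty := (hM.1 c hc).1 j

/-- A coordinate that is constant on a cell is constant on its affine span, which contains the
corners of the big triangle. -/
theorem lo_lt_hi (hm : 0 < m) (hc : c ∈ M) (r : Fin 3) : lo c r < hi c r := by
  by_contra hcon
  have heq : lo c r = hi c r := le_antisymm (lo_le_hi c r) (not_lt.1 hcon)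
  have hconst : ∀ x ∈ c.polytope, (LinearMap.proj r : (Fin 3 → ℝ) →ₗ[ℝ] ℝ) x = hi c r := by
    intro x hx
    refine le_antisymm (le_hi_of_mem hx r) ?_
    rw [← heq]
    exact lo_le_of_mem hx r
  have hall : ∀ x ∈ dilatedTriangle m, x r = hi c r := by
    intro x hx
    have h1 : x ∈ affineSpan ℝ c.polytope := by
      rw [(hM.1 c hc).2]
      exact subset_affineSpan ℝ _ hx
    exact (LinearMap.proj r : (Fin 3 → ℝ) →ₗ[ℝ] ℝ).eq_of_mem_affineSpan hconst h1
  have hv : ∀ p, (m : ℝ) • (Pi.single p 1 : Fin 3 → ℝ) ∈ dilatedTriangle m :=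
    fun p => ⟨_, single_mem_stdSimplex ℝ p, rfl⟩
  obtain ⟨p, q, -, hpr, -⟩ := Fin.exists_ne_ne r
  have h1 := hall _ (hv r)
  have h2 := hall _ (hv p)
  simp [hpr.symm] at h1 h2
  rw [← h1] at h2
  have : (0 : ℝ) < m := by exact_mod_cast hm
  linarith

theorem exists_mem_ne (hm : 0 < m) (hc : c ∈ M) (r : Fin 3) : ∃ j, r ∈ c j ∧ c j ≠ {r} :=
  exists_of_lo_lt_hi (hM.lo_lt_hi hm hc r)

theorem exists_hasAlcove (hα : ∑ a, α a + 1 = m ∨ ∑ a, α a + 2 = m) : ∃ c ∈ M, HasAlcove c α := by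
  have h : centre m α ∈ dilatedTriangle m :=
    mem_dilatedTriangle_iff.2 ⟨fun a => (Nat.cast_nonneg _).trans (centre_bounds hα a).1.le,
      sum_centre m α⟩
  rw [← hM.2.1] at h
  obtain ⟨c, hc, h⟩ := Set.mem_iUnion₂.1 h
  exact ⟨c, hc, (hasAlcove_iff hα (hM.nonempty hc)).2 h⟩

theorem exists_face (hc : c ∈ M) (hd : d ∈ M) (hx : x ∈ c.polytope) (hx' : x ∈ d.polytope) :
    ∃ F : MixedCell m, F.IsFace c ∧ F.IsFace d ∧ c.polytope ∩ d.polytope = F.polytope := by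
  rcases hM.2.2 c hc d hd with h | h
  · exact absurd (show x ∈ c.polytope ∩ d.polytope from ⟨hx, hx'⟩) (by rw [h]; simp)
  · exact h

/-- The common face contains the three vertices of the unit triangle. A functional with equal values
there is constant, so the common face is all of `c` and all of `d`. -/
theorem eq_of_hasAlcove (hα : ∑ a, α a + 1 = m ∨ ∑ a, α a + 2 = m) (hc : c ∈ M) (hd : d ∈ M)
    (h1 : HasAlcove c α) (h2 : HasAlcove d α) : c = d := by
  obtain ⟨F, ⟨w, hw⟩, ⟨w', hw'⟩, hF⟩ := hM.exists_face hc hd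
    ((hasAlcove_iff hα (hM.nonempty hc)).1 h1) ((hasAlcove_iff hα (hM.nonempty hd)).1 h2)
  have key : ∀ {e : MixedCell m} {w : Fin 3 → ℝ},
      (∀ j a, a ∈ F j ↔ a ∈ e j ∧ ∀ b ∈ e j, w a ≤ w b) → F = e := by
    intro e w hw
    refine eq_of_forall_mem_iff (const_of_hasAlcove hα (hM.nonempty hc) (hM.nonempty hd) h1 h2 ?_) hw
    intro x hx y hy hx' hy'
    have hxF : x ∈ F.polytope := hF ▸ ⟨hx, hx'⟩
    have hyF : y ∈ F.polytope := hF ▸ ⟨hy, hy'⟩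
    have hsub : ∀ j, F j ⊆ e j := IsFace.subset ⟨w, hw⟩
    exact le_antisymm (sum_mul_le_of_face (fun j a => (hw j a).1) hxF (polytope_mono hsub hyF))
      (sum_mul_le_of_face (fun j a => (hw j a).1) hyF (polytope_mono hsub hxF))
  exact (key hw).symm.trans (key hw')

/-- Two cells with a common segment on a line `x r = const` have a common edge. -/
theorem topFace_eq_botFace (hm : 0 < m) (hc : c ∈ M) (hd : d ∈ M) (hcd : c ≠ d) (hxc : x ∈ c.polytope)
    (hxd : x ∈ d.polytope) (hyc : y ∈ c.polytope) (hyd : y ∈ d.polytope) (hxy : x ≠ y)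
    (hr : x r = y r) (hlo : lo c r < x r) (hhi : x r < hi d r) (j : Fin m) :
    topFace r (c j) = botFace r (d j) := by
  obtain ⟨p, q, hpq, hpr, hqr⟩ := Fin.exists_ne_ne r
  obtain ⟨F, ⟨w, hw⟩, ⟨w', hw'⟩, hF⟩ := hM.exists_face hc hd hxc hxd
  have hxF : x ∈ F.polytope := hF ▸ ⟨hxc, hxd⟩
  have hyF : y ∈ F.polytope := hF ▸ ⟨hyc, hyd⟩
  have key : ∀ {e : MixedCell m} {w : Fin 3 → ℝ}, e ∈ M →
      (∀ j a, a ∈ F j ↔ a ∈ e j ∧ ∀ b ∈ e j, w a ≤ w b) →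
      F = e ∨ (∀ j, F j = topFace r (e j)) ∨ ∀ j, F j = botFace r (e j) := by
    intro e w he hw
    have hsub : ∀ j, F j ⊆ e j := IsFace.subset ⟨w, hw⟩
    have h1 := le_antisymm
      (sum_mul_le_of_face (fun j a => (hw j a).1) hxF (polytope_mono hsub hyF))
      (sum_mul_le_of_face (fun j a => (hw j a).1) hyF (polytope_mono hsub hxF))
    have h2 : ∑ a, x a = ∑ a, y a := (sum_eq_of_mem hxc).trans (sum_eq_of_mem hyc).symm
    rw [Fin.sum_eq_of_ne hpq hpr hqr, Fin.sum_eq_of_ne hpq hpr hqr, hr] at h1 h2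
    have h3 : x p ≠ y p := by
      intro h3
      apply hxy
      ext a
      rcases Fin.eq_or_eq_or_eq_of_ne hpq hpr hqr a with rfl | rfl | rfl
      · exact hr
      · exact h3
      · linarith
    -- The points `x` and `y` differ by a multiple of `e_p - e_q`, and the functional that defines
    -- the face has the same value at both.
    have h4 : (w p - w q) * (x p - y p) = 0 := by
      have : x q - y q = - (x p - y p) := by linarith
      linear_combination h1 - w q * h2
    refine face_trichotomy hpq hpr hqr ?_ hw (hM.nonempty he)
    rcases mul_eq_zero.1 h4 with h | h
    · linarith
    · exact absurd (by linarith) h3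
  -- If the common face were all of `c`, then `c` would be `d`, or lie in the top of `d` although `x
  -- r < hi d r`, or lie in the bottom of `d`, with constant coordinate `r`.
  have hFne : F ≠ c := by
    rintro rfl
    rcases key hd hw' with h | h | h
    · exact hcd h
    · exact hhi.ne (eq_hi_of_topFace h hxF)
    · have h1 : ∀ z ∈ F.polytope, z r = lo d r := fun z hz => eq_lo_of_botFace h hz
      have h2 : hi F r ≤ lo F r := by
        by_contra hcon
        obtain ⟨j, h3, h4⟩ := exists_of_lo_lt_hi (not_le.1 hcon)
        rw [h j] at h3 h4
        rw [mem_botFace_iff] at h3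
        exact h4 (by rw [h3, botFace_singleton])
      exact (hM.lo_lt_hi hm hc r).not_ge h2
  have hFne' : F ≠ d := by
    rintro rfl
    rcases key hc hw with h | h | h
    · exact hcd h.symm
    · have h2 : hi F r ≤ lo F r := by
        by_contra hcon
        obtain ⟨j, h3, h4⟩ := exists_of_lo_lt_hi (not_le.1 hcon)
        rw [h j] at h3 h4
        rw [mem_topFace_iff] at h3
        exact h4 (topFace_of_mem h3)
      exact (hM.lo_lt_hi hm hd r).not_ge h2
    · exact hlo.ne' (eq_lo_of_botFace h hxF)
  rcases key hc hw with h | h | h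
  · exact absurd h hFne
  · rcases key hd hw' with h' | h' | h'
    · exact absurd h' hFne'
    · exact absurd (eq_hi_of_topFace h' hxF) hhi.ne
    · rw [← h, ← h']
  · exact absurd (eq_lo_of_botFace h hxF) hlo.ne'

end IsMixedSubdivision

namespace MixedCell

variable {m : ℕ} {c d E : MixedCell m} {x : Fin 3 → ℝ} {p q r : Fin 3} {α : Fin 3 → ℕ}

theorem mem_of_hasAlcove (hd : ∀ j, (d j).Nonempty) (h : HasAlcove d α) (hsum : ∑ a, x a = m)
    (h1 : ∀ a, (α a : ℝ) ≤ x a) (h2 : ∀ a, x a ≤ α a + 1) : x ∈ d.polytope := by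
  refine mem_polytope_of_bounds hd hsum (fun a => ?_) fun a => ?_
  · have : (lo d a : ℝ) ≤ α a := by exact_mod_cast (h a).1
    exact this.trans (h1 a)
  · have : (α a : ℝ) + 1 ≤ hi d a := by exact_mod_cast (h a).2
    exact (h2 a).trans this

/-- An edge on which the coordinate `r` is constant contains a unit segment. -/
theorem exists_segment (hE : ∀ j, (E j).Nonempty) (hr : ∀ j, r ∈ E j → E j = {r}) {i : Fin m}
    (hi : {r}ᶜ ⊆ E i) : ∃ α : Fin 3 → ℕ, α r = lo E r ∧ ∑ a, α a + 1 = m ∧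
      ∀ c : MixedCell m, (∀ j, E j ⊆ c j) → ∀ b, b ≠ r →
        (fun a => (α a : ℝ) + if a = b then 1 else 0) ∈ c.polytope := by
  -- One vertex is fixed in every summand except the `i`-th, where it runs over the two ends of
  -- `{r}ᶜ`. The vector `α` counts the fixed vertices.
  choose v hv using hE
  have hcount : ∀ b a, (Finset.univ.filter fun j => Function.update v i b j = a).card =
      (Finset.univ.filter fun j => j ≠ i ∧ v j = a).card + if a = b then 1 else 0 := by
    intro b a
    have h1 : (Finset.univ.filter fun j => j ≠ i ∧ v j = a) =
        (Finset.univ.erase i).filter fun j => v j = a := by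
      ext j; simp
    have h2 : ∀ s : Finset (Fin m), i ∉ s → (s.filter fun j => Function.update v i b j = a) =
        s.filter fun j => v j = a := by
      intro s hs
      apply Finset.filter_congr
      intro j hj
      rw [Function.update_of_ne (by rintro rfl; exact hs hj)]
    conv_lhs => rw [← Finset.insert_erase (Finset.mem_univ i)]
    rw [Finset.filter_insert, h2 _ (Finset.notMem_erase i _), h1, Function.update_self]
    split_ifs with h3 h4 h4
    · rw [Finset.card_insert_of_notMem (by simp)]
    · exact absurd h3.symm h4
    · exact absurd h4.symm h3
    · rfl
  have hmem : ∀ c : MixedCell m, (∀ j, E j ⊆ c j) → ∀ b, b ≠ r →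
      (fun a => ((Finset.univ.filter fun j => j ≠ i ∧ v j = a).card : ℝ) + if a = b then 1 else 0) ∈
        c.polytope := by
    intro c hc b hb
    have h1 : ∀ j, Function.update v i b j ∈ c j := by
      intro j
      by_cases hj : j = i
      · subst hj
        rw [Function.update_self]
        exact hc j (hi (by simpa using hb))
      · rw [Function.update_of_ne hj]
        exact hc j (hv j)
    have h2 := sum_vertices_mem h1
    simp only [hcount] at h2
    push_cast at h2
    exact h2
  refine ⟨fun a => (Finset.univ.filter fun j => j ≠ i ∧ v j = a).card, ?_, ?_, hmem⟩
  · refine congrArg Finset.card (Finset.ext fun j => ?_)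
    simp only [Finset.mem_filter, Finset.mem_univ, true_and]
    constructor
    · rintro ⟨-, h⟩
      exact hr j (h ▸ hv j)
    · intro h
      refine ⟨?_, by have := hv j; rw [h] at this; simpa using this⟩
      rintro rfl
      rw [h] at hi
      revert hi; clear * -; revert r; decide
  · obtain ⟨p, q, -, hpr, -⟩ := Fin.exists_ne_ne r
    have h := sum_eq_of_mem (hmem E (fun _ => subset_rfl) p hpr)
    rw [Finset.sum_add_distrib] at h
    simp only [Finset.sum_ite_eq', Finset.mem_univ, if_true] at h
    exact_mod_cast h

theorem hi_eq_lo_topFace (c : MixedCell m) : lo (fun j => topFace r (c j)) r = hi c r := by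
  unfold lo hi
  congr 1
  ext j
  simp [topFace_eq_singleton_iff]

theorem lo_botFace (c : MixedCell m) : lo (fun j => botFace r (c j)) r = lo c r := by
  unfold lo
  congr 1
  ext j
  simp [botFace_eq_singleton_iff]

theorem mem_topFace_imp {X : Finset (Fin 3)} : r ∈ topFace r X → topFace r X = {r} := by
  revert r X; decide

theorem mem_botFace_imp {X : Finset (Fin 3)} : r ∈ botFace r X → botFace r X = {r} := by
  revert r X; decide

theorem botFace_nonempty {X : Finset (Fin 3)} : X.Nonempty → (botFace r X).Nonempty := by
  revert r X; decide

theorem compl_subset_botFace {X : Finset (Fin 3)} : {r}ᶜ ⊆ X → {r}ᶜ ⊆ botFace r X := by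
  revert r X; decide

theorem compl_subset_of_topFace {X : Finset (Fin 3)} : {r}ᶜ ⊆ topFace r X → X = {r}ᶜ := by
  revert r X; decide

end MixedCell

/-! ### Neighbouring cells along a pseudoline -/

namespace IsMixedSubdivision

open MixedCell

variable {m : ℕ} {M : Finset (MixedCell m)} {c d : MixedCell m} {r : Fin 3} {i : Fin m}
  (hM : IsMixedSubdivision M)

include hM

/-- The top of `c` contains a unit segment. The upward unit triangle on it, in the direction of
growing coordinate `r`, lies in another cell, which then has this segment in common with `c`. -/
theorem exists_above (hc : c ∈ M) (hi : c i = {r}ᶜ) :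
    ∃ d ∈ M, ∀ j, topFace r (c j) = botFace r (d j) := by
  have hm : 0 < m := i.pos
  obtain ⟨α, h1, h2, h3⟩ := exists_segment (E := fun j => topFace r (c j)) (r := r) (i := i)
    (fun j => topFace_nonempty (hM.nonempty hc j)) (fun j => mem_topFace_imp)
    (by rw [hi, topFace_of_notMem (by simp)])
  rw [hi_eq_lo_topFace] at h1
  obtain ⟨d, hd, hα⟩ := hM.exists_hasAlcove (Or.inl h2)
  obtain ⟨p, q, hpq, hpr, hqr⟩ := Fin.exists_ne_ne r
  have h4 := (hα r).2
  have hcd : c ≠ d := by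
    rintro rfl
    exact h4.ne h1
  have hmem : ∀ b, b ≠ r → (fun a => (α a : ℝ) + if a = b then 1 else 0) ∈ d.polytope := by
    intro b hb
    refine mem_of_hasAlcove (hM.nonempty hd) hα ?_ (fun a => ?_) fun a => ?_
    · exact sum_eq_of_mem (h3 c (fun j => topFace_subset) b hb)
    · split_ifs <;> simp
    · split_ifs <;> simp
  refine ⟨d, hd, hM.topFace_eq_botFace hm hc hd hcd (h3 c (fun j => topFace_subset) p hpr)
    (hmem p hpr) (h3 c (fun j => topFace_subset) q hqr) (hmem q hqr) ?_ ?_ ?_ ?_⟩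
  · intro h
    have := congrFun h p
    simp [hpq] at this
  · simp [hpr.symm, hqr.symm]
  · simp only [hpr.symm, if_false, add_zero]
    rw [h1]
    exact_mod_cast hM.lo_lt_hi hm hc r
  · simp only [hpr.symm, if_false, add_zero]
    exact_mod_cast h4

/-- The summand `c k = {r}` keeps the cell away from side `r`, so there is a downward unit triangle
on the other side of a unit segment in its bottom. -/
theorem exists_below (hc : c ∈ M) (hi : {r}ᶜ ⊆ c i) {k : Fin m} (hk : c k = {r}) :
    ∃ d ∈ M, d i = {r}ᶜ ∧ ∀ j, topFace r (d j) = botFace r (c j) := by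
  have hm : 0 < m := i.pos
  obtain ⟨α, h1, h2, h3⟩ := exists_segment (E := fun j => botFace r (c j)) (r := r) (i := i)
    (fun j => botFace_nonempty (hM.nonempty hc j)) (fun j => mem_botFace_imp)
    (compl_subset_botFace hi)
  rw [lo_botFace] at h1
  have hpos : 0 < lo c r := Finset.card_pos.2 ⟨k, by simp [hk]⟩
  obtain ⟨p, q, hpq, hpr, hqr⟩ := Fin.exists_ne_ne r
  -- The downward triangle that shares the segment with the upward triangle `α` has index one lower
  -- in the coordinate `r`.
  set β : Fin 3 → ℕ := Function.update α r (α r - 1) with hβ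
  have hβr : β r + 1 = α r := by
    rw [hβ, Function.update_self]; omega
  have hβn : ∀ b, b ≠ r → β b = α b := fun b hb => by rw [hβ, Function.update_of_ne hb]
  have hsum : ∑ a, β a + 2 = m := by
    rw [Fin.sum_eq_of_ne hpq hpr hqr] at h2 ⊢
    rw [hβn p hpr, hβn q hqr]
    omega
  obtain ⟨d, hd, hα⟩ := hM.exists_hasAlcove (Or.inr hsum)
  have h4 := hα r
  have hcd : d ≠ c := by
    rintro rfl
    omega
  have hmem : ∀ b, b ≠ r → (fun a => (α a : ℝ) + if a = b then 1 else 0) ∈ d.polytope := by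
    intro b hb
    refine mem_of_hasAlcove (hM.nonempty hd) hα ?_ (fun a => ?_) fun a => ?_
    · exact sum_eq_of_mem (h3 c (fun j => botFace_subset) b hb)
    · by_cases ha : a = r
      · subst ha
        rw [← hβr]
        push_cast
        split_ifs <;> linarith
      · rw [hβn a ha]
        split_ifs <;> simp
    · by_cases ha : a = r
      · subst ha
        rw [← hβr, if_neg hb.symm]
        simp
      · rw [hβn a ha]
        split_ifs <;> simp
  have key : ∀ j, topFace r (d j) = botFace r (c j) := by
    refine hM.topFace_eq_botFace hm hd hc hcd (hmem p hpr) (h3 c (fun j => botFace_subset) p hpr)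
      (hmem q hqr) (h3 c (fun j => botFace_subset) q hqr) ?_ ?_ ?_ ?_
    · intro h
      have := congrFun h p
      simp [hpq] at this
    · simp [hpr.symm, hqr.symm]
    · simp only [hpr.symm, if_false, add_zero]
      exact_mod_cast (show lo d r < α r by omega)
    · simp only [hpr.symm, if_false, add_zero]
      rw [h1]
      exact_mod_cast hM.lo_lt_hi hm hc r
  refine ⟨d, hd, compl_subset_of_topFace ?_, key⟩
  rw [key i]
  exact compl_subset_botFace hi

/-- Both cells contain the upward unit triangle that stands on a unit segment of the common bottom.
-/
theorem eq_of_botFace_eq (hc : c ∈ M) (hd : d ∈ M) (hi : {r}ᶜ ⊆ c i)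
    (h : ∀ j, botFace r (c j) = botFace r (d j)) : c = d := by
  have hm : 0 < m := i.pos
  obtain ⟨α, h1, h2, h3⟩ := exists_segment (E := fun j => botFace r (c j)) (r := r) (i := i)
    (fun j => botFace_nonempty (hM.nonempty hc j)) (fun j => mem_botFace_imp)
    (compl_subset_botFace hi)
  obtain ⟨p, q, hpq, hpr, hqr⟩ := Fin.exists_ne_ne r
  have key : ∀ e ∈ M, (∀ j, botFace r (c j) = botFace r (e j)) → HasAlcove e α := by
    intro e he hce
    have hsub : ∀ j, botFace r (c j) ⊆ e j := fun j => by rw [hce]; exact botFace_subset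
    have hlo : lo e r = α r := by
      rw [h1, ← lo_botFace e]
      simp only [hce]
    have h4 := h3 e hsub p hpr
    have h5 := h3 e hsub q hqr
    have h6 : ∀ s t, s ≠ t → (fun a => (α a : ℝ) + if a = s then 1 else 0) ∈ e.polytope →
        (fun a => (α a : ℝ) + if a = t then 1 else 0) ∈ e.polytope → lo e s ≤ α s ∧ α s < MixedCell.hi e s := by
      intro s t hst hs ht
      have h7 := le_hi_of_mem hs s
      have h8 := lo_le_of_mem ht s
      simp only [if_true, if_neg hst, add_zero] at h7 h8
      constructor
      · exact_mod_cast h8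
      · have : α s + 1 ≤ MixedCell.hi e s := by exact_mod_cast h7
        omega
    intro a
    rcases Fin.eq_or_eq_or_eq_of_ne hpq hpr hqr a with rfl | rfl | rfl
    · rw [← hlo]
      exact ⟨le_rfl, hM.lo_lt_hi hm he a⟩
    · exact h6 a q hpq h4 h5
    · exact h6 a p hpq.symm h5 h4
  exact hM.eq_of_hasAlcove (Or.inl h2) hc hd (key c hc fun _ => rfl) (key d hd h)

end IsMixedSubdivision

namespace MixedCell

variable {m : ℕ} {M : Finset (MixedCell m)} {c d e e' : MixedCell m} {x : Fin 3 → ℝ}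
  {a r s : Fin 3} {α : Fin 3 → ℕ}

set_option synthInstance.maxSize 512 in
theorem topFace_eq_botFace_of {X Y : Finset (Fin 3)} (hrs : r ≠ s) (hra : r ≠ a) (hsa : s ≠ a)
    (h : r ∈ X ↔ s ∉ Y) (hX : X.Nonempty) (hY : Y.Nonempty) (haX : a ∉ X) (haY : a ∉ Y) :
    topFace r X = botFace r Y := by
  revert a r s X Y; decide

set_option synthInstance.maxSize 512 in
theorem mem_iff_ne_singleton {X : Finset (Fin 3)} (hrs : r ≠ s) (hra : r ≠ a) (hsa : s ≠ a)
    (hX : X.Nonempty) (ha : a ∉ X) : s ∈ X ↔ X ≠ {r} := by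
  revert a r s X; decide

/-- A nonempty summand without `a` either contains `s` or is the point `r`, so the two counts add up
to the number of summands. -/
theorem hi_add_lo (hrs : r ≠ s) (hra : r ≠ a) (hsa : s ≠ a) (he : ∀ j, (e j).Nonempty)
    (ha : ∀ j, a ∉ e j) : hi e s + lo e r = m := by
  have h : (Finset.univ.filter fun j => e j = {r}) = Finset.univ.filter fun j => ¬ s ∈ e j :=
    Finset.filter_congr fun j _ => by
      rw [mem_iff_ne_singleton hrs hra hsa (he j) (ha j), not_not]
  rw [hi, lo, h, Finset.card_filter_add_card_filter_not]
  simp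

end MixedCell

open MixedCell

/-! ### Edges on the sides of the big triangle -/

namespace IsBoundaryEdge

variable {m : ℕ} {M : Finset (MixedCell m)} {e e' : MixedCell m} {a r : Fin 3}

theorem notMem (h : IsBoundaryEdge M a e) (j : Fin m) : a ∉ e j := by
  obtain ⟨⟨c, -, hc⟩, -⟩ := h
  rw [hc]; simp

theorem nonempty (h : IsBoundaryEdge M a e) (j : Fin m) : (e j).Nonempty := h.2.1 j

theorem exists_eq (h : IsBoundaryEdge M a e) : ∃ j, e j = {a}ᶜ := by
  obtain ⟨j, hj⟩ := h.2.2
  refine ⟨j, ?_⟩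
  have := h.notMem j
  revert hj this
  generalize e j = X
  clear * -
  revert a X; decide

theorem exists_mem_ne (h : IsBoundaryEdge M a e) (hra : r ≠ a) : ∃ j, r ∈ e j ∧ e j ≠ {r} := by
  obtain ⟨j, hj⟩ := h.exists_eq
  refine ⟨j, by rw [hj]; simpa using hra, ?_⟩
  rw [hj]
  clear * -
  revert a r; decide

theorem lo_lt_hi (h : IsBoundaryEdge M a e) (hra : r ≠ a) : lo e r < hi e r := by
  obtain ⟨j, h1, h2⟩ := h.exists_mem_ne hra
  exact MixedCell.lo_lt_hi h1 h2

end IsBoundaryEdge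

namespace IsMixedSubdivision

variable {m : ℕ} {M : Finset (MixedCell m)} {c d e e' : MixedCell m} {x : Fin 3 → ℝ}
  {a r s : Fin 3} {α : Fin 3 → ℕ} (hM : IsMixedSubdivision M)

include hM

/-- The triangles with `α a = 0` are those standing on side `a`. If the base of one of them lies in
the edge `e`, the triangle lies in the cell of this edge, because that cell has a positive extent in
the coordinate `a`. -/
theorem hasAlcove_of_edge (hm : 0 < m) (hrs : r ≠ s) (hra : r ≠ a) (hsa : s ≠ a) (hc : c ∈ M)
    (he : ∀ j, e j = (c j).erase a) (hne : ∀ j, (e j).Nonempty) (ha : α a = 0)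
    (hα : ∑ b, α b + 1 = m) (h1 : lo e r ≤ α r) (h2 : α r < hi e r) : HasAlcove c α := by
  have hae : ∀ j, a ∉ e j := fun j => by rw [he]; simp
  have hlo : ∀ b, b ≠ a → lo c b ≤ lo e b := by
    intro b hb
    refine Finset.card_le_card fun j => ?_
    simp only [Finset.mem_filter, Finset.mem_univ, true_and]
    intro h
    rw [he, h, Finset.erase_eq_of_notMem]
    simpa using hb.symm
  have hhi : ∀ b, b ≠ a → hi c b = hi e b := by
    intro b hb
    refine congrArg Finset.card (Finset.filter_congr fun j _ => ?_)
    rw [he, Finset.mem_erase]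
    exact ⟨fun h => ⟨hb, h⟩, fun h => h.2⟩
  have h3 := hi_add_lo hrs hra hsa hne hae
  have h4 := hi_add_lo hrs.symm hsa hra hne hae
  have h5 := Fin.sum_eq_of_ne hrs hra hsa α
  have hsr := hlo s hsa
  have hrr := hlo r hra
  have hs := hhi s hsa
  have hr := hhi r hra
  intro b
  rcases Fin.eq_or_eq_or_eq_of_ne hrs hra hsa b with rfl | rfl | rfl
  · have h6 := hM.lo_lt_hi hm hc b
    have h7 : lo c b = 0 := by
      rw [lo, Finset.card_eq_zero, Finset.filter_eq_empty_iff]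
      intro j _ hj
      have := hne j
      rw [he, hj] at this
      simp at this
    omega
  · omega
  · omega

/-- A cell containing a unit triangle on side `a` has `lo c a = 0`, so no summand is lost when `a`
is erased, and the base of the triangle lies in the resulting edge. -/
theorem isBoundaryEdge_of_hasAlcove (hrs : r ≠ s) (hra : r ≠ a) (hsa : s ≠ a) (hc : c ∈ M)
    (ha : α a = 0) (hα : ∑ b, α b + 1 = m) (h : HasAlcove c α) :
    IsBoundaryEdge M a (fun j => (c j).erase a) ∧ lo (fun j => (c j).erase a) r ≤ α r ∧
      α r < hi (fun j => (c j).erase a) r := by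
  set e : MixedCell m := fun j => (c j).erase a with he
  have hlo : lo c a = 0 := by
    have := (h a).1
    omega
  have hne : ∀ j, (e j).Nonempty := by
    intro j
    rw [Finset.nonempty_iff_ne_empty]
    intro h1
    have h2 : c j = {a} := by
      have h3 := hM.nonempty hc j
      rw [he] at h1
      simp only [Finset.erase_eq_empty_iff] at h1
      exact h1.resolve_left h3.ne_empty
    rw [lo, Finset.card_eq_zero, Finset.filter_eq_empty_iff] at hlo
    exact hlo (Finset.mem_univ j) h2
  have hae : ∀ j, a ∉ e j := fun j => by rw [he]; simp
  have hhi : ∀ b, b ≠ a → hi c b = hi e b := by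
    intro b hb
    refine congrArg Finset.card (Finset.filter_congr fun j _ => ?_)
    rw [he, Finset.mem_erase]
    exact ⟨fun h => ⟨hb, h⟩, fun h => h.2⟩
  have h3 := hi_add_lo hrs hra hsa hne hae
  have h5 := Fin.sum_eq_of_ne hrs hra hsa α
  have hs := hhi s hsa
  have hr := hhi r hra
  have h6 := h s
  have h7 := h r
  have h8 : lo e r ≤ α r ∧ α r < hi e r := by omega
  refine ⟨⟨⟨c, hc, fun _ => rfl⟩, hne, ?_⟩, h8⟩
  obtain ⟨j, h9, h10⟩ := exists_of_lo_lt_hi (h8.1.trans_lt h8.2)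
  exact ⟨j, (hne j).card_pos.nat_succ_le.lt_of_ne fun hcard => h10
    (Finset.eq_singleton_iff_unique_mem.2 ⟨h9, fun b hb =>
      Finset.card_le_one.1 hcard.ge b hb r h9⟩)⟩

omit hM in
theorem exists_alcove_on_side (hrs : r ≠ s) (hra : r ≠ a) (hsa : s ≠ a) {t : ℕ} (ht : t < m) :
    ∃ α : Fin 3 → ℕ, α a = 0 ∧ α r = t ∧ ∑ b, α b + 1 = m := by
  refine ⟨fun b => if b = r then t else if b = s then m - 1 - t else 0, ?_, ?_, ?_⟩
  · simp [hra.symm, hsa.symm]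
  · simp
  · rw [Fin.sum_eq_of_ne hrs hra hsa]
    simp [hra.symm, hsa.symm, hrs.symm]
    omega

/-- A unit segment on the side determines the unit triangle standing on it, hence its cell, hence
the edge. -/
theorem edge_unique (hrs : r ≠ s) (hra : r ≠ a) (hsa : s ≠ a) (he : IsBoundaryEdge M a e)
    (he' : IsBoundaryEdge M a e') {t : ℕ} (h1 : lo e r ≤ t) (h2 : t < hi e r) (h3 : lo e' r ≤ t)
    (h4 : t < hi e' r) : e = e' := by
  have ht : t < m := h2.trans_le (by
    have := hi_add_lo hrs.symm hsa hra he.nonempty he.notMem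
    omega)
  obtain ⟨α, ha, rfl, hα⟩ := exists_alcove_on_side hrs hra hsa ht
  obtain ⟨⟨c, hc, hec⟩, hne, -⟩ := id he
  obtain ⟨⟨c', hc', hec'⟩, hne', -⟩ := id he'
  have hm : 0 < m := by omega
  have := hM.eq_of_hasAlcove (Or.inl hα) hc hc' (hM.hasAlcove_of_edge hm hrs hra hsa hc hec hne ha hα h1 h2)
    (hM.hasAlcove_of_edge hm hrs hra hsa hc' hec' hne' ha hα h3 h4)
  subst this
  funext j
  rw [hec, hec']

theorem exists_edge (hrs : r ≠ s) (hra : r ≠ a) (hsa : s ≠ a) {t : ℕ} (ht : t < m) :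
    ∃ e, IsBoundaryEdge M a e ∧ lo e r ≤ t ∧ t < hi e r := by
  obtain ⟨α, ha, rfl, hα⟩ := exists_alcove_on_side hrs hra hsa ht
  obtain ⟨c, hc, h⟩ := hM.exists_hasAlcove (Or.inl hα)
  exact ⟨_, hM.isBoundaryEdge_of_hasAlcove hrs hra hsa hc ha hα h⟩

theorem edge_eq_of_lo_eq (hrs : r ≠ s) (hra : r ≠ a) (hsa : s ≠ a) (he : IsBoundaryEdge M a e)
    (he' : IsBoundaryEdge M a e') (h : lo e r = lo e' r) : e = e' :=
  hM.edge_unique hrs hra hsa he he' le_rfl (he.lo_lt_hi hra) h.ge (h ▸ he'.lo_lt_hi hra)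

/-- Consecutive edges on a side of the triangle have a common vertex. -/
theorem edge_step (hrs : r ≠ s) (hra : r ≠ a) (hsa : s ≠ a) (he : IsBoundaryEdge M a e)
    (he' : IsBoundaryEdge M a e') (h : hi e r = lo e' r) (j : Fin m) :
    topFace r (e j) = botFace r (e' j) := by
  -- The common vertex: its coordinate `r` is maximal on `e` and its coordinate `s` is maximal on
  -- `e'`.
  set z : Fin 3 → ℝ := fun b => if b = r then (lo e' r : ℝ) else if b = s then (hi e' s : ℝ) else 0
    with hz
  have hpt : ∀ e, IsBoundaryEdge M a e → lo e r ≤ lo e' r → lo e' r ≤ hi e r → z ∈ e.polytope := by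
    intro e he h1 h2
    rw [hz]
    have h3 := hi_add_lo hrs hra hsa he.nonempty he.notMem
    have h4 := hi_add_lo hrs.symm hsa hra he.nonempty he.notMem
    have h5 := hi_add_lo hrs hra hsa he'.nonempty he'.notMem
    refine mem_polytope_of_bounds he.nonempty ?_ (fun b => ?_) fun b => ?_
    · rw [Fin.sum_eq_of_ne hrs hra hsa]
      simp [hra.symm, hsa.symm, hrs.symm]
      rw [add_comm]
      exact_mod_cast h5
    · rcases Fin.eq_or_eq_or_eq_of_ne hrs hra hsa b with rfl | rfl | rfl
      · simp [hra.symm, hsa.symm]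
        rw [lo, Finset.card_eq_zero, Finset.filter_eq_empty_iff]
        intro j _ hj
        exact he.notMem j (by rw [hj]; simp)
      · simpa using h1
      · simp [hrs.symm]
        omega
    · rcases Fin.eq_or_eq_or_eq_of_ne hrs hra hsa b with rfl | rfl | rfl
      · simp [hra.symm, hsa.symm]
      · simpa using h2
      · simp [hrs.symm]
        omega
  have hx : z ∈ e.polytope := hpt e he (by have := he.lo_lt_hi hra; omega) h.ge
  have hx' : z ∈ e'.polytope := hpt e' he' le_rfl (he'.lo_lt_hi hra).le
  obtain ⟨⟨c, hc, hec⟩, -, -⟩ := id he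
  obtain ⟨⟨c', hc', hec'⟩, -, -⟩ := id he'
  have hec0 : ∀ j, e j ⊆ c j := fun j => by rw [hec]; exact Finset.erase_subset _ _
  have hec0' : ∀ j, e' j ⊆ c' j := fun j => by rw [hec']; exact Finset.erase_subset _ _
  obtain ⟨F, hF, hF', hFe⟩ := hM.exists_face hc hc' (polytope_mono hec0 hx) (polytope_mono hec0' hx')
  obtain ⟨W, hW⟩ := mem_polytope_iff.1
    (show z ∈ F.polytope from hFe ▸ ⟨polytope_mono hec0 hx, polytope_mono hec0' hx'⟩)
  -- the weights of the common vertex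
  have hWa : ∀ j, W j a = 0 := by
    have h1 := hW.sum_eq a
    simp only [hz, hra.symm, hsa.symm, if_false] at h1
    intro j
    exact (Finset.sum_eq_zero_iff_of_nonneg fun j _ => hW.nonneg j a).1 h1 j (Finset.mem_univ j)
  -- If a coordinate attains its maximum, each summand that contains the corresponding point has all
  -- its weight there. The weights come from the common labelled face, so the conclusions for `e`
  -- and for `e'` concern the same `W`.
  have force : ∀ (e c : MixedCell m) (b : Fin 3), b ≠ a → (∀ j, e j = (c j).erase a) →
      (∀ j, F j ⊆ c j) → ∑ j, W j b = hi e b → ∀ j, W j b = if b ∈ e j then 1 else 0 := by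
    intro e c b hb hec hFc hsum
    rw [hi, card_filter_eq_sum] at hsum
    have h1 : ∀ j, W j b ≤ if b ∈ e j then 1 else 0 := by
      intro j
      split_ifs with h
      · exact hW.le_one j b
      · rw [hW.supp j b]
        intro h'
        exact h (by rw [hec]; exact Finset.mem_erase.2 ⟨hb, hFc j h'⟩)
    intro j
    exact (Finset.sum_eq_sum_iff_of_le fun j _ => h1 j).1 hsum j (Finset.mem_univ j)
  have h1 := force e c r hra hec hF.subset (by rw [hW.sum_eq]; simp [hz, h]) j
  have h2 := force e' c' s hsa hec' hF'.subset (by rw [hW.sum_eq]; simp [hz, hrs.symm]) j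
  have h3 := hW.sum_eq_one j
  rw [Fin.sum_eq_of_ne hrs hra hsa, hWa, h1, h2, zero_add] at h3
  have h4 : r ∈ e j ↔ s ∉ e' j := by
    split_ifs at h3 with h5 h6 h6 <;> simp_all
  exact topFace_eq_botFace_of hrs hra hsa h4 (he.nonempty j) (he'.nonempty j) (he.notMem j)
    (he'.notMem j)

theorem exists_next_edge (hrs : r ≠ s) (hra : r ≠ a) (hsa : s ≠ a) (he : IsBoundaryEdge M a e)
    {k : Fin m} (hk : r ∉ e k) :
    ∃ e', IsBoundaryEdge M a e' ∧ ∀ j, topFace r (e j) = botFace r (e' j) := by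
  have hlt : hi e r < m := by
    have h1 : hi e r < (Finset.univ : Finset (Fin m)).card := Finset.card_lt_card
      ⟨Finset.filter_subset _ _, fun h => hk (Finset.mem_filter.1 (h (Finset.mem_univ k))).2⟩
    simpa using h1
  obtain ⟨e', he', h1, h2⟩ := hM.exists_edge hrs hra hsa hlt
  refine ⟨e', he', hM.edge_step hrs hra hsa he he' (le_antisymm ?_ h1)⟩
  by_contra hcon
  have h3 := he.lo_lt_hi hra
  -- This is the last unit segment of `e`; it would also belong to `e'` if the two edges overlapped.
  have := hM.edge_unique hrs hra hsa he he' (t := hi e r - 1) (by omega) (by omega) (by omega) (by omega)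
  subst this
  omega

theorem exists_previous_edge (hrs : r ≠ s) (hra : r ≠ a) (hsa : s ≠ a) (he : IsBoundaryEdge M a e)
    {k : Fin m} (hk : e k = {r}) :
    ∃ e', IsBoundaryEdge M a e' ∧ ∀ j, topFace r (e' j) = botFace r (e j) := by
  have hpos : 0 < lo e r := Finset.card_pos.2 ⟨k, by simp [hk]⟩
  have h0 := he.lo_lt_hi hra
  have hm : hi e r ≤ m := by
    have := hi_add_lo hrs.symm hsa hra he.nonempty he.notMem
    omega
  obtain ⟨e', he', h1, h2⟩ := hM.exists_edge hrs hra hsa (t := lo e r - 1) (by omega)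
  refine ⟨e', he', hM.edge_step hrs hra hsa he' he (le_antisymm ?_ (by omega))⟩
  by_contra hcon
  have := hM.edge_unique hrs hra hsa he he' (t := lo e r) (by omega) (by omega) (by omega) (by omega)
  subst this
  omega

end IsMixedSubdivision

/-! ### The lines of a mixed subdivision as spiders -/

open MixedCell IsSpider

namespace MixedCell

variable {m : ℕ}

/-- The positions of all lines relative to the cell `c` passed by the line `ℓ`: the boundary lines
are far away, but at the boundary line `a` itself we look at its leg from the side `a + 2`. -/
def faces (ℓ : TreeLabel m) (c : MixedCell m) : TreeLabel m → Finset (Fin 3)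
  | .inr j => c j
  | .inl b => if ℓ = .inl b then {b + 2}ᶜ else {b}

variable {ℓ : TreeLabel m} {c d : MixedCell m} {a b r : Fin 3} {i j : Fin m}

@[simp] theorem faces_inr : faces ℓ c (.inr j) = c j := rfl

@[simp] theorem faces_inr_inl : faces (.inr i) c (.inl b) = {b} := rfl

@[simp] theorem faces_inl_self : faces (.inl a) c (.inl a) = {a + 2}ᶜ := if_pos rfl

theorem faces_inl_of_ne (h : b ≠ a) : faces (.inl a) c (.inl b) = {b} :=
  if_neg fun h' => h (Sum.inl_injective h').symm

end MixedCell

section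

variable {a b r : Fin 3} {X : Finset (Fin 3)}

theorem Fin.add_two_ne (a : Fin 3) : a + 2 ≠ a := by
  revert a; decide

theorem Fin.add_one_ne (a : Fin 3) : a + 1 ≠ a := by
  revert a; decide

theorem Fin.add_two_ne_add_one (a : Fin 3) : a + 2 ≠ a + 1 := by
  revert a; decide

theorem Fin.eq_add_of_ne (h : b ≠ a) : b = a + 1 ∨ b = a + 2 := by
  revert a b; decide

theorem topFace_singleton_eq_botFace : topFace r {b} = botFace r {b} := by
  revert b r; decide

theorem topFace_compl_eq_botFace : topFace r {b}ᶜ = botFace r {b}ᶜ ↔ b = r := by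
  revert b r; decide

theorem two_le_card_iff (hX : X.Nonempty) (ha : a ∉ X) : 2 ≤ X.card ↔ a + 2 ∈ X ∧ X ≠ {a + 2} := by
  revert a X; decide

theorem exists_compl_subset (h : 2 ≤ X.card) : ∃ r : Fin 3, {r}ᶜ ⊆ X := by
  revert X; decide

theorem erase_nonempty_iff (hX : X.Nonempty) : (X.erase b).Nonempty ↔ X ≠ {b} := by
  revert b X; decide

theorem two_le_card_erase_iff : 2 ≤ (X.erase b).card ↔ {b}ᶜ ⊆ X := by
  revert b X; decide

theorem ne_add_one_iff_mem (hX : X.Nonempty) (ha : a ∉ X) : X ≠ {a + 1} ↔ a + 2 ∈ X := by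
  revert a X; decide

end

namespace IsMixedSubdivision

variable {m : ℕ} {M : Finset (MixedCell m)} (hM : IsMixedSubdivision M)

include hM

/-- The edges on side `a` form one leg, along which the coordinate `a + 2` grows. It starts at the
corner on side `a + 2` and ends at the corner on side `a + 1`, whose label is the terminal one. -/
theorem isSpider_boundary (a : Fin 3) :
    IsSpider (fun e : {e // IsTreeNode M (.inl a) e} => faces (.inl a) e.1) (.inl a) Sum.inl := by
  have hrs := Fin.add_two_ne_add_one a
  have hra := Fin.add_two_ne a
  have hsa := Fin.add_one_ne a
  have hleg : ∀ {e : MixedCell m} {r}, {r}ᶜ ⊆ faces (.inl a) e (.inl a) → r = a + 2 := by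
    intro e r h
    rw [faces_inl_self] at h
    exact eq_of_compl_subset_compl h
  have hext : ∀ {e e' : MixedCell m}, (∀ j, topFace (a + 2) (e j) = botFace (a + 2) (e' j)) →
      ∀ k, topFace (a + 2) (faces (.inl a) e k) = botFace (a + 2) (faces (.inl a) e' k) := by
    rintro e e' h (b | j)
    · by_cases hb : b = a
      · subst hb
        rw [faces_inl_self, faces_inl_self, topFace_compl_eq_botFace]
      · rw [faces_inl_of_ne hb, faces_inl_of_ne hb, topFace_singleton_eq_botFace]
    · exact h j
  constructor
  · rintro ⟨e, he⟩ (b | j)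
    · by_cases hb : b = a
      · subst hb
        rw [faces_inl_self]
        exact ⟨b, by simp⟩
      · rw [faces_inl_of_ne hb]; simp
    · exact IsBoundaryEdge.nonempty he j
  · exact fun e => ⟨a + 2, by rw [faces_inl_self]⟩
  · rintro e r hr
    obtain rfl := hleg hr
    exact faces_inl_of_ne hra
  · exact Sum.inl_injective
  · rintro ⟨e, he⟩ r hr
    obtain rfl := hleg hr.ge
    obtain ⟨j, hj⟩ := IsBoundaryEdge.exists_mem_ne he hra
    exact ⟨.inr j, hj⟩
  · rintro ⟨e, he⟩ r hr
    obtain rfl := hleg hr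
    by_cases h : ∃ j, e j = {a + 2}
    · obtain ⟨j, hj⟩ := h
      obtain ⟨e', he', h⟩ := hM.exists_previous_edge hrs hra hsa he hj
      exact Or.inl ⟨⟨e', he'⟩, faces_inl_self, hext h⟩
    · right
      push Not at h
      rintro (b | j) hk
      · by_cases hb : b = a
        · subst hb
          rw [faces_inl_self] at hk
          exact absurd hk (compl_singleton_ne _)
        · rw [faces_inl_of_ne hb] at hk
          rw [Finset.singleton_inj.1 hk]
      · exact absurd hk (h j)
  · rintro ⟨e, he⟩ r hr
    obtain rfl := hleg hr.ge
    by_cases h : ∃ j, a + 2 ∉ e j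
    · obtain ⟨j, hj⟩ := h
      obtain ⟨e', he', h⟩ := hM.exists_next_edge hrs hra hsa he hj
      exact Or.inl ⟨⟨e', he'⟩, hext h⟩
    · right
      push Not at h
      refine ⟨.inl (a + 1), fun h' => hsa (Sum.inl_injective h'), ?_⟩
      rintro (b | j) hk
      · have hb : b ≠ a := fun h => hk (congrArg _ h)
        rw [faces_inl_of_ne hb]
        rcases Fin.eq_add_of_ne hb with rfl | rfl
        · simp [hrs]
        · simp [hrs]
      · simpa using h j
  · rintro ⟨e, he⟩ ⟨e', he'⟩ r hr hr' h
    obtain rfl := hleg hr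
    refine Subtype.ext (hM.edge_eq_of_lo_eq hrs hra hsa he he' ?_)
    rw [← lo_botFace e, ← lo_botFace e']
    exact congrArg (fun f => lo f (a + 2)) (funext fun j => h (.inr j))
  · rintro ⟨e, he⟩ ⟨e', he'⟩ r hr hr' h h'
    obtain rfl := hleg hr
    refine Subtype.ext (hM.edge_eq_of_lo_eq hrs hra hsa he he' ?_)
    have hzero : ∀ e : MixedCell m, (∀ k, faces (.inl a) e k = {a + 2} → k = .inl (a + 2)) →
        lo e (a + 2) = 0 := by
      intro e h
      rw [lo, Finset.card_eq_zero, Finset.filter_eq_empty_iff]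
      intro j _ hj
      exact absurd (h (.inr j) hj) Sum.inr_ne_inl
    rw [hzero e h, hzero e' h']
  · rintro ⟨e, he⟩ r κ hκ hr h ⟨e', he'⟩
    obtain rfl := hleg hr.ge
    have h1 : κ = .inl (a + 1) := by
      by_contra hne
      have := (h (.inl (a + 1)) fun h' => hsa (Sum.inl_injective h')).2 (Ne.symm hne)
      simp only [faces_inl_of_ne hsa, Finset.mem_singleton] at this
      exact hrs this
    subst h1
    refine ⟨faces_inl_self, ?_⟩
    simp only [faces_inl_of_ne hsa, Finset.mem_singleton]
    exact hrs

omit hM in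
theorem nodeAdj_boundary_iff {a : Fin 3} (e e' : {e // IsTreeNode M (.inl a) e}) :
    NodeAdj (.inl a) e.1 e'.1 ↔
      NodesAdj (fun e : {e // IsTreeNode M (.inl a) e} => faces (.inl a) e.1) (.inl a) e e' := by
  constructor
  · intro h
    refine ⟨?_, ?_⟩
    · rintro (b | j)
      · simp only [faces, Finset.inter_self]
        split_ifs
        · exact ⟨b, by simp⟩
        · simp
      · exact h j
    · simp only [faces_inl_self, Finset.inter_self]
      exact two_le_card_of_compl_subset (Finset.Subset.refl _)
  · exact fun h j => h.1 (.inr j)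

omit hM in
theorem leafAdj_boundary_iff {a : Fin 3} (e : {e // IsTreeNode M (.inl a) e}) (k : TreeLabel m)
    (hk : k ≠ .inl a) : LeafAdj (.inl a) e.1 k ↔
      Attached (fun e : {e // IsTreeNode M (.inl a) e} => faces (.inl a) e.1) (.inl a) Sum.inl e k := by
  obtain ⟨e, he⟩ := e
  have hne := fun j => IsBoundaryEdge.nonempty he j
  have hnm := fun j => IsBoundaryEdge.notMem he j
  have hrs := Fin.add_two_ne_add_one a
  have hra := Fin.add_two_ne a
  have hsa := Fin.add_one_ne a
  have h1ne : (.inl (a + 1) : TreeLabel m) ≠ .inl a := fun h' => hsa (Sum.inl_injective h')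
  unfold Attached
  simp only [faces_inl_self]
  rcases k with b | j
  · have hb : b ≠ a := fun h => hk (congrArg _ h)
    have hcard : ¬ 2 ≤ (faces (.inl a) e (.inl b)).card := by
      rw [faces_inl_of_ne hb]; simp
    simp only [hcard, false_and, false_or]
    rcases Fin.eq_add_of_ne hb with rfl | rfl
    · constructor
      · intro h
        refine Or.inr ⟨a + 2, rfl, ?_⟩
        rintro (b' | j) hk'
        · have hb' : b' ≠ a := fun h => hk' (congrArg _ h)
          rw [faces_inl_of_ne hb']
          rcases Fin.eq_add_of_ne hb' with rfl | rfl
          · simp [hrs]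
          · simp [hrs]
        · simpa using (ne_add_one_iff_mem (hne j) (hnm j)).1 ((erase_nonempty_iff (hne j)).1 (h j))
      · rintro (⟨r, h1, h2, -⟩ | ⟨r, h1, h2⟩) j
        · have h3 := Sum.inl_injective h1
          have h4 := eq_of_compl_subset_compl h2
          exact absurd (h3.trans h4).symm hrs
        · obtain rfl := compl_singleton_injective h1
          rw [erase_nonempty_iff (hne j), ne_add_one_iff_mem (hne j) (hnm j)]
          exact (h2 (.inr j) (by simp)).2 (by simp)
    · constructor
      · intro h
        refine Or.inl ⟨a + 2, rfl, Finset.Subset.refl _, ?_⟩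
        rintro (b' | j) hk'
        · by_cases hb' : b' = a
          · subst hb'
            rw [faces_inl_self] at hk'
            exact absurd hk' (compl_singleton_ne _)
          · rw [faces_inl_of_ne hb'] at hk'
            rw [Finset.singleton_inj.1 hk']
        · exact absurd hk' ((erase_nonempty_iff (hne j)).1 (h j))
      · rintro (⟨r, h1, -, h2⟩ | ⟨r, h1, h2⟩) j
        · obtain rfl := Sum.inl_injective h1
          rw [erase_nonempty_iff (hne j)]
          exact fun h => absurd (h2 (.inr j) h) Sum.inr_ne_inl
        · obtain rfl := compl_singleton_injective h1
          have := (h2 (.inl (a + 1)) h1ne).2 (fun h => hrs (Sum.inl_injective h).symm)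
          rw [faces_inl_of_ne hsa, Finset.mem_singleton] at this
          exact absurd this hrs
  · constructor
    · intro h
      refine Or.inl ⟨h, ?_⟩
      rw [faces_inr]
      exact (cross_iff.2 ((two_le_card_iff (hne j) (hnm j)).1 h)).2
    · rintro (⟨h, -⟩ | ⟨r, h, -⟩ | ⟨r, h1, h2⟩)
      · exact h
      · exact absurd h Sum.inr_ne_inl
      · obtain rfl := compl_singleton_injective h1
        have := (h2 (.inl (a + 1)) h1ne).2 Sum.inl_ne_inr
        rw [faces_inl_of_ne hsa, Finset.mem_singleton] at this
        exact absurd this hrs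

/-- Unit segments on a side give nodes for the boundary lines. A pseudoline `i` ends in some edge of
side `0`, and the cell at this edge is a node for `i`. -/
theorem nonempty_treeNode (hm : 0 < m) (ℓ : TreeLabel m) :
    Nonempty {c : MixedCell m // IsTreeNode M ℓ c} := by
  have key : ∀ a, Nonempty {c : MixedCell m // IsTreeNode M (.inl a) c} := by
    intro a
    obtain ⟨e, he, -⟩ := hM.exists_edge (Fin.add_two_ne_add_one a) (Fin.add_two_ne a)
      (Fin.add_one_ne a) hm
    exact ⟨⟨e, he⟩⟩
  rcases ℓ with a | i
  · exact key a
  · have := key 0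
    obtain ⟨e, he⟩ := (hM.isSpider_boundary 0).exists_attached (k := .inr i) Sum.inr_ne_inl
    have h1 : 2 ≤ (e.1 i).card := (leafAdj_boundary_iff e (.inr i) Sum.inr_ne_inl).2 he
    obtain ⟨c, hc, hec⟩ := e.2.1
    refine ⟨⟨c, hc, h1.trans (Finset.card_le_card ?_)⟩⟩
    rw [hec]
    exact Finset.erase_subset _ _

/-- The lowest cell on the leg `r` is unique because the leaf `i` has only one position in the tree
of side `r`. A pseudoline has no terminal label: on its leg `r` the two boundary lines other than
`r` are never passed. -/
theorem isSpider_inner (i : Fin m) :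
    IsSpider (fun c : {c // IsTreeNode M (.inr i) c} => faces (.inr i) c.1) (.inr i) Sum.inl := by
  have hm : 0 < m := i.pos
  constructor
  · rintro ⟨c, hc⟩ (b | j)
    · simp
    · exact hM.nonempty hc.1 j
  · exact fun c => exists_compl_subset c.2.2
  · exact fun c r _ => rfl
  · exact Sum.inl_injective
  · rintro ⟨c, hc⟩ r hr
    obtain ⟨j, hj⟩ := hM.exists_mem_ne hm hc.1 r
    exact ⟨.inr j, hj⟩
  · rintro ⟨c, hc⟩ r hr
    by_cases h : ∃ j, c j = {r}
    · obtain ⟨j, hj⟩ := h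
      obtain ⟨d, hd, h1, h2⟩ := hM.exists_below hc.1 hr hj
      refine Or.inl ⟨⟨d, hd, two_le_card_of_compl_subset h1.ge⟩, h1, ?_⟩
      rintro (b | k)
      · exact topFace_singleton_eq_botFace
      · exact h2 k
    · push Not at h
      right
      rintro (b | k) hk
      · rw [faces_inr_inl] at hk
        rw [Finset.singleton_inj.1 hk]
      · exact absurd hk (h k)
  · rintro ⟨c, hc⟩ r hr
    left
    obtain ⟨d, hd, h⟩ := hM.exists_above hc.1 hr
    have h1 : {r}ᶜ ⊆ d i := by
      apply compl_subset_of_topFace_eq_botFace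
      rw [← h i, show c i = {r}ᶜ from hr]
    refine ⟨⟨d, hd, two_le_card_of_compl_subset h1⟩, ?_⟩
    rintro (b | k)
    · exact topFace_singleton_eq_botFace
    · exact h k
  · rintro ⟨c, hc⟩ ⟨d, hd⟩ r hr hr' h
    exact Subtype.ext (hM.eq_of_botFace_eq hc.1 hd.1 hr fun j => h (.inr j))
  · rintro ⟨c, hc⟩ ⟨d, hd⟩ r hr hr' h h'
    have hne : ∀ {c : MixedCell m}, (∀ k, faces (.inr i) c k = {r} → k = .inl r) → ∀ j, c j ≠ {r} :=
      fun h j hj => absurd (h (.inr j) hj) Sum.inr_ne_inl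
    have hedge : ∀ {c : MixedCell m}, c ∈ M → {r}ᶜ ⊆ c i → (∀ j, c j ≠ {r}) →
        ∃ he : IsTreeNode M (.inl r) (fun j => (c j).erase r),
          Attached (fun e : {e // IsTreeNode M (.inl r) e} => faces (.inl r) e.1) (.inl r) Sum.inl
            ⟨_, he⟩ (.inr i) := by
      intro c hc hr h
      have hi : 2 ≤ ((c i).erase r).card := two_le_card_erase_iff.2 hr
      have he : IsTreeNode M (.inl r) (fun j => (c j).erase r) :=
        ⟨⟨c, hc, fun _ => rfl⟩, fun j => (erase_nonempty_iff (hM.nonempty hc j)).2 (h j), i, hi⟩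
      exact ⟨he, (leafAdj_boundary_iff ⟨_, he⟩ (.inr i) Sum.inr_ne_inl).1 hi⟩
    obtain ⟨he, ha⟩ := hedge hc.1 hr (hne h)
    obtain ⟨he', ha'⟩ := hedge hd.1 hr' (hne h')
    have := hM.nonempty_treeNode hm (.inl r)
    have heq := congrArg Subtype.val
      ((hM.isSpider_boundary r).attached_unique Sum.inr_ne_inl ha ha')
    refine Subtype.ext (hM.eq_of_botFace_eq hc.1 hd.1 hr fun j => ?_)
    rw [botFace_of_ne (hne h j), botFace_of_ne (hne h' j)]
    exact congrFun heq j
  · rintro ⟨c, hc⟩ r κ hκ hr h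
    obtain ⟨p, q, hpq, hpr, hqr⟩ := Fin.exists_ne_ne r
    have key : ∀ p, p ≠ r → κ = .inl p := by
      intro p hp
      by_contra hne
      have := (h (.inl p) Sum.inl_ne_inr).2 (Ne.symm hne)
      rw [faces_inr_inl, Finset.mem_singleton] at this
      exact hp this.symm
    exact absurd (Sum.inl_injective ((key p hpr).symm.trans (key q hqr))) hpq

omit hM in
theorem nodeAdj_inner_iff {i : Fin m} (c d : {c // IsTreeNode M (.inr i) c}) :
    NodeAdj (.inr i) c.1 d.1 ↔
      NodesAdj (fun c : {c // IsTreeNode M (.inr i) c} => faces (.inr i) c.1) (.inr i) c d := by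
  constructor
  · rintro ⟨h1, h2⟩
    refine ⟨?_, h2⟩
    rintro (b | j)
    · simp
    · exact h1 j
  · exact fun h => ⟨fun j => h.1 (.inr j), h.2⟩

theorem leafAdj_inner_iff {i : Fin m} (c : {c // IsTreeNode M (.inr i) c}) (k : TreeLabel m) :
    LeafAdj (.inr i) c.1 k ↔
      Attached (fun c : {c // IsTreeNode M (.inr i) c} => faces (.inr i) c.1) (.inr i) Sum.inl c k := by
  have hterm : ¬ ∃ r, faces (.inr i) c.1 (.inr i) = {r}ᶜ ∧
      ∀ k', k' ≠ .inr i → (r ∈ faces (.inr i) c.1 k' ↔ k' ≠ k) := by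
    rintro ⟨r, hr, h⟩
    obtain ⟨p, q, hpq, hpr, hqr⟩ := Fin.exists_ne_ne r
    have key : ∀ p, p ≠ r → k = .inl p := by
      intro p hp
      by_contra hne
      have := (h (.inl p) Sum.inl_ne_inr).2 (Ne.symm hne)
      rw [faces_inr_inl, Finset.mem_singleton] at this
      exact hp this.symm
    exact absurd (Sum.inl_injective ((key p hpr).symm.trans (key q hqr))) hpq
  obtain ⟨c, hc⟩ := c
  unfold Attached
  rw [or_iff_left (b := ∃ r, _ ∧ _) hterm]
  rcases k with b | j
  · have hcard : ¬ 2 ≤ (faces (.inr i) c (.inl b)).card := by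
      rw [faces_inr_inl]; simp
    simp only [hcard, false_and, false_or]
    constructor
    · rintro ⟨h1, h2⟩
      refine ⟨b, rfl, two_le_card_erase_iff.1 h2, ?_⟩
      rintro (b' | j) hk
      · rw [Finset.singleton_inj.1 hk]
      · exact absurd hk ((erase_nonempty_iff (hM.nonempty hc.1 j)).1 (h1 j))
    · rintro ⟨r, h, h1, h2⟩
      obtain rfl := Sum.inl_injective h
      exact ⟨fun j => (erase_nonempty_iff (hM.nonempty hc.1 j)).2
        fun hj => absurd (h2 (.inr j) hj) Sum.inr_ne_inl, two_le_card_erase_iff.2 h1⟩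
  · constructor
    · rintro ⟨-, h⟩
      exact Or.inl h
    · rintro (h | ⟨r, h, -⟩)
      · exact ⟨hc.2, h⟩
      · exact absurd h Sum.inr_ne_inl

theorem exists_isRootedSpider (hm : 0 < m) (ℓ : TreeLabel m) :
    ∃ ρ par ht, IsRootedSpider (fun c : {c // IsTreeNode M ℓ c} => faces ℓ c.1) ℓ Sum.inl
      (fun c c' => NodeAdj ℓ c.1 c'.1) (fun c k => LeafAdj ℓ c.1 k) ρ par ht := by
  have := hM.nonempty_treeNode hm ℓ
  rcases ℓ with a | i
  · exact (hM.isSpider_boundary a).exists_isRootedSpider nodeAdj_boundary_iff leafAdj_boundary_iff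
  · exact (hM.isSpider_inner i).exists_isRootedSpider nodeAdj_inner_iff
      fun c k _ => hM.leafAdj_inner_iff c k

theorem isTreeWithLeaves_mixedTree (hm : 0 < m) (ℓ : TreeLabel m) :
    (mixedTree M ℓ).IsTreeWithLeaves {k | k ≠ ℓ} := by
  obtain ⟨ρ, par, ht, h⟩ := hM.exists_isRootedSpider hm ℓ
  have := hM.nonempty_treeNode hm ℓ
  rw [mixedTree_eq]
  exact h.isTreeWithLeaves

end IsMixedSubdivision

open MixedCell IsSpider

/-! ### Refinements of mixed subdivisions -/

namespace IsMixedSubdivision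

variable {m : ℕ} {M M' : Finset (MixedCell m)} (hM : IsMixedSubdivision M)

include hM

omit hM in
theorem exists_node_of_refines (h : MixedRefines M' M) (ℓ : TreeLabel m)
    (c : {c // IsTreeNode M' ℓ c}) : ∃ d : {c // IsTreeNode M ℓ c}, ∀ j, c.1 j ⊆ d.1 j := by
  rcases ℓ with a | i
  · obtain ⟨e, ⟨c, hc, hec⟩, h1, k, h2⟩ := c
    obtain ⟨d, hd, hsub⟩ := h c hc
    have hsub' : ∀ j, e j ⊆ (d j).erase a := fun j => by
      rw [hec]; exact Finset.erase_subset_erase _ (hsub j)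
    exact ⟨⟨fun j => (d j).erase a, ⟨d, hd, fun _ => rfl⟩, fun j => (h1 j).mono (hsub' j), k,
      h2.trans (Finset.card_le_card (hsub' k))⟩, hsub'⟩
  · obtain ⟨c, hc, h2⟩ := c
    obtain ⟨d, hd, hsub⟩ := h c hc
    exact ⟨⟨d, hd, h2.trans (Finset.card_le_card (hsub i))⟩, hsub⟩

theorem isContractionOf_mixedTree (hM' : IsMixedSubdivision M') (h : MixedRefines M' M)
    (hm : 0 < m) (ℓ : TreeLabel m) : (mixedTree M ℓ).IsContractionOf (mixedTree M' ℓ) := by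
  obtain ⟨ρ, par, ht, h1⟩ := hM.exists_isRootedSpider hm ℓ
  obtain ⟨ρ', par', ht', h1'⟩ := hM'.exists_isRootedSpider hm ℓ
  have := hM.nonempty_treeNode hm ℓ
  have := hM'.nonempty_treeNode hm ℓ
  rw [mixedTree_eq, mixedTree_eq]
  choose f hf using exists_node_of_refines h ℓ
  refine h1.isContractionOf h1' f ?_ ?_
  · rintro c (b | j)
    · exact subset_rfl
    · exact hf c j
  -- The terminal label of a boundary line is a boundary label, and its position is the same at all
  -- edges. A pseudoline has no terminal cell.
  · rcases ℓ with a | i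
    · intro c r κ hκ hr hk
      obtain ⟨h2, h3⟩ := h1'.isSpider.one_leg c r κ hκ hr hk c
      refine ⟨h2, ?_⟩
      rcases κ with b | j
      · exact h3
      · have := (hk (.inl (a + 1)) fun h => Fin.add_one_ne a (Sum.inl_injective h)).2 Sum.inl_ne_inr
        simp only [faces_inl_of_ne (Fin.add_one_ne a), Finset.mem_singleton] at this
        simp only [faces_inl_self] at h2
        have h4 := compl_singleton_injective h2
        exact absurd (h4.trans this) (Fin.add_two_ne_add_one a)
    · intro c r κ hκ hr hk
      obtain ⟨p, hp⟩ : ∃ p, p ≠ r ∧ (.inl p : TreeLabel m) ≠ κ := by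
        obtain ⟨p, q, hpq, hpr, hqr⟩ := Fin.exists_ne_ne r
        by_cases h : (.inl p : TreeLabel m) = κ
        · exact ⟨q, hqr, fun h' => hpq (Sum.inl_injective (h.trans h'.symm))⟩
        · exact ⟨p, hpr, h⟩
      have := (hk (.inl p) Sum.inl_ne_inr).2 hp.2
      rw [faces_inr_inl, Finset.mem_singleton] at this
      exact absurd this.symm hp.1

end IsMixedSubdivision

/-! ### The quartets of the trees -/

namespace MixedCell

variable {m : ℕ} {M : Finset (MixedCell m)} {a b r : Fin 3} {i j : Fin m} {c e : MixedCell m}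

/-- The positions of the lines at the corner `b`. -/
def cornerFaces (b : Fin 3) : TreeLabel m → Finset (Fin 3)
  | .inr _ => {b}
  | .inl a => if a = b then {b} else {a + 2}ᶜ

/-- The positions of the lines at the cells, beyond the boundary edges and at the corners. -/
def positions (M : Finset (MixedCell m)) : Set (TreeLabel m → Finset (Fin 3)) :=
  {N | (∃ i, ∃ c ∈ M, N = faces (.inr i) c) ∨ (∃ a e, IsBoundaryEdge M a e ∧ N = faces (.inl a) e) ∨
    ∃ b, N = cornerFaces b}

@[simp] theorem cornerFaces_inr : cornerFaces b (.inr j) = {b} := rfl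

@[simp] theorem cornerFaces_inl_self : cornerFaces (m := m) b (.inl b) = {b} := if_pos rfl

theorem cornerFaces_inl_of_ne (h : a ≠ b) : cornerFaces (m := m) b (.inl a) = {a + 2}ᶜ := if_neg h

theorem faces_mem_positions (i : Fin m) (hc : c ∈ M) : faces (.inr i) c ∈ positions M :=
  Or.inl ⟨i, c, hc, rfl⟩

theorem boundary_mem_positions (he : IsBoundaryEdge M a e) : faces (.inl a) e ∈ positions M :=
  Or.inr (Or.inl ⟨a, e, he, rfl⟩)

theorem corner_mem_positions (b : Fin 3) : cornerFaces b ∈ positions M :=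
  Or.inr (Or.inr ⟨b, rfl⟩)

end MixedCell

theorem Fin.add_two_add_one (a : Fin 3) : a + 2 + 1 = a := by
  revert a; decide

theorem singleton_ne_compl {b r : Fin 3} : ({b} : Finset (Fin 3)) ≠ {r}ᶜ := by
  revert b r; decide

theorem not_compl_subset_singleton {b r : Fin 3} : ¬ ({r}ᶜ : Finset (Fin 3)) ⊆ {b} := by
  revert b r; decide

theorem eq_compl_of_two_le {a : Fin 3} {X : Finset (Fin 3)} (h : 2 ≤ X.card) (ha : a ∉ X) :
    X = {a}ᶜ := by
  revert a X; decide

theorem botFace_corner {b : Fin 3} : botFace (b + 2) ({b}ᶜ : Finset (Fin 3)) = {b + 1} := by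
  revert b; decide

theorem topFace_corner {b : Fin 3} : topFace (b + 2) ({b + 1}ᶜ : Finset (Fin 3)) = {b + 2} := by
  revert b; decide

theorem botFace_eq_of_ne {a : Fin 3} {X : Finset (Fin 3)} (ha : a ∉ X) (hX : X.Nonempty)
    (h : X ≠ {a + 2}) : botFace (a + 2) X = {a + 1} := by
  revert a X; decide

theorem Fin.add_one_add_two (a : Fin 3) : a + 1 + 2 = a := by
  revert a; decide

theorem Fin.add_two_add_two (a : Fin 3) : a + 2 + 2 = a + 1 := by
  revert a; decide

namespace MixedCell

variable {m : ℕ} {M : Finset (MixedCell m)} {a b r : Fin 3} {i : Fin m} {l : TreeLabel m}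
  {c e : MixedCell m}

theorem leg_cell (h : {r}ᶜ ⊆ faces (.inr i) c l) : ∃ j, l = .inr j ∧ {r}ᶜ ⊆ c j := by
  rcases l with b | j
  · exact absurd h not_compl_subset_singleton
  · exact ⟨j, rfl, h⟩

theorem leg_boundary (he : IsBoundaryEdge M a e) (h : {r}ᶜ ⊆ faces (.inl a) e l) :
    (l = .inl a ∧ r = a + 2) ∨ ∃ j, l = .inr j ∧ r = a ∧ e j = {r}ᶜ := by
  rcases l with b | j
  · left
    by_cases hb : b = a
    · subst hb
      rw [faces_inl_self] at h
      exact ⟨rfl, eq_of_compl_subset_compl h⟩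
    · rw [faces_inl_of_ne hb] at h
      exact absurd h not_compl_subset_singleton
  · right
    have h1 : {r}ᶜ ⊆ e j := h
    obtain rfl : r = a := by
      by_contra hne
      exact he.notMem j (h1 (by simpa using Ne.symm hne))
    exact ⟨j, rfl, rfl, eq_compl_of_two_le (two_le_card_of_compl_subset h1) (he.notMem j)⟩

theorem leg_corner (h : {r}ᶜ ⊆ cornerFaces b l) :
    (l = .inl (b + 1) ∧ b = r) ∨ (l = .inl (b + 2) ∧ r = b + 1) := by
  rcases l with a | j
  · by_cases ha : a = b
    · subst ha
      rw [cornerFaces_inl_self] at h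
      exact absurd h not_compl_subset_singleton
    · rw [cornerFaces_inl_of_ne ha] at h
      have h1 := eq_of_compl_subset_compl h
      rcases Fin.eq_add_of_ne ha with rfl | rfl
      · rw [Fin.add_one_add_two] at h1
        exact Or.inl ⟨rfl, h1.symm⟩
      · rw [Fin.add_two_add_two] at h1
        exact Or.inr ⟨rfl, h1⟩
  · exact absurd h not_compl_subset_singleton

end MixedCell

namespace IsMixedSubdivision

variable {m : ℕ} {M : Finset (MixedCell m)} (hM : IsMixedSubdivision M)

include hM

theorem nonempty_of_mem_positions {N : TreeLabel m → Finset (Fin 3)}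
    (hN : N ∈ positions M) (k : TreeLabel m) : (N k).Nonempty := by
  have hcompl : ∀ a : Fin 3, ({a}ᶜ : Finset (Fin 3)).Nonempty := by decide
  rcases hN with ⟨i, c, hc, rfl⟩ | ⟨a, e, he, rfl⟩ | ⟨b, rfl⟩ <;> rcases k with a' | j
  · simp
  · exact hM.nonempty hc j
  · unfold faces
    dsimp only
    split_ifs
    · exact hcompl _
    · simp
  · exact he.nonempty j
  · unfold cornerFaces
    dsimp only
    split_ifs
    · simp
    · exact hcompl _
  · simp

/-- The added positions continue the walks that would leave the triangle. Below its lowest cell a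
pseudoline crosses a boundary line; the boundary line `a` runs from the corner `a + 1` to the corner
`a + 2` and crosses the other two boundary lines at these corners. -/
theorem isTraversable_positions (hm : 0 < m) : IsTraversable (positions M) := by
  have step : ∀ {a : Fin 3} {e e' : MixedCell m}, (∀ j, topFace (a + 2) (e j) = botFace (a + 2) (e' j)) →
      ∀ k, topFace (a + 2) (faces (.inl a) e k) = botFace (a + 2) (faces (.inl a) e' k) := by
    rintro a e e' h (b | j)
    · by_cases hb : b = a
      · subst hb
        rw [faces_inl_self, faces_inl_self, topFace_compl_eq_botFace]
      · rw [faces_inl_of_ne hb, faces_inl_of_ne hb, topFace_singleton_eq_botFace]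
    · exact h j
  -- the last and the first edge on a side
  have last : ∀ a, ∃ e, IsBoundaryEdge M a e ∧ ∀ j, a + 2 ∈ e j := by
    intro a
    -- The edge over the last unit segment has `hi` equal to `m`, which means that all summands
    -- contain `a + 2`.
    obtain ⟨e, he, -, h⟩ := hM.exists_edge (Fin.add_two_ne_add_one a) (Fin.add_two_ne a)
      (Fin.add_one_ne a) (t := m - 1) (by omega)
    refine ⟨e, he, fun j => ?_⟩
    by_contra hj
    have h1 : hi e (a + 2) < (Finset.univ : Finset (Fin m)).card := Finset.card_lt_card
      ⟨Finset.filter_subset _ _, fun h => hj (Finset.mem_filter.1 (h (Finset.mem_univ j))).2⟩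
    simp only [Finset.card_univ, Fintype.card_fin] at h1
    omega
  have first : ∀ a, ∃ e, IsBoundaryEdge M a e ∧ ∀ j, e j ≠ {a + 2} := by
    intro a
    obtain ⟨e, he, h, -⟩ := hM.exists_edge (Fin.add_two_ne_add_one a) (Fin.add_two_ne a)
      (Fin.add_one_ne a) hm
    refine ⟨e, he, fun j hj => ?_⟩
    have : 0 < lo e (a + 2) := Finset.card_pos.2 ⟨j, by simp [hj]⟩
    omega
  -- the corners at the ends of a side
  have atLast : ∀ {a : Fin 3} {e : MixedCell m}, (∀ j, a + 2 ∈ e j) → ∀ k,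
      topFace (a + 2) (faces (.inl a) e k) = botFace (a + 2) (cornerFaces (a + 2) k) := by
    rintro a e h (b | j)
    · by_cases hb : b = a
      · subst hb
        rw [faces_inl_self, cornerFaces_inl_of_ne (Fin.add_two_ne b).symm, topFace_compl_eq_botFace]
      · rw [faces_inl_of_ne hb]
        rcases Fin.eq_add_of_ne hb with rfl | rfl
        · rw [cornerFaces_inl_of_ne (Fin.add_two_ne_add_one a).symm, Fin.add_one_add_two,
            botFace_corner, topFace_of_notMem]
          simp
        · rw [cornerFaces_inl_self, topFace_singleton_eq_botFace]
    · rw [faces_inr, cornerFaces_inr, topFace_of_mem (h j), botFace_singleton]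
  have atFirst : ∀ {a : Fin 3} {e : MixedCell m}, IsBoundaryEdge M a e → (∀ j, e j ≠ {a + 2}) → ∀ k,
      topFace (a + 2) (cornerFaces (a + 1) k) = botFace (a + 2) (faces (.inl a) e k) := by
    rintro a e he h (b | j)
    · by_cases hb : b = a
      · subst hb
        rw [faces_inl_self, cornerFaces_inl_of_ne (Fin.add_one_ne b).symm, topFace_compl_eq_botFace]
      · rw [faces_inl_of_ne hb]
        rcases Fin.eq_add_of_ne hb with rfl | rfl
        · rw [cornerFaces_inl_self, topFace_singleton_eq_botFace]
        · rw [cornerFaces_inl_of_ne (Fin.add_two_ne_add_one a), Fin.add_two_add_two, topFace_corner,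
            botFace_singleton]
    · rw [faces_inr, cornerFaces_inr, botFace_eq_of_ne (he.notMem j) (he.nonempty j) (h j),
        topFace_of_notMem]
      simp
  have toSide : ∀ {r : Fin 3} {c : MixedCell m} (i : Fin m), c ∈ M → (∀ j, c j ≠ {r}) → ∀ k,
      topFace r (faces (.inl r) (fun j => (c j).erase r) k) = botFace r (faces (.inr i) c k) := by
    rintro r c i hc h (b | j)
    · rw [faces_inr_inl]
      by_cases hb : b = r
      · subst hb
        rw [faces_inl_self, botFace_singleton, topFace_of_mem]
        simp
      · rw [faces_inl_of_ne hb, topFace_singleton_eq_botFace]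
    · rw [faces_inr, faces_inr, botFace_of_ne (h j), topFace_of_notMem (by simp)]
  constructor
  · rintro N (⟨i, c, hc, rfl⟩ | ⟨a, e, he, rfl⟩ | ⟨b, rfl⟩) l r hl
    · obtain ⟨j, hj⟩ := hM.exists_mem_ne hm hc r
      exact ⟨.inr j, hj⟩
    · rcases leg_boundary he hl.ge with ⟨rfl, rfl⟩ | ⟨j, rfl, rfl, hj⟩
      · obtain ⟨j, hj⟩ := he.exists_mem_ne (Fin.add_two_ne a)
        exact ⟨.inr j, hj⟩
      · refine ⟨.inl r, ?_, ?_⟩ <;> rw [faces_inl_self]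
        · simp
        · exact singleton_ne_compl.symm
    · rcases leg_corner hl.ge with ⟨rfl, rfl⟩ | ⟨rfl, rfl⟩
      · refine ⟨.inl (b + 2), ?_, ?_⟩ <;> rw [cornerFaces_inl_of_ne (Fin.add_two_ne b)]
        · simp [Fin.add_two_add_two]
        · exact singleton_ne_compl.symm
      · refine ⟨.inl (b + 1), ?_, ?_⟩ <;>
          rw [cornerFaces_inl_of_ne (Fin.add_one_ne b), Fin.add_one_add_two]
        · simp
        · exact singleton_ne_compl.symm
  · rintro N (⟨i, c, hc, rfl⟩ | ⟨a, e, he, rfl⟩ | ⟨b, rfl⟩) l r hl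
    · obtain ⟨j, rfl, hj⟩ := leg_cell hl.ge
      obtain ⟨d, hd, h⟩ := hM.exists_above hc (show c j = {r}ᶜ from hl)
      refine Or.inl ⟨_, faces_mem_positions i hd, ?_⟩
      rintro (b | k)
      · exact topFace_singleton_eq_botFace
      · exact h k
    · rcases leg_boundary he hl.ge with ⟨rfl, rfl⟩ | ⟨j, rfl, rfl, hj⟩
      · left
        by_cases h : ∃ j, a + 2 ∉ e j
        · obtain ⟨j, hj⟩ := h
          obtain ⟨e', he', h⟩ := hM.exists_next_edge (Fin.add_two_ne_add_one a) (Fin.add_two_ne a)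
            (Fin.add_one_ne a) he hj
          exact ⟨_, boundary_mem_positions he', step h⟩
        · push Not at h
          exact ⟨_, corner_mem_positions _, atLast h⟩
      · left
        obtain ⟨⟨c, hc, hec⟩, hne, -⟩ := he
        obtain rfl : e = fun j => (c j).erase r := funext hec
        exact ⟨_, faces_mem_positions j hc, toSide j hc fun k =>
          (erase_nonempty_iff (hM.nonempty hc k)).1 (hne k)⟩
    · rcases leg_corner hl.ge with ⟨rfl, rfl⟩ | ⟨rfl, rfl⟩
      · right
        rintro (a | k) hk
        · by_cases ha : a = b
          · subst ha; simp
          rcases Fin.eq_add_of_ne ha with rfl | rfl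
          · exact absurd rfl hk
          · rw [cornerFaces_inl_of_ne ha, Fin.add_two_add_two]
            simp
        · simp
      · left
        obtain ⟨e, he, h⟩ := first (b + 2)
        refine ⟨_, boundary_mem_positions he, ?_⟩
        have := atFirst he h
        simpa only [Fin.add_two_add_one, Fin.add_two_add_two] using this
  · rintro N (⟨i, c, hc, rfl⟩ | ⟨a, e, he, rfl⟩ | ⟨b, rfl⟩) l r hl
    · obtain ⟨j, rfl, hj⟩ := leg_cell hl
      left
      by_cases h : ∃ k, c k = {r}
      · obtain ⟨k, hk⟩ := h
        obtain ⟨d, hd, h1, h2⟩ := hM.exists_below hc hj hk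
        refine ⟨_, faces_mem_positions i hd, h1, ?_⟩
        rintro (b | k)
        · exact topFace_singleton_eq_botFace
        · exact h2 k
      · push Not at h
        have h1 : ((c j).erase r) = {r}ᶜ :=
          eq_compl_of_two_le (two_le_card_erase_iff.2 hj) (by simp)
        exact ⟨_, boundary_mem_positions ⟨⟨c, hc, fun _ => rfl⟩,
          fun k => (erase_nonempty_iff (hM.nonempty hc k)).2 (h k), j, two_le_card_erase_iff.2 hj⟩,
          h1, toSide i hc h⟩
    · rcases leg_boundary he hl with ⟨rfl, rfl⟩ | ⟨j, rfl, rfl, hj⟩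
      · left
        by_cases h : ∃ j, e j = {a + 2}
        · obtain ⟨j, hj⟩ := h
          obtain ⟨e', he', h⟩ := hM.exists_previous_edge (Fin.add_two_ne_add_one a)
            (Fin.add_two_ne a) (Fin.add_one_ne a) he hj
          exact ⟨_, boundary_mem_positions he', faces_inl_self, step h⟩
        · push Not at h
          exact ⟨_, corner_mem_positions _, cornerFaces_inl_of_ne (Fin.add_one_ne a).symm,
            atFirst he h⟩
      · right
        rintro (b | k) hk
        · by_cases hb : b = r
          · subst hb
            rw [faces_inl_self] at hk
            exact singleton_ne_compl hk.symm
          · rw [faces_inl_of_ne hb] at hk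
            exact hb (Finset.singleton_inj.1 hk)
        · exact he.notMem k (by rw [show e k = {r} from hk]; simp)
    · rcases leg_corner hl with ⟨rfl, rfl⟩ | ⟨rfl, rfl⟩
      · left
        obtain ⟨e, he, h⟩ := last (b + 1)
        refine ⟨_, boundary_mem_positions he, by rw [faces_inl_self, Fin.add_one_add_two], ?_⟩
        have := atLast h
        simpa only [Fin.add_one_add_two] using this
      · right
        rintro (a | k) hk
        · by_cases ha : a = b
          · subst ha
            rw [cornerFaces_inl_self] at hk
            exact Fin.add_one_ne a (Finset.singleton_inj.1 hk).symm
          · rw [cornerFaces_inl_of_ne ha] at hk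
            exact singleton_ne_compl hk.symm
        · rw [cornerFaces_inr] at hk
          exact Fin.add_one_ne b (Finset.singleton_inj.1 hk).symm

/-- A tree of the subdivision displays the quartets that are separated by the positions. -/
theorem displays_mixedTree_iff (hm : 0 < m) {ℓ a b c d : TreeLabel m} (hab : a ≠ b) (hcd : c ≠ d)
    (ha : a ≠ ℓ) (hb : b ≠ ℓ) (hc : c ≠ ℓ) (hd : d ≠ ℓ) :
    (mixedTree M ℓ).Displays a b c d ↔ LegDisplays (positions M) ℓ a b c d := by
  obtain ⟨ρ, par, ht, h⟩ := hM.exists_isRootedSpider hm ℓ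
  have := hM.nonempty_treeNode hm ℓ
  rw [mixedTree_eq, h.displays_iff hab hcd ha hb hc hd]
  constructor
  · rintro ⟨n, r, hr, -, hs⟩
    refine ⟨_, ?_, r, hr, hs⟩
    rcases ℓ with x | i
    · exact boundary_mem_positions n.2
    · exact faces_mem_positions i n.2.1
  · -- a node that separates two pairs of labels is not the last one
    have key : ∀ (n : {c // IsTreeNode M ℓ c}) r, faces ℓ n.1 ℓ = {r}ᶜ →
        ((r ∈ faces ℓ n.1 a ∧ r ∈ faces ℓ n.1 b ∧ r ∉ faces ℓ n.1 c ∧ r ∉ faces ℓ n.1 d) ∨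
          (r ∈ faces ℓ n.1 c ∧ r ∈ faces ℓ n.1 d ∧ r ∉ faces ℓ n.1 a ∧ r ∉ faces ℓ n.1 b)) →
        ∃ n', Up (fun c : {c // IsTreeNode M ℓ c} => faces ℓ c.1) ℓ n n' := by
      intro n r hr hs
      rcases h.isSpider.up n r hr with ⟨n', hn'⟩ | ⟨κ, hκ, ht⟩
      · exact ⟨n', r, hr, hn'⟩
      · have hnot : ∀ k, k ≠ ℓ → r ∉ faces ℓ n.1 k → k = κ := fun k hk h1 => by
          by_contra hne
          exact h1 ((ht k hk).2 hne)
        rcases hs with ⟨-, -, h1, h2⟩ | ⟨-, -, h1, h2⟩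
        · exact absurd ((hnot c hc h1).trans (hnot d hd h2).symm) hcd
        · exact absurd ((hnot a ha h1).trans (hnot b hb h2).symm) hab
    have one : ∀ {N : TreeLabel m → Finset (Fin 3)} {r κ}, (∀ k, r ∈ N k → k = κ) →
        ¬ ((r ∈ N a ∧ r ∈ N b ∧ r ∉ N c ∧ r ∉ N d) ∨ (r ∈ N c ∧ r ∈ N d ∧ r ∉ N a ∧ r ∉ N b)) := by
      rintro N r κ h (⟨h1, h2, -⟩ | ⟨h1, h2, -⟩)
      · exact hab ((h a h1).trans (h b h2).symm)
      · exact hcd ((h c h1).trans (h d h2).symm)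
    rintro ⟨N, hN, r, hr, hs⟩
    rcases hN with ⟨i, x, hx, rfl⟩ | ⟨y, e, he, rfl⟩ | ⟨z, rfl⟩
    · obtain ⟨j, rfl, hj⟩ := leg_cell hr.ge
      exact ⟨⟨x, hx, two_le_card_of_compl_subset hj⟩, r, hr,
        key ⟨x, hx, two_le_card_of_compl_subset hj⟩ r hr hs, hs⟩
    · rcases leg_boundary he hr.ge with ⟨rfl, rfl⟩ | ⟨j, rfl, rfl, hj⟩
      · exact ⟨⟨e, he⟩, y + 2, hr, key ⟨e, he⟩ _ hr hs, hs⟩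
      -- Where a pseudoline leaves through side `r`, only the boundary line `r` is on the passed
      -- side, so no two pairs are separated.
      · refine absurd hs (one (κ := .inl r) ?_)
        rintro (x | k) hk
        · by_cases hx : x = r
          · rw [hx]
          · rw [faces_inl_of_ne hx, Finset.mem_singleton] at hk
            exact absurd hk.symm hx
        · exact absurd hk (he.notMem k)
    -- At a corner the passed side consists of all other labels or of a single label, so again no
    -- two pairs are separated.
    · rcases leg_corner hr.ge with ⟨rfl, rfl⟩ | ⟨rfl, rfl⟩
      · have hall : ∀ k : TreeLabel m, k ≠ .inl (z + 1) → z ∈ cornerFaces z k := by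
          rintro (x | k) hk
          · by_cases hx : x = z
            · subst hx; simp
            rcases Fin.eq_add_of_ne hx with rfl | rfl
            · exact absurd rfl hk
            · rw [cornerFaces_inl_of_ne hx, Fin.add_two_add_two]
              simp
          · simp
        rcases hs with ⟨-, -, h1, -⟩ | ⟨-, -, h1, -⟩
        · exact absurd (hall _ hc) h1
        · exact absurd (hall _ ha) h1
      · have hall : ∀ k : TreeLabel m, k ≠ .inl (z + 2) → z + 1 ∈ cornerFaces z k → k = .inl (z + 1) := by
          rintro (x | k) hk hk'
          · by_cases hx : x = z
            · subst hx
              simp at hk'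
            rcases Fin.eq_add_of_ne hx with rfl | rfl
            · rfl
            · exact absurd rfl hk
          · simp at hk'
        rcases hs with ⟨h1, h2, -⟩ | ⟨h1, h2, -⟩
        · exact absurd ((hall _ ha h1).trans (hall _ hb h2).symm) hab
        · exact absurd ((hall _ hc h1).trans (hall _ hd h2).symm) hcd

theorem quartetsCompatible_mixedTree (hm : 0 < m) :
    QuartetsCompatible (Finset.univ : Finset (TreeLabel m)) (mixedTree M) := by
  constructor
  · intro ℓ _
    ext k
    simp [mixedTree]
  · intro ℓ _ a b c d
    obtain ⟨ρ, par, ht, h⟩ := hM.exists_isRootedSpider hm ℓ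
    rw [mixedTree_eq]
    exact IsRootedTree.not_displays_of_displays (T := nodeTree ℓ _ _) h.rooted
  · intro i a b c d _ _ _ _ _ hn hdisp
    simp only [List.nodup_cons, List.mem_cons, not_or, List.not_mem_nil, or_false,
      not_false_eq_true, and_true, List.nodup_nil] at hn
    obtain ⟨⟨hia, hib, hic, hid⟩, ⟨hab, hac, had⟩, ⟨hbc, hbd⟩, hcd⟩ := hn
    rw [hM.displays_mixedTree_iff hm hab hcd (Ne.symm hia) (Ne.symm hib) (Ne.symm hic)
      (Ne.symm hid)] at hdisp
    rw [hM.displays_mixedTree_iff hm hab (Ne.symm hid) hac hbc (Ne.symm hcd) hic,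
      hM.displays_mixedTree_iff hm hcd (Ne.symm hib) (Ne.symm hac) (Ne.symm had) (Ne.symm hab) hia]
    exact (hM.isTraversable_positions hm).legDisplays_transfer
      (fun N hN k => hM.nonempty_of_mem_positions hN k) hdisp

theorem isAbstractTreeArrangement_mixedTree (hm : 0 < m) :
    IsAbstractTreeArrangement (Finset.univ : Finset (TreeLabel m)) (mixedTree M) := by
  have hcard : (Finset.univ : Finset (TreeLabel m)).card = m + 3 := by
    rw [Finset.card_univ, Fintype.card_sum, Fintype.card_fin, Fintype.card_fin, add_comm]
  refine ⟨by omega, fun ℓ _ => ?_, ?_⟩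
  · have : ((Finset.univ : Finset (TreeLabel m)) : Set (TreeLabel m)) \ {ℓ} = {k | k ≠ ℓ} := by
      ext k; simp
    rw [this]
    exact hM.isTreeWithLeaves_mixedTree hm ℓ
  -- For `m = 1` there are four trees and the condition is void.
  · rcases Nat.lt_or_ge m 2 with h | h
    · rw [show (Finset.univ : Finset (TreeLabel m)).card - 4 = 0 by omega]
      trivial
    · obtain ⟨k, rfl⟩ := Nat.exists_eq_add_of_le h
      rw [show (Finset.univ : Finset (TreeLabel (2 + k))).card - 4 = k + 1 by omega]
      exact (hM.quartetsCompatible_mixedTree hm).arrangementCondition k (by omega)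

end IsMixedSubdivision

/-! ### The Cayley trick -/

open MixedCell

section

variable {m : ℕ} {σ τ : Finset (Fin 3 × Fin m)}

theorem sum_smul_prodVertex (w : Fin 3 × Fin m → ℝ) :
    ∑ p, w p • prodVertex m p = (fun a => ∑ j, w (a, j), fun j => ∑ a, w (a, j)) := by
  ext a
  · simp only [prodVertex, Prod.fst_sum, Prod.smul_fst, Finset.sum_apply, Pi.smul_apply,
      smul_eq_mul, Fintype.sum_prod_type]
    rw [Finset.sum_eq_single a]
    · simp
    · intro b _ hb
      simp [hb.symm]
    · simp
  · simp only [prodVertex, Prod.snd_sum, Prod.smul_snd, Finset.sum_apply, Pi.smul_apply,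
      smul_eq_mul, Fintype.sum_prod_type_right]
    rw [Finset.sum_eq_single a]
    · simp
    · intro b _ hb
      simp [hb.symm]
    · simp

theorem mem_cellPolytope_iff {z : (Fin 3 → ℝ) × (Fin m → ℝ)} : z ∈ cellPolytope σ ↔
    ∃ w : Fin 3 × Fin m → ℝ, (∀ p, 0 ≤ w p) ∧ (∀ p, p ∉ σ → w p = 0) ∧ ∑ p, w p = 1 ∧
      ∑ p, w p • prodVertex m p = z :=
  mem_convexHull_image_iff _ _ _

theorem prodVertex_mem_cellPolytope {p : Fin 3 × Fin m} (hp : p ∈ σ) :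
    prodVertex m p ∈ cellPolytope σ :=
  subset_convexHull ℝ _ ⟨p, hp, rfl⟩

/-- A vertex of the product is extreme: its zero coordinates kill all weights except that of `p`.
Hence inclusion of cells is inclusion of their vertex sets. -/
theorem mem_of_prodVertex_mem {p : Fin 3 × Fin m} (hp : prodVertex m p ∈ cellPolytope σ) :
    p ∈ σ := by
  obtain ⟨w, h1, h2, h3, h4⟩ := mem_cellPolytope_iff.1 hp
  rw [sum_smul_prodVertex] at h4
  by_contra hpσ
  have hzero : ∀ q, w q = 0 := by
    rintro ⟨b, i⟩
    by_cases hb : b = p.1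
    · by_cases hi : i = p.2
      · apply h2
        rwa [hb, hi]
      · have := congrFun (congrArg Prod.snd h4) i
        simp only [prodVertex, Pi.single_apply, hi, if_false] at this
        exact (Finset.sum_eq_zero_iff_of_nonneg fun a _ => h1 (a, i)).1 this b (Finset.mem_univ b)
    · have := congrFun (congrArg Prod.fst h4) b
      simp only [prodVertex, Pi.single_apply, hb, if_false] at this
      exact (Finset.sum_eq_zero_iff_of_nonneg fun j _ => h1 (b, j)).1 this i (Finset.mem_univ i)
  simp [hzero] at h3

theorem subset_of_cellPolytope_subset (h : cellPolytope τ ⊆ cellPolytope σ) : τ ⊆ σ :=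
  fun _ hp => mem_of_prodVertex_mem (h (prodVertex_mem_cellPolytope hp))

theorem prodVertex_mem_simplexProduct (p : Fin 3 × Fin m) : prodVertex m p ∈ simplexProduct m :=
  ⟨single_mem_stdSimplex ℝ p.1, single_mem_stdSimplex ℝ p.2⟩

/-- The Minkowski cell of a cell of a subdivision of the product of simplices. -/
def cayleyCell (σ : Finset (Fin 3 × Fin m)) : MixedCell m :=
  fun j => Finset.univ.filter fun a => (a, j) ∈ σ

@[simp] theorem mem_cayleyCell {a : Fin 3} {j : Fin m} : a ∈ cayleyCell σ j ↔ (a, j) ∈ σ := by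
  simp [cayleyCell]

theorem mem_cayley {S : Finset (Finset (Fin 3 × Fin m))} {c : MixedCell m} :
    c ∈ cayley S ↔ ∃ σ ∈ S, cayleyCell σ = c :=
  Finset.mem_image

/-- The point of the slice of the product of simplices over the barycentre. -/
noncomputable def slicePoint (m : ℕ) (x : Fin 3 → ℝ) : (Fin 3 → ℝ) × (Fin m → ℝ) :=
  (fun a => (m : ℝ)⁻¹ * x a, fun _ => (m : ℝ)⁻¹)

theorem slicePoint_weights (hm : 0 < m) {x : Fin 3 → ℝ} {w : Fin 3 × Fin m → ℝ}
    (h1 : ∀ p, 0 ≤ w p) (h2 : ∀ p, p ∉ σ → w p = 0)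
    (h4 : ∑ p, w p • prodVertex m p = slicePoint m x) :
    IsWeight (cayleyCell σ) x fun j a => m * w (a, j) := by
  have hm' : (m : ℝ) ≠ 0 := by positivity
  rw [sum_smul_prodVertex] at h4
  refine ⟨fun j a => mul_nonneg (Nat.cast_nonneg m) (h1 _), fun j a ha => ?_, fun j => ?_,
    fun a => ?_⟩
  · rw [h2 _ (by simpa using ha), mul_zero]
  · have := congrFun (congrArg Prod.snd h4) j
    simp only [slicePoint] at this
    rw [← Finset.mul_sum, this, mul_inv_cancel₀ hm']
  · have := congrFun (congrArg Prod.fst h4) a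
    simp only [slicePoint] at this
    rw [← Finset.mul_sum, this, mul_inv_cancel_left₀ hm']

/-- Over the barycentre of the second factor each `j` carries total weight `1/m`. Multiplication by
`m` turns the weights into one convex combination for each summand. -/
theorem mem_polytope_cayleyCell_iff (hm : 0 < m) {x : Fin 3 → ℝ} :
    x ∈ (cayleyCell σ).polytope ↔ slicePoint m x ∈ cellPolytope σ := by
  have hm' : (m : ℝ) ≠ 0 := by positivity
  rw [mem_cellPolytope_iff, mem_polytope_iff]
  constructor
  · rintro ⟨W, hW⟩
    refine ⟨fun p => (m : ℝ)⁻¹ * W p.2 p.1, fun p => ?_, fun p hp => ?_, ?_, ?_⟩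
    · have := hW.nonneg p.2 p.1
      positivity
    · simp only
      rw [hW.supp p.2 p.1 (by simpa using hp), mul_zero]
    · rw [Fintype.sum_prod_type_right]
      simp only [← Finset.mul_sum, hW.sum_eq_one]
      simp [hm']
    · rw [sum_smul_prodVertex]
      simp only [← Finset.mul_sum, hW.sum_eq_one, hW.sum_eq, mul_one]
      rfl
  · rintro ⟨w, h1, h2, -, h4⟩
    exact ⟨_, slicePoint_weights hm h1 h2 h4⟩

theorem mem_dilatedTriangle_iff_slicePoint (hm : 0 < m) {x : Fin 3 → ℝ} :
    x ∈ dilatedTriangle m ↔ slicePoint m x ∈ simplexProduct m := by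
  have hm' : (0 : ℝ) < m := by exact_mod_cast hm
  have hinv : (0 : ℝ) < (m : ℝ)⁻¹ := by positivity
  rw [mem_dilatedTriangle_iff]
  constructor
  · rintro ⟨h1, h2⟩
    refine ⟨⟨fun a => mul_nonneg hinv.le (h1 a), ?_⟩, ⟨fun _ => hinv.le, ?_⟩⟩
    · simp only [slicePoint]
      rw [← Finset.mul_sum, h2, inv_mul_cancel₀ hm'.ne']
    · simp [slicePoint, hm'.ne']
  · rintro ⟨⟨h1, h2⟩, -⟩
    refine ⟨fun a => nonneg_of_mul_nonneg_right (h1 a) hinv, ?_⟩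
    simp only [slicePoint, ← Finset.mul_sum] at h2
    field_simp at h2
    exact h2

end

section

variable {m : ℕ} {σ τ : Finset (Fin 3 × Fin m)}

theorem cayleyCell_nonempty (h : affineSpan ℝ (cellPolytope σ) = affineSpan ℝ (simplexProduct m))
    (j : Fin m) : (cayleyCell σ j).Nonempty := by
  by_contra hcon
  have hne : ∀ a, (a, j) ∉ σ := fun a ha => hcon ⟨a, by simpa using ha⟩
  let f : (Fin 3 → ℝ) × (Fin m → ℝ) →ₗ[ℝ] ℝ := LinearMap.proj j ∘ₗ LinearMap.snd ℝ _ _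
  have h1 : ∀ z ∈ cellPolytope σ, f z = 0 := by
    intro z hz
    obtain ⟨w, -, h2, -, rfl⟩ := mem_cellPolytope_iff.1 hz
    rw [sum_smul_prodVertex]
    show ∑ a, w (a, j) = 0
    exact Finset.sum_eq_zero fun a _ => h2 _ (hne a)
  have h2 : prodVertex m (0, j) ∈ affineSpan ℝ (cellPolytope σ) := by
    rw [h]
    exact subset_affineSpan ℝ _ (prodVertex_mem_simplexProduct _)
  have h3 := f.eq_of_mem_affineSpan h1 h2
  simp [f, prodVertex] at h3

/-- A functional that is constant on the Minkowski cell of a full-dimensional cell is constant. -/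
theorem const_of_cayleyCell (h : affineSpan ℝ (cellPolytope σ) = affineSpan ℝ (simplexProduct m))
    {w : Fin 3 → ℝ} {k : ℝ} (hw : ∀ x ∈ (cayleyCell σ).polytope, ∑ a, w a * x a = k) (i : Fin m)
    (a b : Fin 3) : w a = w b := by
  choose v hv using cayleyCell_nonempty h
  have hval : ∀ v : Fin m → Fin 3, (∀ j, v j ∈ cayleyCell σ j) → ∑ j, w (v j) = k := by
    intro v hv
    rw [← hw _ (sum_vertices_mem hv)]
    simp only [card_filter_eq_sum, Finset.mul_sum]
    rw [Finset.sum_comm]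
    simp
  -- Exchanging a single vertex in the sum shows that `w` is constant on each summand.
  have hrow : ∀ a j, (a, j) ∈ σ → w a = w (v j) := by
    intro a j ha
    have h1 := hval v hv
    have h2 := hval (Function.update v j a) fun j' => by
      by_cases hj : j' = j
      · subst hj; simpa using ha
      · rw [Function.update_of_ne hj]; exact hv j'
    rw [← Finset.add_sum_erase _ _ (Finset.mem_univ j)] at h1 h2
    rw [Function.update_self, Finset.sum_congr rfl fun j' hj' => by
      rw [Function.update_of_ne (Finset.ne_of_mem_erase hj')]] at h2
    linarith
  -- The functional subtracts these constants, so it vanishes on the vertices of `σ`, and by full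
  -- dimension on all vertices of the product.
  let f : (Fin 3 → ℝ) × (Fin m → ℝ) →ₗ[ℝ] ℝ :=
    (∑ a, w a • LinearMap.proj a) ∘ₗ LinearMap.fst ℝ _ _ -
      (∑ j, w (v j) • LinearMap.proj j) ∘ₗ LinearMap.snd ℝ _ _
  have hf : ∀ p, f (prodVertex m p) = w p.1 - w (v p.2) := by
    intro p
    simp [f, prodVertex, Pi.single_apply]
  have h1 : ∀ z ∈ cellPolytope σ, f z = 0 := by
    intro z hz
    obtain ⟨u, -, h2, -, rfl⟩ := mem_cellPolytope_iff.1 hz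
    rw [map_sum]
    refine Finset.sum_eq_zero fun p _ => ?_
    rw [map_smul, hf, smul_eq_mul]
    by_cases hp : p ∈ σ
    · rw [hrow p.1 p.2 hp, sub_self, mul_zero]
    · rw [h2 p hp, zero_mul]
  have h2 : ∀ a, w a = w (v i) := by
    intro a
    have h3 : prodVertex m (a, i) ∈ affineSpan ℝ (cellPolytope σ) := by
      rw [h]
      exact subset_affineSpan ℝ _ (prodVertex_mem_simplexProduct _)
    have h4 := f.eq_of_mem_affineSpan h1 h3
    rw [hf] at h4
    linarith
  rw [h2 a, h2 b]

/-- Otherwise some functional vanishes on all directions of the Minkowski cell but not on `x - x₀`.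
By `const_of_cayleyCell` it is a multiple of the sum of the coordinates, which is equal at `x` and
`x₀`. -/
theorem affineSpan_cayleyCell (hm : 0 < m)
    (h : affineSpan ℝ (cellPolytope σ) = affineSpan ℝ (simplexProduct m)) :
    affineSpan ℝ (cayleyCell σ).polytope = affineSpan ℝ (dilatedTriangle m) := by
  choose v hv using cayleyCell_nonempty h
  have hx0 := sum_vertices_mem hv
  set x₀ : Fin 3 → ℝ := fun a => ((Finset.univ.filter fun j => v j = a).card : ℝ) with hx₀
  have hsub : (cayleyCell σ).polytope ⊆ dilatedTriangle m := by
    intro x hx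
    obtain ⟨W, hW⟩ := mem_polytope_iff.1 hx
    refine mem_dilatedTriangle_iff.2 ⟨fun a => ?_, sum_eq_of_mem hx⟩
    rw [← hW.sum_eq]
    exact Finset.sum_nonneg fun j _ => hW.nonneg j a
  refine le_antisymm (affineSpan_mono ℝ hsub) ?_
  rw [affineSpan_le]
  intro x hx
  by_contra hcon
  have hx0' : x₀ ∈ affineSpan ℝ (cayleyCell σ).polytope := subset_affineSpan ℝ _ hx0
  have hnot : x - x₀ ∉ (affineSpan ℝ (cayleyCell σ).polytope).direction := fun h' =>
    hcon ((AffineSubspace.vsub_right_mem_direction_iff_mem hx0' x).1 h')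
  obtain ⟨f, hf1, hf2⟩ := Submodule.exists_le_ker_of_notMem hnot
  have hfw : ∀ z : Fin 3 → ℝ, f z = ∑ a, f (Pi.single a 1) * z a := by
    intro z
    conv_lhs => rw [show z = ∑ a, z a • (Pi.single a 1 : Fin 3 → ℝ) by
      ext b; simp [Finset.sum_apply, Pi.single_apply]]
    rw [map_sum]
    refine Finset.sum_congr rfl fun a _ => ?_
    rw [map_smul, smul_eq_mul, mul_comm]
  have hconst := const_of_cayleyCell h (w := fun a => f (Pi.single a 1)) (k := f x₀)
    (fun y hy => by
      rw [← hfw]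
      have h1 : y - x₀ ∈ (affineSpan ℝ (cayleyCell σ).polytope).direction :=
        (AffineSubspace.vsub_right_mem_direction_iff_mem hx0' y).2 (subset_affineSpan ℝ _ hy)
      have h2 : f (y - x₀) = 0 := hf2 h1
      rw [map_sub] at h2
      linarith) ⟨0, hm⟩
  apply hf1
  rw [hfw]
  simp only [hconst _ 0, ← Finset.mul_sum, Pi.sub_apply, Finset.sum_sub_distrib]
  rw [sum_eq_of_mem hx0, (mem_dilatedTriangle_iff.1 hx).2, sub_self, mul_zero]

/-- The common face of two cells of a subdivision that meets the slice. -/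
theorem exposed_of_slicePoint (hm : 0 < m)
    (hexp : IsExposed ℝ (cellPolytope σ) (cellPolytope σ ∩ cellPolytope τ))
    {x : Fin 3 → ℝ} (hx : slicePoint m x ∈ cellPolytope σ) (hx' : slicePoint m x ∈ cellPolytope τ) :
    MixedCell.IsFace (fun j => cayleyCell σ j ∩ cayleyCell τ j) (cayleyCell σ) ∧
      x ∈ MixedCell.polytope fun j => cayleyCell σ j ∩ cayleyCell τ j := by
  have hm' : (m : ℝ) ≠ 0 := by positivity
  obtain ⟨l, hl⟩ := hexp ⟨_, hx, hx'⟩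
  have hmax : ∀ z, z ∈ cellPolytope σ ∧ z ∈ cellPolytope τ ↔
      z ∈ cellPolytope σ ∧ ∀ y ∈ cellPolytope σ, l y ≤ l z := fun z => Set.ext_iff.1 hl z
  have hxmax := ((hmax _).1 ⟨hx, hx'⟩).2
  set μ := l (slicePoint m x)
  obtain ⟨w, h1, h2, h3, h4⟩ := mem_cellPolytope_iff.1 hx
  -- the weights are supported on the common face
  have hw : ∀ p, w p ≠ 0 → l (prodVertex m p) = μ := by
    have hsum : ∑ p, w p * (μ - l (prodVertex m p)) = 0 := by
      have h5 : μ = ∑ p, w p * l (prodVertex m p) := by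
        show l (slicePoint m x) = _
        rw [← h4, map_sum]
        simp
      simp only [mul_sub, Finset.sum_sub_distrib]
      rw [← Finset.sum_mul, h3, one_mul, ← h5, sub_self]
    have hnn : ∀ p ∈ Finset.univ, 0 ≤ w p * (μ - l (prodVertex m p)) := by
      intro p _
      by_cases hp : p ∈ σ
      · exact mul_nonneg (h1 p) (sub_nonneg.2 (hxmax _ (prodVertex_mem_cellPolytope hp)))
      · rw [h2 p hp, zero_mul]
    intro p hp
    have := (Finset.sum_eq_zero_iff_of_nonneg hnn).1 hsum p (Finset.mem_univ p)
    have := (mul_eq_zero.1 this).resolve_left hp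
    linarith
  have hmem : ∀ p ∈ σ, p ∈ τ ↔ l (prodVertex m p) = μ := by
    intro p hp
    have hpσ := prodVertex_mem_cellPolytope hp
    constructor
    · intro hpτ
      exact le_antisymm (hxmax _ hpσ)
        (((hmax _).1 ⟨hpσ, prodVertex_mem_cellPolytope hpτ⟩).2 _ hx)
    · intro h
      refine mem_of_prodVertex_mem ((hmax _).2 ⟨hpσ, fun y hy => ?_⟩).2
      rw [h]
      exact hxmax y hy
  have hweight := slicePoint_weights hm h1 h2 h4
  have hsupp : ∀ p, w p ≠ 0 → p ∈ σ ∧ p ∈ τ := by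
    intro p hp
    have hpσ : p ∈ σ := by
      by_contra h
      exact hp (h2 p h)
    exact ⟨hpσ, (hmem p hpσ).2 (hw p hp)⟩
  refine ⟨⟨fun a => -l (Pi.single a 1, 0), fun j a => ?_⟩, mem_polytope_iff.2
    ⟨_, hweight.nonneg, fun j a ha => ?_, hweight.sum_eq_one, hweight.sum_eq⟩⟩
  -- The slice point has weight in every summand `j`, so the maximum of `l` is attained there. For
  -- fixed `j`, `l` differs by a constant from its value on the first factor, so one functional on
  -- the first factor selects the face in all summands.
  · obtain ⟨b₀, hb₀⟩ : ∃ b, w (b, j) ≠ 0 := by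
      by_contra hcon
      push Not at hcon
      have := hweight.sum_eq_one j
      simp [hcon] at this
    have hl0 : ∀ b, l (prodVertex m (b, j)) = l (Pi.single b 1, 0) + l (0, Pi.single j 1) := by
      intro b
      rw [← map_add]
      simp [prodVertex]
    have hb₀' := hw _ hb₀
    have hb₀σ := (hsupp _ hb₀).1
    rw [Finset.mem_inter, mem_cayleyCell, mem_cayleyCell]
    refine and_congr_right fun ha => ?_
    rw [hmem _ ha]
    constructor
    · intro h b hb
      have := hxmax _ (prodVertex_mem_cellPolytope (mem_cayleyCell.1 hb))
      rw [hl0] at this h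
      linarith
    · intro h
      have h5 := h b₀ (mem_cayleyCell.2 hb₀σ)
      have h6 := hxmax _ (prodVertex_mem_cellPolytope ha)
      rw [hl0] at h6 hb₀' ⊢
      linarith
  · by_contra hne
    have := hsupp (a, j) fun h => hne (by rw [h, mul_zero])
    exact ha (Finset.mem_inter.2 ⟨mem_cayleyCell.2 this.1, mem_cayleyCell.2 this.2⟩)

theorem IsPolytopalSubdivision.isMixedSubdivision_cayley (hm : 0 < m)
    {S : Finset (Finset (Fin 3 × Fin m))} (hS : IsPolytopalSubdivision S) :
    IsMixedSubdivision (cayley S) := by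
  obtain ⟨h1, h2, h3⟩ := hS
  refine ⟨fun c hc => ?_, ?_, fun c hc d hd => ?_⟩
  · obtain ⟨σ, hσ, rfl⟩ := mem_cayley.1 hc
    exact ⟨cayleyCell_nonempty (h1 σ hσ), affineSpan_cayleyCell hm (h1 σ hσ)⟩
  · ext x
    rw [mem_dilatedTriangle_iff_slicePoint hm, ← h2]
    simp only [Set.mem_iUnion, mem_cayley, exists_prop]
    constructor
    · rintro ⟨_, ⟨σ, hσ, rfl⟩, hx⟩
      exact ⟨σ, hσ, (mem_polytope_cayleyCell_iff hm).1 hx⟩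
    · rintro ⟨σ, hσ, hx⟩
      exact ⟨_, ⟨σ, hσ, rfl⟩, (mem_polytope_cayleyCell_iff hm).2 hx⟩
  · obtain ⟨σ, hσ, rfl⟩ := mem_cayley.1 hc
    obtain ⟨τ, hτ, rfl⟩ := mem_cayley.1 hd
    rcases Set.eq_empty_or_nonempty ((cayleyCell σ).polytope ∩ (cayleyCell τ).polytope) with
      h | ⟨x, hx, hx'⟩
    · exact Or.inl h
    right
    have key : ∀ {σ τ}, σ ∈ S → τ ∈ S → ∀ {x}, x ∈ (cayleyCell σ).polytope →
        x ∈ (cayleyCell τ).polytope →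
        MixedCell.IsFace (fun j => cayleyCell σ j ∩ cayleyCell τ j) (cayleyCell σ) ∧
          x ∈ MixedCell.polytope fun j => cayleyCell σ j ∩ cayleyCell τ j :=
      fun hσ hτ _ hx hx' => exposed_of_slicePoint hm (h3 _ hσ _ hτ)
        ((mem_polytope_cayleyCell_iff hm).1 hx) ((mem_polytope_cayleyCell_iff hm).1 hx')
    refine ⟨_, (key hσ hτ hx hx').1, ?_, ?_⟩
    · have := (key hτ hσ hx' hx).1
      simpa only [Finset.inter_comm] using this
    · refine Set.Subset.antisymm (fun y hy => (key hσ hτ hy.1 hy.2).2) fun y hy => ⟨?_, ?_⟩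
      · exact polytope_mono (fun j => Finset.inter_subset_left) hy
      · exact polytope_mono (fun j => Finset.inter_subset_right) hy

theorem mixedRefines_cayley {S S' : Finset (Finset (Fin 3 × Fin m))} (h : Refines S' S) :
    MixedRefines (cayley S') (cayley S) := by
  intro c hc
  obtain ⟨τ, hτ, rfl⟩ := mem_cayley.1 hc
  obtain ⟨σ, hσ, hsub⟩ := h τ hτ
  refine ⟨_, mem_cayley.2 ⟨σ, hσ, rfl⟩, fun j a ha => ?_⟩
  rw [mem_cayleyCell] at ha ⊢
  exact subset_of_cellPolytope_subset hsub ha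

end

open MixedCell

section

variable {m : ℕ} {σ : Finset (Fin 3 × Fin m)}

/-- The sums of the coordinates in the two factors. -/
noncomputable def coordinateSums (m : ℕ) : (Fin 3 → ℝ) × (Fin m → ℝ) →ₗ[ℝ] ℝ × ℝ :=
  LinearMap.prodMap (∑ a, LinearMap.proj a) (∑ j, LinearMap.proj j)

theorem coordinateSums_apply (z : (Fin 3 → ℝ) × (Fin m → ℝ)) :
    coordinateSums m z = (∑ a, z.1 a, ∑ j, z.2 j) := by
  simp [coordinateSums]

theorem vectorSpan_simplexProduct (hm : 0 < m) :
    vectorSpan ℝ (simplexProduct m) = LinearMap.ker (coordinateSums m) := by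
  apply le_antisymm
  · rw [vectorSpan_def, Submodule.span_le]
    rintro _ ⟨⟨x, u⟩, ⟨hx, hu⟩, ⟨y, v⟩, ⟨hy, hv⟩, rfl⟩
    have h1 := hx.2
    have h2 := hu.2
    have h3 := hy.2
    have h4 := hv.2
    simp only at h1 h2 h3 h4
    simp [coordinateSums_apply, h1, h2, h3, h4]
  · rintro ⟨x, u⟩ h
    rw [LinearMap.mem_ker, coordinateSums_apply, Prod.mk_eq_zero] at h
    obtain ⟨hx, hu⟩ := h
    simp only at hx hu
    let i : Fin m := ⟨0, hm⟩
    have hmem : ∀ p q, prodVertex m p - prodVertex m q ∈ vectorSpan ℝ (simplexProduct m) :=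
      fun p q => vsub_mem_vectorSpan ℝ (prodVertex_mem_simplexProduct p)
        (prodVertex_mem_simplexProduct q)
    have h : ((x, u) : (Fin 3 → ℝ) × (Fin m → ℝ)) =
        ∑ a, x a • (prodVertex m (a, i) - prodVertex m (0, i)) +
          ∑ j, u j • (prodVertex m (0, j) - prodVertex m (0, i)) := by
      have e1 : ∑ a, x a • (prodVertex m (a, i) - prodVertex m (0, i)) = (x, 0) := by
        simp only [smul_sub, Finset.sum_sub_distrib, ← Finset.sum_smul, hx, zero_smul, sub_zero]
        ext b
        · simp [prodVertex, Prod.fst_sum, Finset.sum_apply, Pi.single_apply]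
        · simp [prodVertex, Prod.snd_sum, ← Finset.sum_mul, hx]
      have e2 : ∑ j, u j • (prodVertex m (0, j) - prodVertex m (0, i)) = (0, u) := by
        simp only [smul_sub, Finset.sum_sub_distrib, ← Finset.sum_smul, hu, zero_smul, sub_zero]
        ext b
        · simp [prodVertex, Prod.fst_sum, ← Finset.sum_mul, hu]
        · simp [prodVertex, Prod.snd_sum, Finset.sum_apply, Pi.single_apply]
      rw [e1, e2]
      simp
    rw [h]
    exact Submodule.add_mem _ (Submodule.sum_mem _ fun a _ => Submodule.smul_mem _ _ (hmem _ _))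
      (Submodule.sum_mem _ fun j _ => Submodule.smul_mem _ _ (hmem _ _))

theorem finrank_vectorSpan_simplexProduct (hm : 0 < m) :
    Module.finrank ℝ (vectorSpan ℝ (simplexProduct m)) = m + 1 := by
  rw [vectorSpan_simplexProduct hm]
  have h1 := (coordinateSums m).finrank_range_add_finrank_ker
  have h2 : LinearMap.range (coordinateSums m) = ⊤ := by
    rw [LinearMap.range_eq_top]
    rintro ⟨s, t⟩
    refine ⟨(Pi.single 0 s, Pi.single ⟨0, hm⟩ t), ?_⟩
    simp [coordinateSums_apply]
  rw [h2, finrank_top] at h1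
  simp only [Module.finrank_prod, Module.finrank_self, Module.finrank_fin_fun] at h1
  omega

theorem card_eq_of_affineIndependent (hm : 0 < m)
    (h : affineSpan ℝ (cellPolytope σ) = affineSpan ℝ (simplexProduct m))
    (hσ : AffineIndependent ℝ fun p : σ => prodVertex m p) : σ.card = m + 2 := by
  have hne : 0 < σ.card := by
    obtain ⟨a, ha⟩ := cayleyCell_nonempty h ⟨0, hm⟩
    exact Finset.card_pos.2 ⟨_, mem_cayleyCell.1 ha⟩
  have h1 := hσ.finrank_vectorSpan (n := σ.card - 1) (by rw [Fintype.card_coe]; omega)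
  have h2 : Set.range (fun p : σ => prodVertex m p) = prodVertex m '' (σ : Set (Fin 3 × Fin m)) := by
    ext z; simp
  rw [h2, ← direction_affineSpan, ← affineSpan_convexHull] at h1
  have h3 := finrank_vectorSpan_simplexProduct hm
  rw [← direction_affineSpan, ← h] at h3
  have : m + 1 = σ.card - 1 := h3.symm.trans h1
  omega

theorem sum_card_cayleyCell (σ : Finset (Fin 3 × Fin m)) : ∑ j, (cayleyCell σ j).card = σ.card := by
  have h : σ.card = ∑ p, if p ∈ σ then 1 else 0 := by simp
  rw [h, Fintype.sum_prod_type_right]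
  refine Finset.sum_congr rfl fun j _ => ?_
  rw [cayleyCell, Finset.card_filter]

/-- The `m + 2` vertices are distributed over `m` nonempty summands, which leaves an excess of two.
-/
theorem IsTriangulation.isFineMixedSubdivision_cayley (hm : 0 < m)
    {S : Finset (Finset (Fin 3 × Fin m))} (hS : IsTriangulation S) :
    IsFineMixedSubdivision (cayley S) := by
  refine ⟨hS.1.isMixedSubdivision_cayley hm, fun c hc => ?_⟩
  obtain ⟨σ, hσ, rfl⟩ := mem_cayley.1 hc
  have h1 := card_eq_of_affineIndependent hm (hS.1.1 σ hσ) (hS.2 σ hσ)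
  rw [← sum_card_cayleyCell] at h1
  have h2 : ∑ j, ((cayleyCell σ j).card - 1) + ∑ _j : Fin m, 1 = ∑ j, (cayleyCell σ j).card := by
    rw [← Finset.sum_add_distrib]
    refine Finset.sum_congr rfl fun j _ => Nat.sub_add_cancel ?_
    exact (cayleyCell_nonempty (hS.1.1 σ hσ) j).card_pos
  simp only [Finset.sum_const, Finset.card_univ, Fintype.card_fin, smul_eq_mul, mul_one] at h2
  omega

end

theorem proposition4p5 (n : ℕ) (hn : 4 ≤ n) :
    -- polytopal subdivisions of the product of simplices
    (∀ S : Finset (Finset (Fin 3 × Fin (n - 3))), IsPolytopalSubdivision S →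
      IsMixedSubdivision (cayley S) ∧
      IsAbstractTreeArrangement (Finset.univ : Finset (TreeLabel (n - 3))) (mixedTree (cayley S)) ∧
      ∀ S' : Finset (Finset (Fin 3 × Fin (n - 3))), IsTriangulation S' → Refines S' S →
        IsFineMixedSubdivision (cayley S') ∧
        ∀ l, (mixedTree (cayley S) l).IsContractionOf (mixedTree (cayley S') l)) ∧
    -- mixed subdivisions of the dilated triangle
    (∀ M : Finset (MixedCell (n - 3)), IsMixedSubdivision M →
      IsAbstractTreeArrangement (Finset.univ : Finset (TreeLabel (n - 3))) (mixedTree M) ∧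
      ∀ M' : Finset (MixedCell (n - 3)), IsFineMixedSubdivision M' → MixedRefines M' M →
        ∀ l, (mixedTree M l).IsContractionOf (mixedTree M' l)) := by
  have hm : 0 < n - 3 := by omega
  refine ⟨fun S hS => ⟨hS.isMixedSubdivision_cayley hm,
    (hS.isMixedSubdivision_cayley hm).isAbstractTreeArrangement_mixedTree hm, fun S' hS' h =>
      ⟨hS'.isFineMixedSubdivision_cayley hm, fun l => ?_⟩⟩,
    fun M hM => ⟨hM.isAbstractTreeArrangement_mixedTree hm, fun M' hM' h l =>
      hM.isContractionOf_mixedTree hM'.1 h hm l⟩⟩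
  exact (hS.isMixedSubdivision_cayley hm).isContractionOf_mixedTree
    (hS'.1.isMixedSubdivision_cayley hm) (mixedRefines_cayley h) hm l
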